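/- Setting. Let $\mathcal T\subset\mathbb R^d$ be compact, $\langle f,g\rangle=\int_{\mathcal T}fg$ the inner product of $L^2(\mathcal T)$ (Lebesgue measure), and $K$ a bounded (measurable) symmetric nonnegative definite kernel on $\mathcal T$ whose integral operator has a complete orthonormal system of eigenfunctions $(\psi_l)$ with eigenvalues $\theta_l\ge 0$. Put $\|f\|_{\mathcal H(K)}^2=\sum_l\langle f,\psi_l\rangle^2/\theta_l$ (a term with $\theta_l=0$ counts as $0$ if $\langle f,\psi_l\rangle=0$ and as $\infty$ otherwise), $\mathcal H(K)=\{f\in L^2(\mathcal T):\|f\|_{\mathcal H(K)}<\infty\}$, and $L_{K^{1/2}}f=\sum_l\sqrt{\theta_l}\langle f,\psi_l\rangle\psi_l$. For each (large) $n$ one observes $y_j=\langle\beta_j^*,X_j\rangle+\varepsilon_j$ and $X_j$, $1\le j\le n$. There are $\mathcal K\ge 1$ change points $0=\eta_0<\eta_1<\dots<\eta_{\mathcal K}<\eta_{\mathcal K+1}=n$, that is, $\beta^*_j\ne\beta^*_{j+1}$ if and only if $j\in\{\eta_1,\dots,\eta_{\mathcal K}\}$ (for $1\le j<n$). The slope functions,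 $\mathcal K$ and the $\eta_k$ may depend on $n$; the kernel $K$ and the sequence $(X_j,\varepsilon_j)_{j\ge1}$ do not. Let $\Sigma[f,g]=\mathbb E(\langle X_1,f\rangle\langle X_1,g\rangle)$, $\kappa_k^2=\Sigma[\beta^*_{\eta_k}-\beta^*_{\eta_{k+1}},\beta^*_{\eta_k}-\beta^*_{\eta_{k+1}}]$, $\kappa=\min_{1\le k\le\mathcal K}\kappa_k$ and $\Delta=\min_{1\le k\le\mathcal K+1}(\eta_k-\eta_{k-1})$. Assumptions. 1. The $X_j$ are random elements of $L^2(\mathcal T)$ with $\mathbb E X_j=0$, $\mathbb E\|X_j\|^2<\infty$, and for some constant $c>0$, $(\mathbb E\langle X_j,f\rangle^6)^{1/6}\le c\,(\mathbb E\langle X_j,f\rangle^2)^{1/2}<\infty$ for all $f\in L^2(\mathcal T)$. Moreover $\mathbb E[\varepsilon_j\mid X_j]=0$ and $\mathbb E\,\varepsilon_j^6<\infty$. The sequence $(X_j,\varepsilon_j)_{j\ge1}$ is strictly stationary and $\alpha$-mixing with coefficients satisfying $\sum_{k\ge1}k^{1/3}\alpha(k)^{1/3}<\infty$. 2. $\beta_j^*\in\mathcal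 H(K)$, with $\|\beta_j^*\|_{\mathcal H(K)}$ bounded uniformly in $j$ and $n$. There are an orthonormal system $(\phi_l)_{l\ge1}$ in $L^2(\mathcal T)$ and numbers $\mathfrak s_l\asymp l^{-2r}$, with a constant $r>1$, such that $\Sigma[L_{K^{1/2}}f,L_{K^{1/2}}g]=\sum_{l\ge1}\mathfrak s_l\langle f,\phi_l\rangle\langle g,\phi_l\rangle$ for all $f,g\in L^2(\mathcal T)$ (that is, $K^{1/2}\Sigma K^{1/2}=\sum_l\mathfrak s_l\,\phi_l\otimes\phi_l$). 3. For some constant $\xi>0$, as $n\to\infty$, $$\min\left\{\frac{\kappa^2\Delta^2}{n\cdot n^{1/(2r+1)}\log^{1+2\xi}(n)},\ \frac{\kappa^2\Delta^{r/(2r+1)}}{\log^{1+2\xi}(\Delta)}\right\}\to\infty .$$ Procedure. Fix $\omega>1/2$. For $0\le s<e\le n$ let $$\widehat\beta_{(s,e]}=\operatorname*{arg\,min}_{\beta\in\mathcal H(K)}\Big\{\frac1{e-s}\sum_{j=s+1}^e(y_j-\langle X_j,\beta\rangle)^2+\omega(e-s)^{-2r/(2r+1)}\|\beta\|_{\mathcal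 H(K)}^2\Big\},$$ let $R(s,e)=\sum_{j=s+1}^e(y_j-\langle X_j,\widehat\beta_{(s,e]}\rangle)^2$, and let $\widehat W^{s,e}_t=R(s,e)-R(s,t)-R(t,e)$ for $s<t<e$. The seeded intervals $\mathcal J$ are the intervals $(\lceil(i-1)n/2^k\rceil,\ \lfloor(i-1)n/2^k+n/2^{k-1}\rfloor]$ with $1\le k\le\lceil\log_2(n/\Delta)\rceil+1$ and $1\le i\le 2^k-1$. With a threshold $\tau=\tau_n$, the recursive algorithm FRBS on $(s,e]$ considers all $(s_m,e_m]\in\mathcal J$ contained in $(s,e]$ with $\max_{s_m<t<e_m}\widehat W^{s_m,e_m}_t>\tau$. If there is none, it stops. Otherwise it takes a shortest of them, records a maximiser $b$ of $t\mapsto\widehat W^{s_m,e_m}_t$ on it as an estimated change point, and continues on $(s,b]$ and on $(b,e]$. Let $\widehat\eta_1<\dots<\widehat\eta_{\widehat{\mathcal K}}$ be the points recorded by FRBS started on $(0,n]$. Theorem. Let $c_{\tau,1}>32$, $c_{\tau,2}\in(0,1/20)$ and $2<C_1<c_{\tau,1}/16$ be constants. Suppose that Assumptions 1, 2 and 3 hold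 and that, for all large $n$, $$c_{\tau,1}\Big(\frac n\Delta\Big)n^{1/(2r+1)}\log^{1+2\xi}(n)<\tau<c_{\tau,2}\,\kappa^2\Delta .$$ Then, as $n\to\infty$, with any rule for breaking ties in the algorithm, $$\mathbb P\Big(\widehat{\mathcal K}=\mathcal K\ \text{ and }\ \max_{1\le k\le\mathcal K}\kappa_k^2\,|\widehat\eta_k-\eta_k|\le C_1\Big(\frac n\Delta\Big)\Delta^{1/(2r+1)}\log^{1+2\xi}(n)\Big)\to1 .$$ -/

import Mathlib

open MeasureTheory ProbabilityTheory Filter Topology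

noncomputable section

namespace FuncReg

/-! ### The function space, kernels and the reproducing kernel Hilbert space -/

/-- `ℝᵈ`. -/
abbrev Euc (d : ℕ) : Type := EuclideanSpace ℝ (Fin d)

/-- `L²(𝒯)`, square integrable functions on `𝒯` with respect to Lebesgue measure. -/
abbrev L2 {d : ℕ} (𝒯 : Set (Euc d)) : Type := Lp ℝ 2 (volume.restrict 𝒯)

/-- Random elements of `L²(𝒯)` are taken with respect to the Borel σ-algebra. -/
instance instMeasurableSpaceL2 {d : ℕ} (𝒯 : Set (Euc d)) : MeasurableSpace (L2 𝒯) := borel _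

instance instBorelSpaceL2 {d : ℕ} (𝒯 : Set (Euc d)) : BorelSpace (L2 𝒯) := ⟨rfl⟩

/-- A bounded kernel function on `𝒯`: measurable, symmetric, bounded and nonnegative definite. -/
structure IsKernel {d : ℕ} (𝒯 : Set (Euc d)) (K : Euc d → Euc d → ℝ) : Prop where
  measurable : AEStronglyMeasurable (Function.uncurry K)
    ((volume.restrict 𝒯).prod (volume.restrict 𝒯))
  symm : ∀ u ∈ 𝒯, ∀ v ∈ 𝒯, K u v = K v u
  bounded : ∃ C : ℝ, ∀ u ∈ 𝒯, ∀ v ∈ 𝒯, |K u v| ≤ C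
  nonneg : ∀ (m : ℕ) (x : Fin m → Euc d), (∀ i, x i ∈ 𝒯) → ∀ a : Fin m → ℝ,
    0 ≤ ∑ i, ∑ j, a i * a j * K (x i) (x j)

/-- `(ψ_l, θ_l)` is a (complete, orthonormal) system of eigenfunctions and nonnegative
eigenvalues of the integral operator `f ↦ ∫_𝒯 K(·, v) f(v) dv`.  The order in which the
eigenvalues are listed plays no role. -/
structure IsEigensystem {d : ℕ} (𝒯 : Set (Euc d)) (K : Euc d → Euc d → ℝ)
    (ψ : HilbertBasis ℕ ℝ (L2 𝒯)) (θ : ℕ → ℝ) : Prop where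
  nonneg : ∀ l, 0 ≤ θ l
  eigen : ∀ l, ∀ᵐ u ∂(volume.restrict 𝒯), ∫ v in 𝒯, K u v * (ψ l : L2 𝒯) v = θ l * (ψ l : L2 𝒯) u

variable {d : ℕ} {𝒯 : Set (Euc d)}

/-- `f ∈ ℋ(K)`: the series `∑ ⟨f, ψ_l⟩² / θ_l` is finite, where a term with `θ_l = 0` counts as
`0` if `⟨f, ψ_l⟩ = 0` and as `∞` otherwise. -/
def InRKHS (ψ : HilbertBasis ℕ ℝ (L2 𝒯)) (θ : ℕ → ℝ) (f : L2 𝒯) : Prop :=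
  (∀ l, θ l = 0 → inner ℝ f (ψ l) = 0) ∧ Summable fun l => inner ℝ f (ψ l) ^ 2 / θ l

/-- `‖f‖²_{ℋ(K)} = ∑ ⟨f, ψ_l⟩² / θ_l` (for `f ∈ ℋ(K)`). -/
def rkhsNormSq (ψ : HilbertBasis ℕ ℝ (L2 𝒯)) (θ : ℕ → ℝ) (f : L2 𝒯) : ℝ :=
  ∑' l, inner ℝ f (ψ l) ^ 2 / θ l

/-- The operator `L_{K^{1/2}} f = ∑ √θ_l ⟨f, ψ_l⟩ ψ_l`. -/
def sqrtKernelOp (ψ : HilbertBasis ℕ ℝ (L2 𝒯)) (θ : ℕ → ℝ) (f : L2 𝒯) : L2 𝒯 :=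
  ∑' l, (√(θ l) * inner ℝ f (ψ l)) • ψ l

/-! ### Distributional assumptions -/

variable {Ω : Type*} [MeasurableSpace Ω]

/-- `Σ[f, g] = E(⟨X, f⟩ ⟨X, g⟩)`, the covariance form of a centred random function `X`. -/
def covForm (μ : Measure Ω) (X : Ω → L2 𝒯) (f g : L2 𝒯) : ℝ :=
  ∫ w, inner ℝ (X w) f * inner ℝ (X w) g ∂μ

/-- The strong mixing coefficient of two σ-algebras,
`sup_{A, B} |P(A ∩ B) - P(A) P(B)|`. -/
def alphaCoeff (μ : Measure Ω) (m₁ m₂ : MeasurableSpace Ω) : ℝ :=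
  sSup {x | ∃ A B : Set Ω, MeasurableSet[m₁] A ∧ MeasurableSet[m₂] B ∧
    x = |μ.real (A ∩ B) - μ.real A * μ.real B|}

/-- The σ-algebra generated by `(X_j, ε_j)` for `j ∈ S`. -/
@[reducible] def sigmaGen (X : ℕ → Ω → L2 𝒯) (ε : ℕ → Ω → ℝ) (S : Set ℕ) : MeasurableSpace Ω :=
  ⨆ j ∈ S, MeasurableSpace.comap (fun w => (X j w, ε j w)) inferInstance

/-- The mixing coefficient `α(k)` of the sequence `(X_j, ε_j)`, `j ≥ 1`. -/
def alphaMixing (μ : Measure Ω) (X : ℕ → Ω → L2 𝒯) (ε : ℕ → Ω → ℝ) (k : ℕ) : ℝ :=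
  sSup {x | ∃ t : ℕ, 1 ≤ t ∧
    x = alphaCoeff μ (sigmaGen X ε (Set.Icc 1 t)) (sigmaGen X ε (Set.Ici (t + k)))}

/-- The assumptions on the covariates `X_j` and the noise `ε_j`, `j ≥ 1`
(the values at the index `0` are irrelevant). -/
structure DataAssumption (μ : Measure Ω) (X : ℕ → Ω → L2 𝒯) (ε : ℕ → Ω → ℝ) : Prop where
  measurable_X : ∀ j, 1 ≤ j → Measurable (X j)
  measurable_ε : ∀ j, 1 ≤ j → Measurable (ε j)
  sq_integrable : ∀ j, 1 ≤ j → MemLp (X j) 2 μ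
  centered : ∀ j, 1 ≤ j → ∫ w, X j w ∂μ = 0
  sixth_moment : ∃ c : ℝ, 0 < c ∧ ∀ j, 1 ≤ j → ∀ f : L2 𝒯,
    Integrable (fun w => inner ℝ (X j w) f ^ 6) μ ∧
    (∫ w, inner ℝ (X j w) f ^ 6 ∂μ) ^ (1 / 6 : ℝ)
      ≤ c * (∫ w, inner ℝ (X j w) f ^ 2 ∂μ) ^ (1 / 2 : ℝ)
  noise_sixth_moment : ∀ j, 1 ≤ j → MemLp (ε j) 6 μ
  noise_centered : ∀ j, 1 ≤ j →
    μ[ε j | MeasurableSpace.comap (X j) inferInstance] =ᵐ[μ] 0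
  stationary : ∀ h : ℕ,
    μ.map (fun w (j : ℕ) => (X (j + 1 + h) w, ε (j + 1 + h) w))
      = μ.map (fun w (j : ℕ) => (X (j + 1) w, ε (j + 1) w))
  mixing : Summable fun k : ℕ => (k : ℝ) ^ (1 / 3 : ℝ) * alphaMixing μ X ε k ^ (1 / 3 : ℝ)

/-- `K^{1/2} Σ K^{1/2} = ∑_l 𝔰_l φ_l ⊗ φ_l` with orthonormal `φ_l` and `𝔰_l ≍ l^{-2r}`
(`l ≥ 1`; the `l`-th pair has the index `l - 1`). -/
def SpectralDecay (μ : Measure Ω) (X₁ : Ω → L2 𝒯) (ψ : HilbertBasis ℕ ℝ (L2 𝒯)) (θ : ℕ → ℝ)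
    (r : ℝ) : Prop :=
  ∃ (φ : ℕ → L2 𝒯) (𝔰 : ℕ → ℝ), Orthonormal ℝ φ ∧
    (∀ f g : L2 𝒯, HasSum (fun l => 𝔰 l * inner ℝ f (φ l) * inner ℝ g (φ l))
      (covForm μ X₁ (sqrtKernelOp ψ θ f) (sqrtKernelOp ψ θ g))) ∧
    ∃ a b : ℝ, 0 < a ∧ ∀ l : ℕ,
      a * ((l : ℝ) + 1) ^ (-2 * r) ≤ 𝔰 l ∧ 𝔰 l ≤ b * ((l : ℝ) + 1) ^ (-2 * r)

/-! ### Change points -/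

/-- `0 = η_0 < η_1 < … < η_𝒦 < η_{𝒦+1} = n` with `𝒦 ≥ 1` are the change points of the slope
functions `β_1, …, β_n`. -/
structure IsChangePoints (n : ℕ) (β : ℕ → L2 𝒯) (𝒦 : ℕ) (η : ℕ → ℕ) : Prop where
  one_le : 1 ≤ 𝒦
  zero : η 0 = 0
  last : η (𝒦 + 1) = n
  lt_succ : ∀ k ≤ 𝒦, η k < η (k + 1)
  change_iff : ∀ j, 1 ≤ j → j < n → (β j ≠ β (j + 1) ↔ ∃ k, 1 ≤ k ∧ k ≤ 𝒦 ∧ j = η k)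

/-- The squared change size `κ_k² = Σ[β_{η_k} - β_{η_{k+1}}, β_{η_k} - β_{η_{k+1}}]`. -/
def jumpSq (μ : Measure Ω) (X₁ : Ω → L2 𝒯) (β : ℕ → L2 𝒯) (η : ℕ → ℕ) (k : ℕ) : ℝ :=
  covForm μ X₁ (β (η k) - β (η (k + 1))) (β (η k) - β (η (k + 1)))

/-- `κ² = min_{1 ≤ k ≤ 𝒦} κ_k²`. -/
def minJumpSq (μ : Measure Ω) (X₁ : Ω → L2 𝒯) (β : ℕ → L2 𝒯) (𝒦 : ℕ) (η : ℕ → ℕ) : ℝ :=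
  sInf (jumpSq μ X₁ β η '' Set.Icc 1 𝒦)

/-- `Δ = min_{1 ≤ k ≤ 𝒦 + 1} (η_k - η_{k-1})`. -/
def minSpacing (𝒦 : ℕ) (η : ℕ → ℕ) : ℕ :=
  sInf ((fun k => η k - η (k - 1)) '' Set.Icc 1 (𝒦 + 1))

/-! ### The estimator and the scan statistic -/

/-- The regularisation parameter `λ_m = ω m^{-2r/(2r+1)}`. -/
def regParam (ω r : ℝ) (m : ℕ) : ℝ := ω * (m : ℝ) ^ (-(2 * r) / (2 * r + 1))

/-- The penalised least squares criterion on the interval `(s, e]`, for data `(y_j, x_j)`. -/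
def penLoss (ψ : HilbertBasis ℕ ℝ (L2 𝒯)) (θ : ℕ → ℝ) (ω r : ℝ) (y : ℕ → ℝ) (x : ℕ → L2 𝒯)
    (s e : ℕ) (b : L2 𝒯) : ℝ :=
  1 / ((e : ℝ) - s) * ∑ j ∈ Finset.Ioc s e, (y j - inner ℝ (x j) b) ^ 2
    + regParam ω r (e - s) * rkhsNormSq ψ θ b

/-- `b` minimises the criterion over `ℋ(K)`. -/
def IsPenMin (ψ : HilbertBasis ℕ ℝ (L2 𝒯)) (θ : ℕ → ℝ) (ω r : ℝ) (y : ℕ → ℝ) (x : ℕ → L2 𝒯)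
    (s e : ℕ) (b : L2 𝒯) : Prop :=
  InRKHS ψ θ b ∧ ∀ b' : L2 𝒯, InRKHS ψ θ b' →
    penLoss ψ θ ω r y x s e b ≤ penLoss ψ θ ω r y x s e b'

/-- The estimator `β̂_{(s, e]}`, the (unique) minimiser over `ℋ(K)` of the criterion. -/
def betaHat (ψ : HilbertBasis ℕ ℝ (L2 𝒯)) (θ : ℕ → ℝ) (ω r : ℝ) (y : ℕ → ℝ) (x : ℕ → L2 𝒯)
    (s e : ℕ) : L2 𝒯 :=
  Classical.epsilon (IsPenMin ψ θ ω r y x s e)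

/-- The residual sum of squares `∑_{j ∈ (s, e]} (y_j - ⟨x_j, β̂_{(s, e]}⟩)²`. -/
def rss (ψ : HilbertBasis ℕ ℝ (L2 𝒯)) (θ : ℕ → ℝ) (ω r : ℝ) (y : ℕ → ℝ) (x : ℕ → L2 𝒯)
    (s e : ℕ) : ℝ :=
  ∑ j ∈ Finset.Ioc s e, (y j - inner ℝ (x j) (betaHat ψ θ ω r y x s e)) ^ 2

/-- The scan statistic `Ŵ_t^{s, e}`. -/
def scanStat (ψ : HilbertBasis ℕ ℝ (L2 𝒯)) (θ : ℕ → ℝ) (ω r : ℝ) (y : ℕ → ℝ) (x : ℕ → L2 𝒯)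
    (s e t : ℕ) : ℝ :=
  rss ψ θ ω r y x s e - rss ψ θ ω r y x s t - rss ψ θ ω r y x t e

/-- The responses `y_j = ⟨β_j, X_j⟩ + ε_j`. -/
def response (β : ℕ → L2 𝒯) (X : ℕ → Ω → L2 𝒯) (ε : ℕ → Ω → ℝ) (w : Ω) (j : ℕ) : ℝ :=
  inner ℝ (β j) (X j w) + ε j w

/-! ### Seeded intervals and the segmentation algorithm -/

/-- The seeded intervals for `n` and `Δ`; the pair `(s, e)` stands for the interval `(s, e]`.
There are `⌈log₂(n/Δ)⌉ + 1` layers; the `k`-th one has length `n/2^{k-1}` and shift `n/2^k`. -/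
def seededIntervals (n Δ : ℕ) : Finset (ℕ × ℕ) :=
  (Finset.Icc 1 (⌈Real.logb 2 ((n : ℝ) / Δ)⌉₊ + 1)).biUnion fun k =>
    (Finset.Icc 1 (2 ^ k - 1)).image fun i : ℕ =>
      (⌈((i : ℝ) - 1) * ((n : ℝ) / 2 ^ k)⌉₊,
        ⌊((i : ℝ) - 1) * ((n : ℝ) / 2 ^ k) + (n : ℝ) / 2 ^ (k - 1)⌋₊)

/-- `b` maximises `t ↦ W s_m e_m t` over `s_m < t < e_m`, and the maximum exceeds `τ`. -/
def IsSignal (W : ℕ → ℕ → ℕ → ℝ) (τ : ℝ) (I : ℕ × ℕ) (b : ℕ) : Prop :=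
  I.1 < b ∧ b < I.2 ∧ (∀ t, I.1 < t → t < I.2 → W I.1 I.2 t ≤ W I.1 I.2 b) ∧ τ < W I.1 I.2 b

/-- `FRBS J W τ s e B`: the recursive algorithm, run on `(s, e]` with the intervals `J`, the
statistic `W` and the threshold `τ`, can return the set `B`.  Among the intervals of `J` inside
`(s, e]` whose maximal statistic exceeds `τ`, a shortest one is taken, a maximiser `b` on it is
recorded, and the algorithm continues on `(s, b]` and `(b, e]`; if there is no such interval, it
stops.  Ties are broken arbitrarily. -/
inductive FRBS (J : Finset (ℕ × ℕ)) (W : ℕ → ℕ → ℕ → ℝ) (τ : ℝ) : ℕ → ℕ → Finset ℕ → Prop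
  | finish (s e : ℕ)
      (h : ∀ I ∈ J, s ≤ I.1 → I.2 ≤ e → ∀ b, ¬ IsSignal W τ I b) : FRBS J W τ s e ∅
  | split (s e : ℕ) (I : ℕ × ℕ) (b : ℕ) (B₁ B₂ : Finset ℕ)
      (hI : I ∈ J) (hs : s ≤ I.1) (he : I.2 ≤ e) (hb : IsSignal W τ I b)
      (hmin : ∀ I' ∈ J, s ≤ I'.1 → I'.2 ≤ e → (∃ b', IsSignal W τ I' b') →
        I.2 - I.1 ≤ I'.2 - I'.1)
      (h₁ : FRBS J W τ s b B₁) (h₂ : FRBS J W τ b e B₂) :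
      FRBS J W τ s e (insert b (B₁ ∪ B₂))

/-- The algorithm always terminates with an output. -/
theorem FRBS.exists_output (J : Finset (ℕ × ℕ)) (W : ℕ → ℕ → ℕ → ℝ) (τ : ℝ) (s e : ℕ) :
    ∃ B, FRBS J W τ s e B := by
  classical
  induction h : e - s using Nat.strong_induction_on generalizing s e with
  | _ m ih =>
    let M := J.filter fun I => s ≤ I.1 ∧ I.2 ≤ e ∧ ∃ b, IsSignal W τ I b
    by_cases hM : M.Nonempty
    · obtain ⟨I, hI, hmin⟩ := M.exists_min_image (fun I => I.2 - I.1) hM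
      obtain ⟨hIJ, hs, he, b, hb⟩ := Finset.mem_filter.1 hI
      obtain ⟨B₁, h₁⟩ := ih (b - s) (by have := hb.1; have := hb.2.1; omega) s b rfl
      obtain ⟨B₂, h₂⟩ := ih (e - b) (by have := hb.1; have := hb.2.1; omega) b e rfl
      exact ⟨_, .split s e I b B₁ B₂ hIJ hs he hb
        (fun I' h1 h2 h3 h4 => hmin I' (Finset.mem_filter.2 ⟨h1, h2, h3, h4⟩)) h₁ h₂⟩
    · refine ⟨∅, .finish s e fun I h1 h2 h3 b hb => hM ⟨I, Finset.mem_filter.2 ⟨h1, h2, h3, b, hb⟩⟩⟩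

/-- `B = {η̂_1 < … < η̂_{𝒦̂}}` satisfies `𝒦̂ = 𝒦` and `κ_k² |η̂_k - η_k| ≤ bound` for
`k = 1, …, 𝒦`. -/
def Localizes (B : Finset ℕ) (𝒦 : ℕ) (η : ℕ → ℕ) (jump : ℕ → ℝ) (bound : ℝ) : Prop :=
  ∃ h : B.card = 𝒦, ∀ k : Fin 𝒦,
    jump (k + 1) * |((B.orderEmbOfFin h k : ℕ) : ℝ) - (η (k + 1) : ℝ)| ≤ bound

end FuncReg

end

/-! Writing a slope as `sqrtKernelOp ψ θ g` turns the estimator into ridge regression on the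
covariates `z_j = L_{K^{1/2}} X_j`; on an interval of length m the penalty added to the sum of
squares is `ω m^q ‖g‖²` with `q = 1 / (2r + 1)` (`exists_rss_eq`). The theorem then rests on one
comparison. On an interval without change points the residual sum of squares equals the sum of the
`ε_j²` up to an error of order `x m^q`. If a change point splits the interval into m₁ and m₂ points,
no single coefficient fits both sides, and the residual sum of squares is larger by about `κ_k² m₁
m₂ / (m₁ + m₂)` (`abs_rss_sub_le`, `le_rss_of_change`).

The rest of the deterministic part works on a `GoodSample`. The scan statistic stays below τ on an
interval whose change points all lie very close to its ends (`scan_le_of_region`), it exceeds τ on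
some seeded interval of length at most Δ around every change point (`exists_signal`), and a
maximiser on such a short interval lies within `1200 b(Δ) / κ_k²` of the change point
(`localization`). Since the algorithm takes a shortest signalling interval, every split finds one
new change point with this accuracy, and it stops exactly when none is left (`frbs_output`).

The probabilistic part shows that samples are good with probability tending to 1. Mixing and third
moments bound conditional expectations given the past in L² (`integral_condExp_sq_le_of_mixing`), so
sums of functionals of the data are mixingale sums. McLeish's argument, which decomposes each term
into martingale differences lag by lag and applies Doob's inequality to every lag, gives an
integrable majorant of all squared partial sums up to M whose mean is of order M
(`exists_majorant`). Applied to each coefficient along `φ_l`, weighted by `1 / (𝔰_l + λ)` with `λ =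
M^{-2r/(2r+1)}`, it meets the effective dimension `∑ 𝔰_l / (𝔰_l + λ)`, which is of order `M^q`;
Markov's inequality then controls all directions h and all subintervals at once
(`exists_uniform_bound`). A lower bound for the empirical covariance (`exists_lower_bound`) replaces
population norms by empirical ones.

Only intervals with an end among O(n/Δ) anchors are needed, and lengths can be grouped dyadically,
so a union bound costs `(n/Δ) log n (1/x + 1/M₀)`, where M₀ is the length below which only crude
bounds are used. With `x = (n/Δ) log^{1+ξ} n` and M₀ about `(n/Δ) log² n` this tends to 0, while x
stays a factor `log^ξ n` below the rates in the theorem; that factor absorbs every constant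
(`exists_parameters`). -/

namespace FuncReg

/-! ### Conditional expectations under strong mixing. -/

section CondExp

variable {Ω : Type*} {m₀ : MeasurableSpace Ω} {μ : Measure Ω} [IsProbabilityMeasure μ]

/-- The defining property of the conditional expectation for square integrable functions. -/
theorem integral_mul_condExp {m : MeasurableSpace Ω} (hm : m ≤ m₀) {v g : Ω → ℝ}
    (hv : MemLp v 2 μ) (hg : MemLp g 2 μ) (hgm : StronglyMeasurable[m] g) :
    ∫ w, v w * g w ∂μ = ∫ w, (μ[v | m]) w * g w ∂μ := by
  have h1 : Integrable (v * g) μ := hv.integrable_mul hg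
  have h2 := condExp_mul_of_stronglyMeasurable_right hgm h1 (hv.integrable one_le_two)
  calc ∫ w, v w * g w ∂μ = ∫ w, (μ[v * g | m]) w ∂μ := (integral_condExp hm).symm
    _ = _ := integral_congr_ae (by filter_upwards [h2] with w hw; simpa using hw)

theorem integral_condExp_mul_condExp {m m' : MeasurableSpace Ω} (hm : m' ≤ m₀) (hmm : m ≤ m')
    {v : Ω → ℝ} (hv : MemLp v 2 μ) :
    ∫ w, (μ[v | m']) w * (μ[v | m]) w ∂μ = ∫ w, (μ[v | m]) w ^ 2 ∂μ := by
  rw [← integral_mul_condExp hm hv (hv.condExp one_le_two) (stronglyMeasurable_condExp.mono hmm),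
    integral_mul_condExp (hmm.trans hm) hv (hv.condExp one_le_two) stronglyMeasurable_condExp]
  simp [sq]

/-- Increments of conditional expectations along nested σ-algebras. -/
theorem integral_condExp_sub_sq {m m' : MeasurableSpace Ω} (hm : m' ≤ m₀) (hmm : m ≤ m')
    {v : Ω → ℝ} (hv : MemLp v 2 μ) :
    ∫ w, ((μ[v | m']) w - (μ[v | m]) w) ^ 2 ∂μ
      = ∫ w, (μ[v | m']) w ^ 2 ∂μ - ∫ w, (μ[v | m]) w ^ 2 ∂μ := by
  have h' : MemLp (μ[v | m']) 2 μ := hv.condExp one_le_two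
  have h : MemLp (μ[v | m]) 2 μ := hv.condExp one_le_two
  have e : ∀ w, ((μ[v | m']) w - (μ[v | m]) w) ^ 2
      = (μ[v | m']) w ^ 2 - 2 * ((μ[v | m']) w * (μ[v | m]) w) + (μ[v | m]) w ^ 2 := by
    intro w; ring
  simp_rw [e]
  rw [integral_add, integral_sub, integral_const_mul, integral_condExp_mul_condExp hm hmm hv]
  · ring
  · exact h'.integrable_sq
  · exact (h'.integrable_mul h).const_mul 2
  · exact h'.integrable_sq.sub ((h'.integrable_mul h).const_mul 2)
  · exact h.integrable_sq

theorem integral_condExp_sq_le {m : MeasurableSpace Ω} (hm : m ≤ m₀) {v : Ω → ℝ}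
    (hv : MemLp v 2 μ) : ∫ w, (μ[v | m]) w ^ 2 ∂μ ≤ ∫ w, v w ^ 2 ∂μ := by
  have h : MemLp (μ[v | m]) 2 μ := hv.condExp one_le_two
  have e : ∫ w, (v w - (μ[v | m]) w) ^ 2 ∂μ = ∫ w, v w ^ 2 ∂μ - ∫ w, (μ[v | m]) w ^ 2 ∂μ := by
    have e : ∀ w, (v w - (μ[v | m]) w) ^ 2
      = v w ^ 2 - 2 * (v w * (μ[v | m]) w) + (μ[v | m]) w ^ 2 := by intro w; ring
    simp_rw [e]
    rw [integral_add, integral_sub, integral_const_mul,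
      integral_mul_condExp hm hv h stronglyMeasurable_condExp]
    · simp_rw [← sq]; ring
    · exact hv.integrable_sq
    · exact (hv.integrable_mul h).const_mul 2
    · exact hv.integrable_sq.sub ((hv.integrable_mul h).const_mul 2)
    · exact h.integrable_sq
  have : 0 ≤ ∫ w, (v w - (μ[v | m]) w) ^ 2 ∂μ := integral_nonneg fun w => sq_nonneg _
  linarith

omit [IsProbabilityMeasure μ] in
/-- The `L¹` norm of a centred function is twice the integral over its positivity set. -/
theorem integral_abs_eq_two_mul {Y : Ω → ℝ} (hY : Integrable Y μ) (h0 : ∫ w, Y w ∂μ = 0)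
    (hm : MeasurableSet {w | 0 < Y w}) :
    ∫ w, |Y w| ∂μ = 2 * ∫ w in {w | 0 < Y w}, Y w ∂μ := by
  have h1 : ∀ w, |Y w| = 2 * Set.indicator {w | 0 < Y w} Y w - Y w := by
    intro w
    by_cases h : 0 < Y w
    · rw [Set.indicator_of_mem (by exact h), abs_of_pos h]; ring
    · rw [Set.indicator_of_notMem (by exact h), abs_of_nonpos (not_lt.1 h)]; ring
  simp_rw [h1]
  rw [integral_sub ((hY.indicator hm).const_mul 2) hY, h0, integral_const_mul,
    integral_indicator hm, sub_zero]

/-- `α`-mixing bound for an event and a bounded function. -/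
theorem abs_setIntegral_sub_le_of_mixing {m₁ m₂ : MeasurableSpace Ω} (h₁ : m₁ ≤ m₀) (h₂ : m₂ ≤ m₀)
    {a : ℝ} (ha : ∀ A B, MeasurableSet[m₁] A → MeasurableSet[m₂] B →
      |μ.real (A ∩ B) - μ.real A * μ.real B| ≤ a)
    {x : Ω → ℝ} (hx : StronglyMeasurable[m₂] x) {b : ℝ} (hb : ∀ w, |x w| ≤ b)
    {A : Set Ω} (hA : MeasurableSet[m₁] A) :
    |∫ w in A, x w ∂μ - μ.real A * ∫ w, x w ∂μ| ≤ 2 * a * b := by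
  have hA0 := h₁ _ hA
  have hb0 : 0 ≤ b := by
    obtain ⟨w⟩ : Nonempty Ω := nonempty_of_isProbabilityMeasure μ
    exact (abs_nonneg _).trans (hb w)
  have hxm : AEStronglyMeasurable[m₀] x μ := (hx.mono h₂).aestronglyMeasurable
  have hx2 : MemLp x 2 μ := MemLp.of_bound hxm b (Eventually.of_forall hb)
  let I : Ω → ℝ := A.indicator fun _ => (1 : ℝ)
  have hI2 : MemLp I 2 μ := memLp_indicator_const 2 hA0 1 (Or.inr (measure_ne_top _ _))
  have hIi : Integrable I μ := hI2.integrable one_le_two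
  have hIint : ∫ w, I w ∂μ = μ.real A := by
    simp [I, integral_indicator hA0]
  let Y : Ω → ℝ := fun w => (μ[I | m₂]) w - μ.real A
  have hYi : Integrable Y μ := integrable_condExp.sub (integrable_const _)
  have hY0 : ∫ w, Y w ∂μ = 0 := by
    simp only [Y]
    rw [integral_sub integrable_condExp (integrable_const _), integral_condExp h₂, hIint]
    simp
  have hYm : Measurable[m₂] Y := (stronglyMeasurable_condExp.measurable).sub_const _
  have hD : MeasurableSet[m₂] {w | 0 < Y w} := measurableSet_lt measurable_const hYm
  -- Y is the centred conditional probability of A given `m₂`. Its positivity set lies in `m₂`, so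
  -- half of its L¹ norm is a mixing difference of two events.
  have hYabs : ∫ w, |Y w| ∂μ ≤ 2 * a := by
    rw [integral_abs_eq_two_mul hYi hY0 (h₂ _ hD)]
    have e : ∫ w in {w | 0 < Y w}, Y w ∂μ
        = μ.real (A ∩ {w | 0 < Y w}) - μ.real A * μ.real {w | 0 < Y w} := by
      change ∫ w in {w | 0 < Y w}, ((μ[I | m₂]) w - μ.real A) ∂μ = _
      rw [integral_sub integrable_condExp.integrableOn (integrable_const _),
        setIntegral_condExp h₂ hIi hD, setIntegral_indicator hA0, setIntegral_const,
        setIntegral_const, smul_eq_mul, smul_eq_mul, mul_one, Set.inter_comm A,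
        mul_comm (μ.real A)]
    rw [e]
    have := (abs_le.1 (ha A _ hA hD)).2
    linarith
  have e1 : ∫ w in A, x w ∂μ = ∫ w, (μ[I | m₂]) w * x w ∂μ := by
    rw [← integral_mul_condExp h₂ hI2 hx2 hx, ← integral_indicator hA0]
    congr 1; ext w
    by_cases h : w ∈ A <;> simp [I, h]
  have e2 : ∫ w in A, x w ∂μ - μ.real A * ∫ w, x w ∂μ = ∫ w, Y w * x w ∂μ := by
    rw [e1, ← integral_const_mul, ← integral_sub]
    · simp [Y, sub_mul]
    · exact (hI2.condExp one_le_two).integrable_mul hx2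
    · exact (hx2.integrable one_le_two).const_mul _
  rw [e2]
  calc |∫ w, Y w * x w ∂μ| ≤ ∫ w, |Y w * x w| ∂μ := abs_integral_le_integral_abs
    _ ≤ ∫ w, |Y w| * b ∂μ := by
        refine integral_mono_of_nonneg (Eventually.of_forall fun _ => abs_nonneg _)
          (hYi.abs.mul_const b) (Eventually.of_forall fun w => ?_)
        simp only [abs_mul]
        exact mul_le_mul_of_nonneg_left (hb w) (abs_nonneg _)
    _ ≤ 2 * a * b := by
        rw [integral_mul_const]; exact mul_le_mul_of_nonneg_right hYabs hb0

/-- Conditional expectations of bounded functions under mixing. -/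
theorem integral_condExp_sub_sq_le_of_bounded {m₁ m₂ : MeasurableSpace Ω} (h₁ : m₁ ≤ m₀)
    (h₂ : m₂ ≤ m₀) {a : ℝ} (ha : ∀ A B, MeasurableSet[m₁] A → MeasurableSet[m₂] B →
      |μ.real (A ∩ B) - μ.real A * μ.real B| ≤ a)
    {x : Ω → ℝ} (hx : StronglyMeasurable[m₂] x) {b : ℝ} (hb : ∀ w, |x w| ≤ b) :
    ∫ w, ((μ[x | m₁]) w - ∫ w', x w' ∂μ) ^ 2 ∂μ ≤ 8 * a * b ^ 2 := by
  have hb0 : 0 ≤ b := by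
    obtain ⟨w⟩ : Nonempty Ω := nonempty_of_isProbabilityMeasure μ
    exact (abs_nonneg _).trans (hb w)
  have hxm : AEStronglyMeasurable[m₀] x μ := (hx.mono h₂).aestronglyMeasurable
  have hx2 : MemLp x 2 μ := MemLp.of_bound hxm b (Eventually.of_forall hb)
  have hxi := hx2.integrable one_le_two
  let Z : Ω → ℝ := fun w => (μ[x | m₁]) w - ∫ w', x w' ∂μ
  have hZi : Integrable Z μ := integrable_condExp.sub (integrable_const _)
  have hZ0 : ∫ w, Z w ∂μ = 0 := by
    simp only [Z]
    rw [integral_sub integrable_condExp (integrable_const _), integral_condExp h₁]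
    simp
  have hZm : Measurable[m₁] Z := (stronglyMeasurable_condExp.measurable).sub_const _
  have hD : MeasurableSet[m₁] {w | 0 < Z w} := measurableSet_lt measurable_const hZm
  have hZabs : ∫ w, |Z w| ∂μ ≤ 4 * a * b := by
    rw [integral_abs_eq_two_mul hZi hZ0 (h₁ _ hD)]
    have e : ∫ w in {w | 0 < Z w}, Z w ∂μ
        = ∫ w in {w | 0 < Z w}, x w ∂μ - μ.real {w | 0 < Z w} * ∫ w, x w ∂μ := by
      simp only [Z]
      rw [integral_sub integrable_condExp.integrableOn (integrable_const _),
        setIntegral_condExp h₁ hxi hD, setIntegral_const, smul_eq_mul]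
    rw [e]
    have := (abs_le.1 (abs_setIntegral_sub_le_of_mixing h₁ h₂ ha hx hb hD)).2
    linarith
  have hbd : ∀ᵐ w ∂μ, |(μ[x | m₁]) w| ≤ b := by
    exact ae_bdd_abs_condExp_of_ae_bdd_abs (Eventually.of_forall hb)
  have hmean : |∫ w, x w ∂μ| ≤ b := by
    calc |∫ w, x w ∂μ| ≤ ∫ w, |x w| ∂μ := abs_integral_le_integral_abs
      _ ≤ ∫ _, b ∂μ := integral_mono hxi.abs (integrable_const _) hb
      _ = b := by simp
  calc ∫ w, Z w ^ 2 ∂μ ≤ ∫ w, 2 * b * |Z w| ∂μ := by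
        refine integral_mono_of_nonneg (Eventually.of_forall fun _ => sq_nonneg _)
          (hZi.abs.const_mul _) ?_
        filter_upwards [hbd] with w hw
        have : |Z w| ≤ 2 * b := (abs_sub _ _).trans (by linarith)
        rw [← sq_abs (Z w), sq]
        exact mul_le_mul_of_nonneg_right this (abs_nonneg _)
    _ = 2 * b * ∫ w, |Z w| ∂μ := integral_const_mul _ _
    _ ≤ 2 * b * (4 * a * b) := mul_le_mul_of_nonneg_left hZabs (by positivity)
    _ = 8 * a * b ^ 2 := by ring

theorem memLp_two_of_integrable_abs_pow_three {ξ : Ω → ℝ} (hm : AEStronglyMeasurable ξ μ)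
    (h3 : Integrable (fun w => |ξ w| ^ 3) μ) : MemLp ξ 2 μ := by
  rw [memLp_two_iff_integrable_sq hm]
  refine Integrable.mono' ((integrable_const (1 : ℝ)).add h3) (hm.pow 2)
    (Eventually.of_forall fun w => ?_)
  simp only [Pi.add_apply, Real.norm_eq_abs, abs_pow]
  have := abs_nonneg (ξ w)
  nlinarith [mul_nonneg this (sq_nonneg (|ξ w| - 1)), sq_nonneg (|ξ w| - 1)]

/-- Truncation at the level `b = k / t`. The bounded part contributes `8 t³ b² = 8 t k²` by mixing,
the tail at most `k³ / b = t k²` by the third moment, and splitting the square costs a factor 2: `2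
* (8 + 1) = 18`. -/
theorem integral_condExp_sq_le_of_mixing_aux {m₁ m₂ : MeasurableSpace Ω} (h₁ : m₁ ≤ m₀)
    (h₂ : m₂ ≤ m₀) {ξ : Ω → ℝ} (hξ : StronglyMeasurable[m₂] ξ)
    (h3 : Integrable (fun w => |ξ w| ^ 3) μ) (h0 : ∫ w, ξ w ∂μ = 0) {t k : ℝ} (ht : 0 < t)
    (hk : 0 < k) (ha : ∀ A B, MeasurableSet[m₁] A → MeasurableSet[m₂] B →
      |μ.real (A ∩ B) - μ.real A * μ.real B| ≤ t ^ 3)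
    (hk3 : ∫ w, |ξ w| ^ 3 ∂μ ≤ k ^ 3) :
    ∫ w, (μ[ξ | m₁]) w ^ 2 ∂μ ≤ 18 * t * k ^ 2 := by
  have hξm : AEStronglyMeasurable[m₀] ξ μ := (hξ.mono h₂).aestronglyMeasurable
  have hξ2 : MemLp ξ 2 μ := memLp_two_of_integrable_abs_pow_three hξm h3
  set b : ℝ := k / t with hb
  have hb0 : 0 < b := div_pos hk ht
  have hS : MeasurableSet[m₂] {w | |ξ w| ≤ b} :=
    measurableSet_le (hξ.measurable.abs) measurable_const
  let x : Ω → ℝ := {w | |ξ w| ≤ b}.indicator ξ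
  let y : Ω → ℝ := {w | |ξ w| ≤ b}ᶜ.indicator ξ
  have hxy : ξ = x + y := (Set.indicator_self_add_compl _ _).symm
  have hxm : StronglyMeasurable[m₂] x := hξ.indicator hS
  have hxb : ∀ w, |x w| ≤ b := by
    intro w
    by_cases h : w ∈ {w | |ξ w| ≤ b}
    · simp only [x, Set.indicator_of_mem h]; exact h
    · simp only [x, Set.indicator_of_notMem h, abs_zero]; exact hb0.le
  have hx2 : MemLp x 2 μ := hξ2.indicator (h₂ _ hS)
  have hy2 : MemLp y 2 μ := hξ2.indicator (h₂ _ hS).compl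
  have hxi := hx2.integrable one_le_two
  have hyi := hy2.integrable one_le_two
  have hce : μ[ξ | m₁] =ᵐ[μ] fun w => ((μ[x | m₁]) w - ∫ w', x w' ∂μ)
      + (μ[fun w => y w - ∫ w', y w' ∂μ | m₁]) w := by
    have e1 : μ[ξ | m₁] =ᵐ[μ] μ[x | m₁] + μ[y | m₁] := by
      rw [hxy]; exact condExp_add hxi hyi m₁
    have e2 : μ[fun w => y w - ∫ w', y w' ∂μ | m₁]
        =ᵐ[μ] μ[y | m₁] - μ[fun _ => ∫ w', y w' ∂μ | m₁] :=
      condExp_sub hyi (integrable_const _) m₁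
    rw [condExp_const h₁] at e2
    have e3 : ∫ w, x w ∂μ + ∫ w, y w ∂μ = 0 := by
      rw [← integral_add hxi hyi, ← h0]; congr 1; rw [hxy]; rfl
    filter_upwards [e1, e2] with w hw1 hw2
    rw [hw1, hw2]
    simp only [Pi.add_apply, Pi.sub_apply]
    linarith
  have hv2 : MemLp (fun w => y w - ∫ w', y w' ∂μ) 2 μ := hy2.sub (memLp_const _)
  have hZ2 : MemLp (fun w => (μ[x | m₁]) w - ∫ w', x w' ∂μ) 2 μ :=
    (hx2.condExp one_le_two).sub (memLp_const _)
  have hV2 : MemLp (μ[fun w => y w - ∫ w', y w' ∂μ | m₁]) 2 μ := hv2.condExp one_le_two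
  have hysq : ∫ w, y w ^ 2 ∂μ ≤ k ^ 3 / b := by
    rw [le_div_iff₀ hb0, mul_comm, ← integral_const_mul]
    refine (integral_mono (hy2.integrable_sq.const_mul _) h3 fun w => ?_).trans hk3
    by_cases h : |ξ w| ≤ b
    · have : y w = 0 := Set.indicator_of_notMem (by simpa using h) _
      simp [this]
    · have : y w = ξ w := Set.indicator_of_mem (by simpa using h) _
      simp only [this]
      have h' := (not_le.1 h).le
      rw [← sq_abs]
      nlinarith [sq_nonneg (|ξ w|), mul_le_mul_of_nonneg_right h' (sq_nonneg (|ξ w|))]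
  have hvsq : ∫ w, (y w - ∫ w', y w' ∂μ) ^ 2 ∂μ ≤ ∫ w, y w ^ 2 ∂μ := by
    have e : ∀ w, (y w - ∫ w', y w' ∂μ) ^ 2
        = y w ^ 2 - (2 * ∫ w', y w' ∂μ) * y w + (∫ w', y w' ∂μ) ^ 2 := by intro w; ring
    have i1 : ∫ w, (y w - ∫ w', y w' ∂μ) ^ 2 ∂μ = ∫ w, (y w ^ 2
        - (2 * ∫ w', y w' ∂μ) * y w) ∂μ + ∫ _, (∫ w', y w' ∂μ) ^ 2 ∂μ := by
      simp_rw [e]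
      exact integral_add (hy2.integrable_sq.sub (hyi.const_mul _)) (integrable_const _)
    rw [i1, integral_sub hy2.integrable_sq (hyi.const_mul _), integral_const_mul]
    simp only [integral_const, probReal_univ, smul_eq_mul]
    nlinarith [sq_nonneg (∫ w', y w' ∂μ)]
  calc ∫ w, (μ[ξ | m₁]) w ^ 2 ∂μ
      = ∫ w, (((μ[x | m₁]) w - ∫ w', x w' ∂μ)
        + (μ[fun w => y w - ∫ w', y w' ∂μ | m₁]) w) ^ 2 ∂μ :=
        integral_congr_ae (by filter_upwards [hce] with w hw; rw [hw])
    _ ≤ ∫ w, (2 * ((μ[x | m₁]) w - ∫ w', x w' ∂μ) ^ 2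
        + 2 * (μ[fun w => y w - ∫ w', y w' ∂μ | m₁]) w ^ 2) ∂μ := by
        refine integral_mono (hZ2.add hV2).integrable_sq
          ((hZ2.integrable_sq.const_mul 2).add (hV2.integrable_sq.const_mul 2)) fun w => ?_
        simp only
        nlinarith [sq_nonneg (((μ[x | m₁]) w - ∫ w', x w' ∂μ)
          - (μ[fun w => y w - ∫ w', y w' ∂μ | m₁]) w)]
    _ = 2 * ∫ w, ((μ[x | m₁]) w - ∫ w', x w' ∂μ) ^ 2 ∂μ
        + 2 * ∫ w, (μ[fun w => y w - ∫ w', y w' ∂μ | m₁]) w ^ 2 ∂μ := by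
        rw [integral_add (hZ2.integrable_sq.const_mul 2) (hV2.integrable_sq.const_mul 2),
          integral_const_mul, integral_const_mul]
    _ ≤ 2 * (8 * t ^ 3 * b ^ 2) + 2 * (k ^ 3 / b) := by
        gcongr
        · exact integral_condExp_sub_sq_le_of_bounded h₁ h₂ ha hxm hxb
        · exact (integral_condExp_sq_le h₁ hv2).trans (hvsq.trans hysq)
    _ = 18 * t * k ^ 2 := by rw [hb]; field_simp; ring

/-- Conditional expectations of functions with third moments under mixing. -/
theorem integral_condExp_sq_le_of_mixing {m₁ m₂ : MeasurableSpace Ω} (h₁ : m₁ ≤ m₀)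
    (h₂ : m₂ ≤ m₀) {ξ : Ω → ℝ} (hξ : StronglyMeasurable[m₂] ξ)
    (h3 : Integrable (fun w => |ξ w| ^ 3) μ) (h0 : ∫ w, ξ w ∂μ = 0) {t k : ℝ} (ht : 0 ≤ t)
    (hk : 0 ≤ k) (ha : ∀ A B, MeasurableSet[m₁] A → MeasurableSet[m₂] B →
      |μ.real (A ∩ B) - μ.real A * μ.real B| ≤ t ^ 3)
    (hk3 : ∫ w, |ξ w| ^ 3 ∂μ ≤ k ^ 3) :
    ∫ w, (μ[ξ | m₁]) w ^ 2 ∂μ ≤ 18 * t * k ^ 2 := by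
  -- The truncation level `k / t` needs positive t and k, so both are enlarged by δ, and δ tends to
  -- 0.
  have hlim : Tendsto (fun δ : ℝ => 18 * (t + δ) * (k + δ) ^ 2) (𝓝[>] 0)
      (𝓝 (18 * (t + 0) * (k + 0) ^ 2)) :=
    (Continuous.tendsto (by fun_prop) 0).mono_left nhdsWithin_le_nhds
  simp only [add_zero] at hlim
  refine ge_of_tendsto hlim ?_
  filter_upwards [self_mem_nhdsWithin] with δ hδ
  have hδ : 0 < δ := hδ
  exact integral_condExp_sq_le_of_mixing_aux h₁ h₂ hξ h3 h0 (by linarith) (by linarith)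
    (fun A B hA hB => (ha A B hA hB).trans (by gcongr; linarith))
    (hk3.trans (by gcongr; linarith))

end CondExp


/-! ### Maximal inequalities of Doob and McLeish. -/

section Maximal

/-- The running maximum of the absolute values of a sequence. -/
def runMax (s : ℕ → ℝ) : ℕ → ℝ
  | 0 => |s 0|
  | m + 1 => max (runMax s m) |s (m + 1)|

theorem runMax_nonneg (s : ℕ → ℝ) (m : ℕ) : 0 ≤ runMax s m := by
  cases m with
  | zero => exact abs_nonneg _
  | succ m => exact le_max_of_le_right (abs_nonneg _)

theorem abs_le_runMax (s : ℕ → ℝ) {m M : ℕ} (h : m ≤ M) : |s m| ≤ runMax s M := by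
  induction M with
  | zero => rw [Nat.le_zero.1 h]; exact le_rfl
  | succ M ih =>
    rcases Nat.of_le_succ h with h | h
    · exact (ih h).trans (le_max_left _ _)
    · rw [h]; exact le_max_right _ _

theorem runMax_le_sum (s : ℕ → ℝ) (M : ℕ) : runMax s M ≤ ∑ m ∈ Finset.range (M + 1), |s m| := by
  induction M with
  | zero => simp [runMax]
  | succ M ih =>
    rw [Finset.sum_range_succ]
    have h0 : 0 ≤ ∑ m ∈ Finset.range (M + 1), |s m| := Finset.sum_nonneg fun _ _ => abs_nonneg _
    exact max_le (ih.trans (le_add_of_nonneg_right (abs_nonneg _))) (le_add_of_nonneg_left h0)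

/-- The pathwise form of Doob's `L²` inequality. -/
theorem runMax_sq_le (s : ℕ → ℝ) (h0 : s 0 = 0) (M : ℕ) :
    runMax s M ^ 2 + 4 * ∑ k ∈ Finset.range M, runMax s k * (|s (k + 1)| - |s k|)
      ≤ 4 * s M ^ 2 := by
  -- A step that keeps the maximum changes both sides equally. A step that raises it makes the
  -- maximum equal to `|s (m + 1)|`, and the right side gains half the square of the raise in
  -- addition.
  have key : ∀ m, ∑ k ∈ Finset.range m, runMax s k * (|s (k + 1)| - |s k|)
      ≤ runMax s m * |s m| - runMax s m ^ 2 / 2 := by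
    intro m
    induction m with
    | zero => simp [runMax, h0]
    | succ m ih =>
      rw [Finset.sum_range_succ]
      have e : runMax s (m + 1) = max (runMax s m) |s (m + 1)| := rfl
      rcases le_total |s (m + 1)| (runMax s m) with h | h
      · rw [e, max_eq_left h]; nlinarith
      · rw [e, max_eq_right h]; nlinarith [sq_nonneg (runMax s m - |s (m + 1)|)]
  have := key M
  rw [← sq_abs (s M)]
  nlinarith [sq_nonneg (runMax s M - 2 * |s M|), sq_nonneg (runMax s M - |s M|)]

variable {Ω : Type*} {m₀ : MeasurableSpace Ω} {μ : Measure Ω} [IsProbabilityMeasure μ]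

theorem stronglyMeasurable_runMax {m : MeasurableSpace Ω} {s : ℕ → Ω → ℝ} {M : ℕ}
    (hs : ∀ k ≤ M, StronglyMeasurable[m] (s k)) :
    StronglyMeasurable[m] fun w => runMax (fun k => s k w) M := by
  induction M with
  | zero => exact (hs 0 le_rfl).norm
  | succ M ih =>
    exact (ih fun k hk => hs k (hk.trans M.le_succ)).sup (hs (M + 1) le_rfl).norm

omit [IsProbabilityMeasure μ] in
/-- Doob's `L²` maximal inequality for sums of martingale differences. -/
theorem exists_doob_majorant (G : ℕ → MeasurableSpace Ω) (hG : ∀ i, G i ≤ m₀) (hmono : Monotone G)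
    (d : ℕ → Ω → ℝ) (hd : ∀ i, StronglyMeasurable[G (i + 1)] (d i)) (hd2 : ∀ i, MemLp (d i) 2 μ)
    (h0 : ∀ i (g : Ω → ℝ), StronglyMeasurable[G i] g → MemLp g 2 μ → ∫ w, d i w * g w ∂μ = 0)
    (M : ℕ) :
    ∃ U : Ω → ℝ, Integrable U μ ∧
      (∀ w, ∀ m ≤ M, (∑ i ∈ Finset.range m, d i w) ^ 2 ≤ U w) ∧
      ∫ w, U w ∂μ ≤ 4 * ∑ i ∈ Finset.range M, ∫ w, d i w ^ 2 ∂μ := by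
  let s : ℕ → Ω → ℝ := fun m w => ∑ i ∈ Finset.range m, d i w
  have hs2 : ∀ m, MemLp (s m) 2 μ := fun m => memLp_finsetSum _ fun i _ => hd2 i
  have hsm : ∀ m, StronglyMeasurable[G m] (s m) := fun m =>
    Finset.stronglyMeasurable_fun_sum _ fun i hi =>
      (hd i).mono (hmono (Finset.mem_range.1 hi))
  let mx : ℕ → Ω → ℝ := fun m w => runMax (fun k => s k w) m
  have hmxm : ∀ m, StronglyMeasurable[G m] (mx m) := fun m =>
    stronglyMeasurable_runMax fun k hk => (hsm k).mono (hmono hk)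
  have hmx2 : ∀ m, MemLp (mx m) 2 μ := by
    intro m
    have : MemLp (fun w => ∑ k ∈ Finset.range (m + 1), |s k w|) 2 μ :=
      memLp_finsetSum _ fun i _ => (hs2 i).abs
    refine this.mono ((hmxm m).mono (hG m)).aestronglyMeasurable (Eventually.of_forall fun w => ?_)
    rw [Real.norm_of_nonneg (runMax_nonneg _ _)]
    exact (runMax_le_sum _ _).trans (le_abs_self _)
  have hss : ∀ m, ∫ w, s m w ^ 2 ∂μ = ∑ i ∈ Finset.range m, ∫ w, d i w ^ 2 ∂μ := by
    intro m
    induction m with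
    | zero => simp [s]
    | succ m ih =>
      rw [Finset.sum_range_succ, ← ih]
      have e : ∀ w, s (m + 1) w ^ 2 = s m w ^ 2 + 2 * (d m w * s m w) + d m w ^ 2 := by
        intro w; simp only [s, Finset.sum_range_succ]; ring
      have i1 : ∫ w, (s m w ^ 2 + 2 * (d m w * s m w) + d m w ^ 2) ∂μ
          = ∫ w, (s m w ^ 2 + 2 * (d m w * s m w)) ∂μ + ∫ w, d m w ^ 2 ∂μ :=
        integral_add ((hs2 m).integrable_sq.add (((hd2 m).integrable_mul (hs2 m)).const_mul 2))
          (hd2 m).integrable_sq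
      have i2 : ∫ w, (s m w ^ 2 + 2 * (d m w * s m w)) ∂μ
          = ∫ w, s m w ^ 2 ∂μ + ∫ w, 2 * (d m w * s m w) ∂μ :=
        integral_add (hs2 m).integrable_sq (((hd2 m).integrable_mul (hs2 m)).const_mul 2)
      simp_rw [e]
      rw [i1, i2, integral_const_mul, h0 m _ (hsm m) (hs2 m)]
      ring
  refine ⟨fun w => mx M w ^ 2, (hmx2 M).integrable_sq, fun w m hm => ?_, ?_⟩
  · rw [← sq_abs]
    exact pow_le_pow_left₀ (abs_nonneg _) (abs_le_runMax (fun k => s k w) hm) 2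
  -- The sign of `s k` makes the increment of `|s|` at least the sign times `d k`, and g is
  -- measurable for `G k`. The pathwise correction term therefore dominates a sum of integral zero.
  · let g : ℕ → Ω → ℝ := fun k w => mx k w * (if 0 ≤ s k w then 1 else -1)
    have hgm : ∀ k, StronglyMeasurable[G k] (g k) := fun k =>
      (hmxm k).mul (StronglyMeasurable.ite ((hsm k).measurable measurableSet_Ici)
        stronglyMeasurable_const stronglyMeasurable_const)
    have hg2 : ∀ k, MemLp (g k) 2 μ := by
      intro k
      refine (hmx2 k).mono ((hgm k).mono (hG k)).aestronglyMeasurable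
        (Eventually.of_forall fun w => ?_)
      simp only [g, norm_mul]
      split_ifs <;> simp
    have hdg : ∀ k, Integrable (fun w => 4 * (d k w * g k w)) μ := fun k =>
      ((hd2 k).integrable_mul (hg2 k)).const_mul 4
    have hpt : ∀ w, mx M w ^ 2 ≤ 4 * s M w ^ 2
        - ∑ k ∈ Finset.range M, 4 * (d k w * g k w) := by
      intro w
      have h1 := runMax_sq_le (fun k => s k w) (by simp [s]) M
      have h2 : ∑ k ∈ Finset.range M, d k w * g k w
          ≤ ∑ k ∈ Finset.range M, runMax (fun k => s k w) k * (|s (k + 1) w| - |s k w|) := by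
        refine Finset.sum_le_sum fun k _ => ?_
        have hp := runMax_nonneg (fun k => s k w) k
        have hsucc : s (k + 1) w = s k w + d k w := Finset.sum_range_succ _ _
        have : d k w * (if 0 ≤ s k w then 1 else -1) ≤ |s (k + 1) w| - |s k w| := by
          rw [hsucc]
          split_ifs with h
          · rw [abs_of_nonneg h]; linarith [le_abs_self (s k w + d k w)]
          · rw [abs_of_neg (not_le.1 h)]; linarith [neg_abs_le (s k w + d k w)]
        calc d k w * g k w = mx k w * (d k w * (if 0 ≤ s k w then 1 else -1)) := by
              simp only [g]; ring
          _ ≤ _ := mul_le_mul_of_nonneg_left this hp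
      rw [← Finset.mul_sum]
      simp only [mx]
      linarith
    calc ∫ w, mx M w ^ 2 ∂μ
        ≤ ∫ w, (4 * s M w ^ 2 - ∑ k ∈ Finset.range M, 4 * (d k w * g k w)) ∂μ :=
          integral_mono (hmx2 M).integrable_sq (((hs2 M).integrable_sq.const_mul 4).sub
            (integrable_finsetSum _ fun k _ => hdg k)) hpt
      _ = 4 * ∑ i ∈ Finset.range M, ∫ w, d i w ^ 2 ∂μ := by
          rw [integral_sub ((hs2 M).integrable_sq.const_mul 4)
            (integrable_finsetSum _ fun k _ => hdg k), integral_finsetSum _ fun k _ => hdg k,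
            integral_const_mul, hss]
          simp only [integral_const_mul, h0 _ _ (hgm _) (hg2 _), mul_zero,
            Finset.sum_const_zero, sub_zero]

/-- With cube roots u of `k + 1` and v of `k` the difference is `u + v³ (u - v)`, and factoring `u³
- v³ = 1` bounds the last term by v. -/
theorem rpow_four_thirds_sub_le (k : ℕ) :
    ((k : ℝ) + 1) ^ (4 / 3 : ℝ) - (k : ℝ) ^ (4 / 3 : ℝ) ≤ 2 * ((k : ℝ) + 1) ^ (1 / 3 : ℝ) := by
  have hk : (0 : ℝ) ≤ k := Nat.cast_nonneg k
  set u : ℝ := ((k : ℝ) + 1) ^ (1 / 3 : ℝ) with hu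
  set v : ℝ := (k : ℝ) ^ (1 / 3 : ℝ) with hv
  have hu0 : 0 < u := by positivity
  have hv0 : 0 ≤ v := by positivity
  have hu3 : u ^ 3 = k + 1 := by
    rw [hu, ← Real.rpow_natCast, ← Real.rpow_mul (by positivity)]; norm_num
  have hv3 : v ^ 3 = k := by
    rw [hv, ← Real.rpow_natCast, ← Real.rpow_mul hk]; norm_num
  have hu4 : ((k : ℝ) + 1) ^ (4 / 3 : ℝ) = u ^ 4 := by
    rw [hu, ← Real.rpow_natCast, ← Real.rpow_mul (by positivity)]; norm_num
  have hv4 : (k : ℝ) ^ (4 / 3 : ℝ) = v ^ 4 := by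
    rw [hv, ← Real.rpow_natCast, ← Real.rpow_mul hk]; norm_num
  rw [hu4, hv4]
  have h1 : u ^ 3 - v ^ 3 = 1 := by rw [hu3, hv3]; ring
  have huv : v ≤ u := by
    rw [hu, hv]; exact Real.rpow_le_rpow hk (by linarith) (by norm_num)
  have h2 : (u - v) * (u ^ 2 + u * v + v ^ 2) = 1 := by linarith [h1]
  have h3 : v ^ 3 * (u - v) ≤ v := by
    have : v * (u - v) * v ^ 2 ≤ v * (u - v) * (u ^ 2 + u * v + v ^ 2) :=
      mul_le_mul_of_nonneg_left (by nlinarith [mul_nonneg hu0.le hv0, sq_nonneg u])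
        (mul_nonneg hv0 (by linarith))
    nlinarith
  nlinarith

/-- Summation by parts. It lowers the exponent 4/3, needed for Cauchy–Schwarz over the lags, to the
exponent 1/3 of the mixing condition. -/
theorem sum_weighted_differences_le (p : ℕ → ℝ) (hp : ∀ k, 0 ≤ p k) (K : ℕ) :
    ∑ k ∈ Finset.range K, ((k : ℝ) + 1) ^ (4 / 3 : ℝ) * (p k - p (k + 1))
      ≤ 2 * ∑ k ∈ Finset.range K, ((k : ℝ) + 1) ^ (1 / 3 : ℝ) * p k := by
  have key : ∑ k ∈ Finset.range K, ((k : ℝ) + 1) ^ (4 / 3 : ℝ) * (p k - p (k + 1))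
      = ∑ k ∈ Finset.range K, (((k : ℝ) + 1) ^ (4 / 3 : ℝ) - (k : ℝ) ^ (4 / 3 : ℝ)) * p k
        - (K : ℝ) ^ (4 / 3 : ℝ) * p K := by
    induction K with
    | zero => simp
    | succ K ih =>
      rw [Finset.sum_range_succ, Finset.sum_range_succ, ih]
      push_cast
      ring
  rw [key, Finset.mul_sum]
  have h1 : 0 ≤ (K : ℝ) ^ (4 / 3 : ℝ) * p K := mul_nonneg (by positivity) (hp K)
  have h2 := Finset.sum_le_sum fun k (_ : k ∈ Finset.range K) =>
    mul_le_mul_of_nonneg_right (rpow_four_thirds_sub_le k) (hp k)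
  simp only [mul_assoc] at h2
  linarith

theorem summable_mixingale_weights : Summable fun k : ℕ => ((k : ℝ) + 1) ^ (-(4 / 3) : ℝ) := by
  have := (summable_nat_add_iff 1).2 (Real.summable_nat_rpow.2 (by norm_num : (-(4 / 3) : ℝ) < -1))
  simpa using this

/-- McLeish's maximal inequality for adapted mixingales. -/
theorem exists_mixingale_majorant (F : ℕ → MeasurableSpace Ω) (hF : ∀ i, F i ≤ m₀)
    (hmono : Monotone F) (ξ : ℕ → Ω → ℝ) (hξ : ∀ j, 1 ≤ j → StronglyMeasurable[F j] (ξ j))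
    (hξ2 : ∀ j, 1 ≤ j → MemLp (ξ j) 2 μ) (h0 : ∀ j, 1 ≤ j → μ[ξ j | F 0] =ᵐ[μ] 0)
    (ψ : ℕ → ℝ) {v : ℝ} (hψ : ∀ j, 1 ≤ j → ∀ k, ∫ w, (μ[ξ j | F (j - k)]) w ^ 2 ∂μ ≤ v * ψ k)
    (hsum : Summable fun k : ℕ => ((k : ℝ) + 1) ^ (1 / 3 : ℝ) * ψ k) (hv : 0 ≤ v)
    (hψ0 : ∀ k, 0 ≤ ψ k) (a M : ℕ) :
    ∃ U : Ω → ℝ, Integrable U μ ∧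
      (∀ᵐ w ∂μ, ∀ m ≤ M, (∑ i ∈ Finset.range m, ξ (a + i + 1) w) ^ 2 ≤ U w) ∧
      ∫ w, U w ∂μ ≤ 8 * (∑' k : ℕ, ((k : ℝ) + 1) ^ (-(4 / 3) : ℝ)) *
        (∑' k : ℕ, ((k : ℝ) + 1) ^ (1 / 3 : ℝ) * ψ k) * v * M := by
  -- For a fixed lag k these are martingale differences in i with respect to `F (a + i - k)`.
  -- Truncated subtraction makes `Y k i` vanish once the lag reaches past the index 0.
  let Y : ℕ → ℕ → Ω → ℝ := fun k i w =>
    (μ[ξ (a + i + 1) | F (a + i + 1 - k)]) w - (μ[ξ (a + i + 1) | F (a + i + 1 - (k + 1))]) w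
  have hc2 : ∀ i k, MemLp (μ[ξ (a + i + 1) | F k]) 2 μ := fun i k =>
    (hξ2 _ (by omega)).condExp one_le_two
  have hY2 : ∀ k i, MemLp (Y k i) 2 μ := fun k i => (hc2 _ _).sub (hc2 _ _)
  have hmaj : ∀ k, ∃ U : Ω → ℝ, Integrable U μ ∧
      (∀ w, ∀ m ≤ M, (∑ i ∈ Finset.range m, Y k i w) ^ 2 ≤ U w) ∧
      ∫ w, U w ∂μ ≤ 4 * ∑ i ∈ Finset.range M, ∫ w, Y k i w ^ 2 ∂μ := by
    intro k
    refine exists_doob_majorant (fun i => F (a + i - k)) (fun i => hF _)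
      (fun i j hij => hmono (by omega)) (Y k) (fun i => ?_) (hY2 k) (fun i g hg hg2 => ?_) M
    · refine StronglyMeasurable.sub ?_ ?_
      · exact stronglyMeasurable_condExp.mono (hmono (by omega))
      · exact stronglyMeasurable_condExp.mono (hmono (by omega))
    · have e1 : a + i + 1 - (k + 1) = a + i - k := by omega
      have h1 := integral_mul_condExp (hF _) (hξ2 (a + i + 1) (by omega)) hg2
        (hg.mono (hmono (by omega : a + i - k ≤ a + i + 1 - k)))
      have h2 := integral_mul_condExp (hF _) (hξ2 (a + i + 1) (by omega)) hg2 hg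
      have hi : ∀ k, Integrable (fun w => (μ[ξ (a + i + 1) | F k]) w * g w) μ := fun k =>
        (hc2 i k).integrable_mul hg2
      simp only [Y, sub_mul, e1]
      rw [integral_sub (hi _) (hi _), ← h1, ← h2, sub_self]
  choose U hUi hUb hUe using hmaj
  set A : ℝ := ∑' k : ℕ, ((k : ℝ) + 1) ^ (-(4 / 3) : ℝ) with hA
  set P : ℝ := ∑' k : ℕ, ((k : ℝ) + 1) ^ (1 / 3 : ℝ) * ψ k with hP
  have hA0 : 0 ≤ A := tsum_nonneg fun k => by positivity
  have hP0 : 0 ≤ P := tsum_nonneg fun k => mul_nonneg (by positivity) (hψ0 k)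
  -- At lag K every index `a + i + 1` with `i < M` has been moved to 0, where the conditional
  -- expectation vanishes. The telescoping decomposition is thus exact with finitely many lags.
  set K := a + M + 1 with hK
  have hU0 : ∀ k w, 0 ≤ U k w := fun k w => by simpa using hUb k w 0 (Nat.zero_le _)
  refine ⟨fun w => A * ∑ k ∈ Finset.range K, ((k : ℝ) + 1) ^ (4 / 3 : ℝ) * U k w,
    (integrable_finsetSum _ fun k _ => (hUi k).const_mul _).const_mul _, ?_, ?_⟩
  · have hdec : ∀ᵐ w ∂μ, ∀ i < M, ξ (a + i + 1) w = ∑ k ∈ Finset.range K, Y k i w := by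
      rw [ae_all_iff]
      intro i
      by_cases hi : i < M
      · filter_upwards [h0 (a + i + 1) (by omega)] with w hw _
        have e1 : μ[ξ (a + i + 1) | F (a + i + 1)] = ξ (a + i + 1) :=
          condExp_of_stronglyMeasurable (hF _) (hξ _ (by omega))
            ((hξ2 _ (by omega)).integrable one_le_two)
        have e2 : a + i + 1 - K = 0 := by omega
        simp only [Y]
        rw [Finset.sum_range_sub' (fun k => (μ[ξ (a + i + 1) | F (a + i + 1 - k)]) w)]
        simp only [Nat.sub_zero, e1, e2, hw]
        simp
      · exact Eventually.of_forall fun w h => absurd h hi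
    filter_upwards [hdec] with w hw m hm
    have e : ∑ i ∈ Finset.range m, ξ (a + i + 1) w
        = ∑ k ∈ Finset.range K, ∑ i ∈ Finset.range m, Y k i w := by
      rw [Finset.sum_comm]
      exact Finset.sum_congr rfl fun i hi => hw i (by have := Finset.mem_range.1 hi; omega)
    rw [e]
    set u : ℕ → ℝ := fun k => ∑ i ∈ Finset.range m, Y k i w with hu
    -- Cauchy–Schwarz over the lags. The squared weights `(k + 1)^(-4/3)` are summable, and the
    -- reciprocal weights are removed afterwards by `sum_weighted_differences_le`.
    have cs := Finset.sum_mul_sq_le_sq_mul_sq (Finset.range K)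
      (fun k : ℕ => ((k : ℝ) + 1) ^ (-(2 / 3) : ℝ)) (fun k : ℕ => ((k : ℝ) + 1) ^ (2 / 3 : ℝ) * u k)
    have e1 : ∀ k : ℕ, ((k : ℝ) + 1) ^ (-(2 / 3) : ℝ) * (((k : ℝ) + 1) ^ (2 / 3 : ℝ) * u k)
        = u k := by
      intro k
      rw [← mul_assoc, ← Real.rpow_add (by positivity)]; norm_num
    have e2 : ∀ k : ℕ, (((k : ℝ) + 1) ^ (-(2 / 3) : ℝ)) ^ 2 = ((k : ℝ) + 1) ^ (-(4 / 3) : ℝ) := by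
      intro k
      rw [← Real.rpow_natCast, ← Real.rpow_mul (by positivity)]; norm_num
    have e3 : ∀ k : ℕ, (((k : ℝ) + 1) ^ (2 / 3 : ℝ) * u k) ^ 2
        = ((k : ℝ) + 1) ^ (4 / 3 : ℝ) * u k ^ 2 := by
      intro k
      rw [mul_pow, ← Real.rpow_natCast, ← Real.rpow_mul (by positivity)]; norm_num
    simp only [e1, e2, e3] at cs
    refine cs.trans (mul_le_mul ?_ ?_ ?_ hA0)
    · exact summable_mixingale_weights.sum_le_tsum _ fun k _ => by positivity
    · exact Finset.sum_le_sum fun k _ => mul_le_mul_of_nonneg_left (hUb k w m hm) (by positivity)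
    · exact Finset.sum_nonneg fun k _ => mul_nonneg (by positivity) (sq_nonneg _)
  · rw [integral_const_mul, integral_finsetSum _ fun k _ => (hUi k).const_mul _]
    simp only [integral_const_mul]
    have hinner : ∀ i, ∑ k ∈ Finset.range K, ((k : ℝ) + 1) ^ (4 / 3 : ℝ) * ∫ w, Y k i w ^ 2 ∂μ
        ≤ 2 * (v * P) := by
      intro i
      let p : ℕ → ℝ := fun k => ∫ w, (μ[ξ (a + i + 1) | F (a + i + 1 - k)]) w ^ 2 ∂μ
      have e : ∀ k, ∫ w, Y k i w ^ 2 ∂μ = p k - p (k + 1) := fun k =>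
        integral_condExp_sub_sq (hF _) (hmono (by omega)) (hξ2 _ (by omega))
      simp only [e]
      refine (sum_weighted_differences_le p (fun k => integral_nonneg fun w => sq_nonneg _) K).trans
        (mul_le_mul_of_nonneg_left ?_ zero_le_two)
      calc ∑ k ∈ Finset.range K, ((k : ℝ) + 1) ^ (1 / 3 : ℝ) * p k
          ≤ ∑ k ∈ Finset.range K, v * (((k : ℝ) + 1) ^ (1 / 3 : ℝ) * ψ k) := by
            refine Finset.sum_le_sum fun k _ => ?_
            have := mul_le_mul_of_nonneg_left (hψ (a + i + 1) (by omega) k)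
              (by positivity : 0 ≤ ((k : ℝ) + 1) ^ (1 / 3 : ℝ))
            simp only [p]; linarith
        _ = v * ∑ k ∈ Finset.range K, ((k : ℝ) + 1) ^ (1 / 3 : ℝ) * ψ k := by rw [Finset.mul_sum]
        _ ≤ v * P := mul_le_mul_of_nonneg_left
            (hsum.sum_le_tsum _ fun k _ => mul_nonneg (by positivity) (hψ0 k)) hv
    have h1 : ∑ k ∈ Finset.range K, ((k : ℝ) + 1) ^ (4 / 3 : ℝ) * ∫ w, U k w ∂μ
        ≤ 4 * (M * (2 * (v * P))) := by
      calc ∑ k ∈ Finset.range K, ((k : ℝ) + 1) ^ (4 / 3 : ℝ) * ∫ w, U k w ∂μ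
          ≤ ∑ k ∈ Finset.range K, ((k : ℝ) + 1) ^ (4 / 3 : ℝ)
              * (4 * ∑ i ∈ Finset.range M, ∫ w, Y k i w ^ 2 ∂μ) :=
            Finset.sum_le_sum fun k _ => mul_le_mul_of_nonneg_left (hUe k) (by positivity)
        _ = 4 * ∑ i ∈ Finset.range M, ∑ k ∈ Finset.range K,
              ((k : ℝ) + 1) ^ (4 / 3 : ℝ) * ∫ w, Y k i w ^ 2 ∂μ := by
            rw [Finset.sum_comm, Finset.mul_sum]
            refine Finset.sum_congr rfl fun k _ => ?_
            rw [← Finset.mul_sum]; ring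
        _ ≤ 4 * ∑ i ∈ Finset.range M, 2 * (v * P) :=
            mul_le_mul_of_nonneg_left (Finset.sum_le_sum fun i _ => hinner i) (by norm_num)
        _ = _ := by rw [Finset.sum_const, Finset.card_range, nsmul_eq_mul]
    calc A * _ ≤ A * (4 * (M * (2 * (v * P)))) := mul_le_mul_of_nonneg_left h1 hA0
      _ = _ := by ring

end Maximal


/-! ### The mixing sequence: maximal inequality for functionals of the data. -/

section Mixing

variable {d : ℕ} {𝒯 : Set (Euc d)} {Ω : Type*} [mΩ : MeasurableSpace Ω] {μ : Measure Ω}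
  [IsProbabilityMeasure μ] {X : ℕ → Ω → L2 𝒯} {ε : ℕ → Ω → ℝ}

theorem abs_measureReal_inter_sub_le (A B : Set Ω) :
    |μ.real (A ∩ B) - μ.real A * μ.real B| ≤ 1 := by
  have h1 : μ.real (A ∩ B) ≤ 1 := measureReal_le_one
  have h2 : μ.real A ≤ 1 := measureReal_le_one
  have h3 : μ.real B ≤ 1 := measureReal_le_one
  have h4 : 0 ≤ μ.real (A ∩ B) := measureReal_nonneg
  have h5 : 0 ≤ μ.real A := measureReal_nonneg
  have h6 : 0 ≤ μ.real B := measureReal_nonneg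
  rw [abs_le]
  constructor <;> nlinarith [mul_nonneg h5 h6]

theorem abs_le_alphaCoeff {m₁ m₂ : MeasurableSpace Ω} {A B : Set Ω} (hA : MeasurableSet[m₁] A)
    (hB : MeasurableSet[m₂] B) :
    |μ.real (A ∩ B) - μ.real A * μ.real B| ≤ @alphaCoeff Ω mΩ μ m₁ m₂ := by
  refine le_csSup ⟨1, ?_⟩ ⟨A, B, hA, hB, rfl⟩
  rintro _ ⟨A, B, -, -, rfl⟩
  exact abs_measureReal_inter_sub_le (mΩ := mΩ) (μ := μ) A B

theorem alphaCoeff_le_one (m₁ m₂ : MeasurableSpace Ω) : @alphaCoeff Ω mΩ μ m₁ m₂ ≤ 1 := by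
  refine Real.sSup_le ?_ zero_le_one
  rintro _ ⟨A, B, -, -, rfl⟩
  exact abs_measureReal_inter_sub_le (mΩ := mΩ) (μ := μ) A B

omit [IsProbabilityMeasure μ] in
theorem alphaCoeff_nonneg (m₁ m₂ : MeasurableSpace Ω) : 0 ≤ @alphaCoeff Ω mΩ μ m₁ m₂ := by
  refine Real.sSup_nonneg ?_
  rintro _ ⟨A, B, -, -, rfl⟩
  exact abs_nonneg _

omit [IsProbabilityMeasure μ] in
theorem alphaMixing_nonneg (k : ℕ) : 0 ≤ alphaMixing μ X ε k := by
  refine Real.sSup_nonneg ?_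
  rintro _ ⟨t, -, rfl⟩
  exact alphaCoeff_nonneg _ _

theorem abs_le_alphaMixing {t k : ℕ} (ht : 1 ≤ t) {A B : Set Ω}
    (hA : MeasurableSet[sigmaGen X ε (Set.Icc 1 t)] A)
    (hB : MeasurableSet[sigmaGen X ε (Set.Ici (t + k))] B) :
    |μ.real (A ∩ B) - μ.real A * μ.real B| ≤ alphaMixing μ X ε k := by
  refine (abs_le_alphaCoeff hA hB).trans (le_csSup ⟨1, ?_⟩ ⟨t, ht, rfl⟩)
  rintro _ ⟨t, -, rfl⟩
  exact alphaCoeff_le_one _ _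

omit mΩ in
theorem sigmaGen_mono (X : ℕ → Ω → L2 𝒯) (ε : ℕ → Ω → ℝ) {S S' : Set ℕ} (h : S ⊆ S') :
    sigmaGen X ε S ≤ sigmaGen X ε S' :=
  biSup_mono fun _ hj => h hj

omit mΩ in
theorem sigmaGen_Icc_zero (X : ℕ → Ω → L2 𝒯) (ε : ℕ → Ω → ℝ) :
    sigmaGen X ε (Set.Icc 1 0) = ⊥ := by
  have e : Set.Icc 1 0 = (∅ : Set ℕ) := Set.Icc_eq_empty (by norm_num)
  rw [sigmaGen, e]
  simp

omit mΩ in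
theorem comap_le_sigmaGen (X : ℕ → Ω → L2 𝒯) (ε : ℕ → Ω → ℝ) {S : Set ℕ} {j : ℕ} (h : j ∈ S) :
    MeasurableSpace.comap (fun w => (X j w, ε j w)) inferInstance ≤ sigmaGen X ε S :=
  le_iSup₂ (f := fun j (_ : j ∈ S) =>
    MeasurableSpace.comap (fun w => (X j w, ε j w)) inferInstance) j h

namespace DataAssumption

variable (hd : DataAssumption μ X ε)

include hd

omit [IsProbabilityMeasure μ] in
theorem measurable_pair {j : ℕ} (hj : 1 ≤ j) : Measurable fun w => (X j w, ε j w) :=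
  (hd.measurable_X j hj).prodMk (hd.measurable_ε j hj)

omit [IsProbabilityMeasure μ] in
theorem sigmaGen_le {S : Set ℕ} (hS : ∀ j ∈ S, 1 ≤ j) : sigmaGen X ε S ≤ mΩ :=
  iSup₂_le fun _ hj => (hd.measurable_pair (hS _ hj)).comap_le

omit [IsProbabilityMeasure μ] in
/-- The pairs `(X_j, ε_j)` are identically distributed. -/
theorem map_pair_eq {j : ℕ} (hj : 1 ≤ j) :
    μ.map (fun w => (X j w, ε j w)) = μ.map (fun w => (X 1 w, ε 1 w)) := by
  obtain ⟨h, rfl⟩ := Nat.exists_eq_add_of_le hj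
  have hs := congrArg (fun ν : Measure (ℕ → L2 𝒯 × ℝ) => ν.map fun f => f 0) (hd.stationary h)
  rw [Measure.map_map (measurable_pi_apply 0), Measure.map_map (measurable_pi_apply 0)] at hs
  · have e : 0 + 1 + h = 1 + h := by omega
    simpa [Function.comp_def, e] using hs
  · exact measurable_pi_lambda _ fun i => hd.measurable_pair (by omega)
  · exact measurable_pi_lambda _ fun i => hd.measurable_pair (by omega)

omit [IsProbabilityMeasure μ] in
theorem integral_pair_eq {j : ℕ} (hj : 1 ≤ j) {Φ : L2 𝒯 × ℝ → ℝ} (hΦ : Measurable Φ) :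
    ∫ w, Φ (X j w, ε j w) ∂μ = ∫ w, Φ (X 1 w, ε 1 w) ∂μ := by
  rw [← integral_map (hd.measurable_pair hj).aemeasurable hΦ.aestronglyMeasurable,
    ← integral_map (hd.measurable_pair le_rfl).aemeasurable hΦ.aestronglyMeasurable,
    hd.map_pair_eq hj]

omit [IsProbabilityMeasure μ] in
-- The terms of the convergent mixing series are bounded, and this is the cube of that bound. It
-- makes blocks at distance p independent up to O(1/p).
theorem exists_mul_alphaMixing_le : ∃ C : ℝ, 0 ≤ C ∧ ∀ k : ℕ, k * alphaMixing μ X ε k ≤ C := by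
  obtain ⟨C, hC⟩ := hd.mixing.tendsto_atTop_zero.bddAbove_range
  refine ⟨max C 0 ^ 3, by positivity, fun k => ?_⟩
  have h1 : (k : ℝ) ^ (1 / 3 : ℝ) * alphaMixing μ X ε k ^ (1 / 3 : ℝ) ≤ max C 0 :=
    (hC ⟨k, rfl⟩).trans (le_max_left _ _)
  have h0 := alphaMixing_nonneg (μ := μ) (X := X) (ε := ε) k
  have h2 := pow_le_pow_left₀ (by positivity) h1 3
  rw [mul_pow, ← Real.rpow_natCast, ← Real.rpow_natCast (alphaMixing μ X ε k ^ (1 / 3 : ℝ)),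
    ← Real.rpow_mul (by positivity), ← Real.rpow_mul h0] at h2
  norm_num at h2
  exact h2

omit [IsProbabilityMeasure μ] in
-- At lag 0 the only information is that a mixing difference is at most 1, hence the weight 1.
-- Elsewhere the shift from k to `k + 1` costs a factor 2.
theorem summable_mixing_weights : Summable fun k : ℕ =>
    ((k : ℝ) + 1) ^ (1 / 3 : ℝ) * (if k = 0 then 1 else alphaMixing μ X ε k ^ (1 / 3 : ℝ)) := by
  rw [← summable_nat_add_iff 1]
  refine Summable.of_nonneg_of_le (fun k => ?_) (fun k => ?_)
    (((summable_nat_add_iff 1).2 hd.mixing).mul_left 2)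
  · have := alphaMixing_nonneg (μ := μ) (X := X) (ε := ε) (k + 1)
    simp only [Nat.add_eq_zero_iff, one_ne_zero, and_false, if_false]
    positivity
  · have h0 := alphaMixing_nonneg (μ := μ) (X := X) (ε := ε) (k + 1)
    simp only [Nat.add_eq_zero_iff, one_ne_zero, and_false, if_false]
    rw [← mul_assoc]
    refine mul_le_mul_of_nonneg_right ?_ (by positivity)
    push_cast
    calc ((k : ℝ) + 1 + 1) ^ (1 / 3 : ℝ) ≤ (8 * ((k : ℝ) + 1)) ^ (1 / 3 : ℝ) :=
          Real.rpow_le_rpow (by positivity) (by linarith [(Nat.cast_nonneg k : (0 : ℝ) ≤ k)])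
            (by norm_num)
      _ = 2 * ((k : ℝ) + 1) ^ (1 / 3 : ℝ) := by
          rw [Real.mul_rpow (by norm_num) (by positivity)]
          congr 1
          rw [show (8 : ℝ) = 2 ^ (3 : ℝ) by norm_num, ← Real.rpow_mul (by norm_num)]
          norm_num

/-- The maximal inequality for functionals of the data with uniformly bounded third moments. -/
theorem exists_majorant : ∃ C : ℝ, 0 ≤ C ∧ ∀ (ζ : ℕ → Ω → ℝ) (k : ℝ), 0 ≤ k →
    (∀ j, 1 ≤ j → Measurable[MeasurableSpace.comap (fun w => (X j w, ε j w)) inferInstance] (ζ j)) →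
    (∀ j, 1 ≤ j → Integrable (fun w => |ζ j w| ^ 3) μ) →
    (∀ j, 1 ≤ j → ∫ w, |ζ j w| ^ 3 ∂μ ≤ k ^ 3) → ∀ a M : ℕ,
    ∃ U : Ω → ℝ, Integrable U μ ∧
      (∀ᵐ w ∂μ, ∀ m ≤ M,
        (∑ i ∈ Finset.range m, (ζ (a + i + 1) w - ∫ w', ζ (a + i + 1) w' ∂μ)) ^ 2 ≤ U w) ∧
      ∫ w, U w ∂μ ≤ C * k ^ 2 * M := by
  set ψ : ℕ → ℝ := fun k => if k = 0 then 1 else alphaMixing μ X ε k ^ (1 / 3 : ℝ) with hψ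
  have hψ0 : ∀ k, 0 ≤ ψ k := by
    intro k
    simp only [hψ]
    split_ifs
    · exact zero_le_one
    · exact Real.rpow_nonneg (alphaMixing_nonneg k) _
  have hS := hd.summable_mixing_weights
  -- Here 72 is `18 * 2 ^ 2`: centring at most doubles the scale k of the third moments.
  refine ⟨8 * (∑' k : ℕ, ((k : ℝ) + 1) ^ (-(4 / 3) : ℝ)) *
        (∑' k : ℕ, ((k : ℝ) + 1) ^ (1 / 3 : ℝ) * ψ k) * 72, ?_, ?_⟩
  · have h1 : 0 ≤ ∑' k : ℕ, ((k : ℝ) + 1) ^ (-(4 / 3) : ℝ) := tsum_nonneg fun k => by positivity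
    have h2 : 0 ≤ ∑' k : ℕ, ((k : ℝ) + 1) ^ (1 / 3 : ℝ) * ψ k :=
      tsum_nonneg fun k => mul_nonneg (by positivity) (hψ0 k)
    positivity
  intro ζ k hk hζm hζ3 hζk a M
  let F : ℕ → MeasurableSpace Ω := fun t => sigmaGen X ε (Set.Icc 1 t)
  have hF : ∀ t, F t ≤ mΩ := fun t => hd.sigmaGen_le fun j hj => hj.1
  have hmono : Monotone F := fun s t hst => sigmaGen_mono X ε (Set.Icc_subset_Icc_right hst)
  have hζ0 : ∀ j, 1 ≤ j → Measurable (ζ j) := fun j hj =>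
    (hζm j hj).mono (hd.measurable_pair hj).comap_le le_rfl
  have hζ2 : ∀ j, 1 ≤ j → MemLp (ζ j) 2 μ := fun j hj =>
    memLp_two_of_integrable_abs_pow_three (hζ0 j hj).aestronglyMeasurable (hζ3 j hj)
  let ξ : ℕ → Ω → ℝ := fun j w => ζ j w - ∫ w', ζ j w' ∂μ
  have hξm : ∀ j, 1 ≤ j →
      Measurable[MeasurableSpace.comap (fun w => (X j w, ε j w)) inferInstance] (ξ j) :=
    fun j hj => (hζm j hj).sub_const _
  have hξ2 : ∀ j, 1 ≤ j → MemLp (ξ j) 2 μ := fun j hj => (hζ2 j hj).sub (memLp_const _)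
  have hξ0 : ∀ j, 1 ≤ j → ∫ w, ξ j w ∂μ = 0 := by
    intro j hj
    simp only [ξ]
    rw [integral_sub ((hζ2 j hj).integrable one_le_two) (integrable_const _)]
    simp
  have hmean : ∀ j, 1 ≤ j → |∫ w, ζ j w ∂μ| ^ 3 ≤ ∫ w, |ζ j w| ^ 3 ∂μ := by
    intro j hj
    set e := ∫ w, |ζ j w| ∂μ with he
    have hi := (hζ2 j hj).integrable one_le_two
    have he0 : 0 ≤ e := integral_nonneg fun _ => abs_nonneg _
    have h1 : ∀ w, 3 * e ^ 2 * |ζ j w| - 2 * e ^ 3 ≤ |ζ j w| ^ 3 := by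
      intro w
      have := abs_nonneg (ζ j w)
      nlinarith [mul_nonneg (by linarith : 0 ≤ |ζ j w| + 2 * e) (sq_nonneg (|ζ j w| - e))]
    have h2 := integral_mono ((hi.abs.const_mul (3 * e ^ 2)).sub (integrable_const (2 * e ^ 3)))
      (hζ3 j hj) h1
    have h3 : ∫ w, (3 * e ^ 2 * |ζ j w| - 2 * e ^ 3) ∂μ = e ^ 3 := by
      rw [integral_sub (hi.abs.const_mul (3 * e ^ 2)) (integrable_const _), integral_const_mul,
        ← he]
      simp; ring
    have h4 : |∫ w, ζ j w ∂μ| ≤ e := abs_integral_le_integral_abs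
    exact (pow_le_pow_left₀ (abs_nonneg _) h4 3).trans (h3 ▸ h2)
  have hξ3i : ∀ j, 1 ≤ j → Integrable (fun w => |ξ j w| ^ 3) μ ∧
      ∫ w, |ξ j w| ^ 3 ∂μ ≤ (2 * k) ^ 3 := by
    intro j hj
    have hpt : ∀ w, |ξ j w| ^ 3 ≤ 4 * |ζ j w| ^ 3 + 4 * |∫ w', ζ j w' ∂μ| ^ 3 := by
      intro w
      have h1 : |ξ j w| ≤ |ζ j w| + |∫ w', ζ j w' ∂μ| := abs_sub _ _
      refine (pow_le_pow_left₀ (abs_nonneg _) h1 3).trans ?_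
      have ha := abs_nonneg (ζ j w)
      have hb := abs_nonneg (∫ w', ζ j w' ∂μ)
      nlinarith [mul_nonneg (add_nonneg ha hb) (sq_nonneg (|ζ j w| - |∫ w', ζ j w' ∂μ|))]
    have hi : Integrable (fun w => 4 * |ζ j w| ^ 3 + 4 * |∫ w', ζ j w' ∂μ| ^ 3) μ :=
      ((hζ3 j hj).const_mul 4).add (integrable_const _)
    have hxi : Integrable (fun w => |ξ j w| ^ 3) μ :=
      hi.mono' (((hξ2 j hj).aestronglyMeasurable.norm).pow 3) (Eventually.of_forall fun w => by
        rw [Real.norm_of_nonneg (by positivity)]; exact hpt w)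
    refine ⟨hxi, (integral_mono hxi hi hpt).trans ?_⟩
    rw [integral_add ((hζ3 j hj).const_mul 4) (integrable_const _), integral_const_mul]
    simp only [integral_const, probReal_univ, smul_eq_mul, one_mul]
    have := hmean j hj
    have := hζk j hj
    nlinarith
  have hbound : ∀ j, 1 ≤ j → ∀ i, ∫ w, (μ[ξ j | F (j - i)]) w ^ 2 ∂μ ≤ 72 * k ^ 2 * ψ i := by
    intro j hj i
    have hle := (hd.measurable_pair hj).comap_le
    have aux : ∀ t : ℝ, 0 ≤ t → (∀ A B, MeasurableSet[F (j - i)] A →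
        MeasurableSet[MeasurableSpace.comap (fun w => (X j w, ε j w)) inferInstance] B →
        |μ.real (A ∩ B) - μ.real A * μ.real B| ≤ t ^ 3) →
        ∫ w, (μ[ξ j | F (j - i)]) w ^ 2 ∂μ ≤ 72 * k ^ 2 * t := by
      intro t ht h
      have := integral_condExp_sq_le_of_mixing (hF (j - i)) hle (hξm j hj).stronglyMeasurable
        (hξ3i j hj).1 (hξ0 j hj) ht (by positivity : 0 ≤ 2 * k) h (hξ3i j hj).2
      linarith
    by_cases hi : i = 0
    · refine aux (ψ i) (hψ0 i) fun A B _ _ => ?_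
      simp only [hψ, hi, if_true, one_pow]
      exact abs_measureReal_inter_sub_le A B
    · rcases Nat.lt_or_ge i j with hij | hij
      · refine aux (ψ i) (hψ0 i) fun A B hA hB => ?_
        have e : ψ i ^ 3 = alphaMixing μ X ε i := by
          simp only [hψ, hi, if_false]
          rw [← Real.rpow_natCast, ← Real.rpow_mul (alphaMixing_nonneg i)]
          norm_num
        rw [e]
        exact abs_le_alphaMixing (by omega) hA
          (comap_le_sigmaGen X ε (Set.mem_Ici.2 (by omega : j - i + i ≤ j)) _ hB)
      -- A lag that reaches the start of the sequence leaves no past: the σ-algebra is trivial and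
      -- the conditional expectation is the mean, which is 0.
      · have e : F (j - i) = ⊥ := by
          simp only [F, Nat.sub_eq_zero_of_le hij]
          exact sigmaGen_Icc_zero X ε
        rw [e, condExp_bot, hξ0 j hj]
        simp only [ne_eq, OfNat.ofNat_ne_zero, not_false_eq_true, zero_pow, integral_zero]
        exact mul_nonneg (by positivity) (hψ0 i)
  obtain ⟨U, hUi, hUb, hUe⟩ := exists_mixingale_majorant F hF hmono ξ
    (fun j hj => ((hξm j hj).mono (comap_le_sigmaGen X ε (Set.mem_Icc.2 ⟨hj, le_rfl⟩))
      le_rfl).stronglyMeasurable) hξ2 (fun j hj => by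
      have e : F 0 = ⊥ := sigmaGen_Icc_zero X ε
      rw [e, condExp_bot, hξ0 j hj]; rfl) ψ hbound hS (by positivity) hψ0 a M
  refine ⟨U, hUi, hUb, hUe.trans (le_of_eq ?_)⟩
  ring

end DataAssumption

omit [IsProbabilityMeasure μ] in
-- Cauchy–Schwarz for the cubes. This is why sixth moments are assumed: the products of noise and
-- covariate, and of two covariates, then have the third moments required by `exists_majorant`.
theorem integrable_abs_mul_pow_three {u v : Ω → ℝ} (hu : AEStronglyMeasurable u μ)
    (hv : AEStronglyMeasurable v μ) (hu6 : Integrable (fun w => u w ^ 6) μ)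
    (hv6 : Integrable (fun w => v w ^ 6) μ) {a b : ℝ} (ha : 0 ≤ a) (hb : 0 ≤ b)
    (hua : ∫ w, u w ^ 6 ∂μ ≤ a ^ 6) (hvb : ∫ w, v w ^ 6 ∂μ ≤ b ^ 6) :
    Integrable (fun w => |u w * v w| ^ 3) μ ∧ ∫ w, |u w * v w| ^ 3 ∂μ ≤ (a * b) ^ 3 := by
  have hu2 : MemLp (fun w => |u w| ^ 3) 2 μ := by
    refine (memLp_two_iff_integrable_sq (hu.norm.pow 3)).2 ?_
    refine hu6.congr (Eventually.of_forall fun w => ?_)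
    simp only [Pi.pow_apply, Real.norm_eq_abs]
    rw [← pow_mul, Even.pow_abs (by decide : Even (3 * 2))]
  have hv2 : MemLp (fun w => |v w| ^ 3) 2 μ := by
    refine (memLp_two_iff_integrable_sq (hv.norm.pow 3)).2 ?_
    refine hv6.congr (Eventually.of_forall fun w => ?_)
    simp only [Pi.pow_apply, Real.norm_eq_abs]
    rw [← pow_mul, Even.pow_abs (by decide : Even (3 * 2))]
  have e : (fun w => |u w * v w| ^ 3) = fun w => |u w| ^ 3 * |v w| ^ 3 := by
    ext w; rw [abs_mul, mul_pow]
  refine ⟨e ▸ hu2.integrable_mul hv2, ?_⟩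
  rw [e]
  have h := integral_mul_le_Lp_mul_Lq_of_nonneg (μ := μ) Real.HolderConjugate.two_two
    (f := fun w => |u w| ^ 3) (g := fun w => |v w| ^ 3)
    (Eventually.of_forall fun w => by positivity) (Eventually.of_forall fun w => by positivity)
    (by simpa using hu2) (by simpa using hv2)
  have e1 : ∀ u : Ω → ℝ, (fun w => (|u w| ^ 3) ^ (2 : ℝ)) = fun w => u w ^ 6 := by
    intro u; ext w
    rw [Real.rpow_ofNat, ← pow_mul, Even.pow_abs (by decide : Even (3 * 2))]
  simp only [e1] at h
  refine h.trans ?_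
  have e2 : ∀ x : ℝ, 0 ≤ x → (x ^ 6) ^ (1 / 2 : ℝ) = x ^ 3 := by
    intro x hx
    rw [← Real.rpow_natCast, ← Real.rpow_natCast, ← Real.rpow_mul hx]; norm_num
  rw [mul_pow, ← e2 a ha, ← e2 b hb]
  have h1 : 0 ≤ ∫ w, u w ^ 6 ∂μ := integral_nonneg fun w => by positivity
  have h2 : 0 ≤ ∫ w, v w ^ 6 ∂μ := integral_nonneg fun w => by positivity
  gcongr

end Mixing


/-! ### Ridge regression and weighted Cauchy–Schwarz in a Hilbert space. -/

section Ridge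

variable {H : Type*} [NormedAddCommGroup H] [InnerProductSpace ℝ H]

/-- Ridge regression on finitely many data points has a minimiser. -/
theorem exists_ridge_minimizer (z : ℕ → H) (y : ℕ → ℝ) (S : Finset ℕ) {a lam : ℝ} (ha : 0 ≤ a)
    (hl : 0 < lam) : ∃ f₀ : H, ∀ f : H,
      a * ∑ j ∈ S, (y j - inner ℝ (z j) f₀) ^ 2 + lam * ‖f₀‖ ^ 2
        ≤ a * ∑ j ∈ S, (y j - inner ℝ (z j) f) ^ 2 + lam * ‖f‖ ^ 2 := by
  let V : Submodule ℝ H := Submodule.span ℝ (z '' S)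
  have : FiniteDimensional ℝ V := FiniteDimensional.span_of_finite ℝ (S.finite_toSet.image z)
  let J : H → ℝ := fun f => a * ∑ j ∈ S, (y j - inner ℝ (z j) f) ^ 2 + lam * ‖f‖ ^ 2
  have hJ : Continuous J := by fun_prop
  have hJl : ∀ f, lam * ‖f‖ ^ 2 ≤ J f := fun f => by
    have : 0 ≤ a * ∑ j ∈ S, (y j - inner ℝ (z j) f) ^ 2 :=
      mul_nonneg ha (Finset.sum_nonneg fun _ _ => sq_nonneg _)
    simp only [J]; linarith
  have hcoc : ∀ᶠ v : V in cocompact V, J ((0 : V) : H) ≤ J v := by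
    filter_upwards [(tendsto_norm_cocompact_atTop (E := V)).eventually_ge_atTop
      (max 1 (J ((0 : V) : H) / lam))] with v hv
    refine le_trans ?_ (hJl v)
    have h1 : J ((0 : V) : H) / lam ≤ ‖v‖ := (le_max_right _ _).trans hv
    have h2 : 1 ≤ ‖v‖ := (le_max_left _ _).trans hv
    rw [div_le_iff₀ hl] at h1
    have h3 : ‖v‖ ≤ ‖v‖ ^ 2 := by nlinarith
    have h4 : ‖(v : H)‖ = ‖v‖ := rfl
    rw [h4]
    nlinarith
  obtain ⟨f₀, hf₀⟩ := (hJ.comp continuous_subtype_val).exists_forall_le' (0 : V) hcoc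
  -- Projecting f onto the span of the data keeps all fitted values and does not increase the norm,
  -- so the minimiser over the finite-dimensional span is a global one.
  refine ⟨f₀, fun f => ?_⟩
  have e : ∀ j ∈ S, inner ℝ (z j) (V.starProjection f) = inner ℝ (z j) f := by
    intro j hj
    have hz : z j ∈ V := Submodule.subset_span ⟨j, hj, rfl⟩
    have h := V.starProjection_inner_eq_zero f (z j) hz
    rw [inner_sub_left, sub_eq_zero] at h
    rw [real_inner_comm, ← h, real_inner_comm]
  have hn : ‖V.starProjection f‖ ≤ ‖f‖ := V.norm_starProjection_apply_le f
  have h1 : J f₀ ≤ J (V.starProjection f) := hf₀ ⟨_, V.starProjection_apply_mem f⟩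
  refine h1.trans ?_
  simp only [J]
  rw [Finset.sum_congr rfl fun j hj => by rw [e j hj]]
  gcongr

/-- A vector whose Fourier coefficients exhaust its norm is the sum of its Fourier series. -/
theorem hasSum_inner_mul_inner_of_parseval {φ : ℕ → H} (hφ : Orthonormal ℝ φ) {v : H}
    (hv : HasSum (fun l => inner ℝ v (φ l) ^ 2) (‖v‖ ^ 2)) (h : H) :
    HasSum (fun l => inner ℝ v (φ l) * inner ℝ h (φ l)) (inner ℝ v h) := by
  have key : ∀ s : Finset ℕ, ‖(∑ l ∈ s, inner ℝ v (φ l) • φ l) - v‖ ^ 2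
      = ‖v‖ ^ 2 - ∑ l ∈ s, inner ℝ v (φ l) ^ 2 := by
    intro s
    rw [norm_sub_sq_real, sum_inner]
    have e1 : ‖∑ l ∈ s, inner ℝ v (φ l) • φ l‖ ^ 2 = ∑ l ∈ s, inner ℝ v (φ l) ^ 2 := by
      rw [← real_inner_self_eq_norm_sq, hφ.inner_sum]
      simp [sq]
    have e2 : ∑ l ∈ s, inner ℝ (inner ℝ v (φ l) • φ l) v = ∑ l ∈ s, inner ℝ v (φ l) ^ 2 :=
      Finset.sum_congr rfl fun l _ => by
        rw [real_inner_smul_left, real_inner_comm (φ l) v]; ring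
    rw [e1, e2]; ring
  have hs : HasSum (fun l => inner ℝ v (φ l) • φ l) v := by
    unfold HasSum
    simp only [SummationFilter.unconditional_filter]
    rw [tendsto_iff_norm_sub_tendsto_zero]
    have h1 : Tendsto (fun s : Finset ℕ => ‖v‖ ^ 2 - ∑ l ∈ s, inner ℝ v (φ l) ^ 2) atTop (𝓝 0) := by
      have := (tendsto_const_nhds (x := ‖v‖ ^ 2)).sub hv
      simpa using this
    have h2 := h1.sqrt
    rw [Real.sqrt_zero] at h2
    refine h2.congr fun s => ?_
    rw [← key s, Real.sqrt_sq (norm_nonneg _)]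
  have := hs.mapL (innerSL ℝ h)
  simp only [innerSL_apply_apply, real_inner_smul_right] at this
  rwa [real_inner_comm] at this

theorem sum_sq_inner_le {φ : ℕ → H} (hφ : Orthonormal ℝ φ) (v : H) (s : Finset ℕ) :
    ∑ l ∈ s, inner ℝ v (φ l) ^ 2 ≤ ‖v‖ ^ 2 := by
  have := hφ.sum_inner_products_le (s := s) v
  refine le_trans (le_of_eq (Finset.sum_congr rfl fun l _ => ?_)) this
  rw [Real.norm_eq_abs, sq_abs, real_inner_comm]

/-- Weighted Cauchy–Schwarz for a linear functional given by a series. -/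
theorem sq_le_of_weighted_coeff {s G f : ℕ → ℝ} {lam V g t F : ℝ} (hs : ∀ l, 0 ≤ s l)
    (hl : 0 < lam) (hG : ∀ m, ∑ l ∈ Finset.range m, G l ^ 2 / (s l + lam) ≤ V)
    (hg : HasSum (fun l => G l * f l) g) (ht : HasSum (fun l => s l * f l * f l) t)
    (hF : ∀ m, ∑ l ∈ Finset.range m, f l ^ 2 ≤ F) : g ^ 2 ≤ V * (t + lam * F) := by
  have hV : 0 ≤ V := by simpa using hG 0
  refine le_of_tendsto (hg.tendsto_sum_nat.pow 2) (Eventually.of_forall fun m => ?_)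
  have h1 : (∑ l ∈ Finset.range m, G l * f l) ^ 2
      ≤ (∑ l ∈ Finset.range m, G l ^ 2 / (s l + lam))
        * ∑ l ∈ Finset.range m, (s l + lam) * f l ^ 2 := by
    refine Finset.sum_sq_le_sum_mul_sum_of_sq_le_mul _ (fun l _ => ?_) (fun l _ => ?_)
      fun l _ => le_of_eq ?_
    · have := hs l; positivity
    · have := hs l; positivity
    · have : s l + lam ≠ 0 := by have := hs l; positivity
      field_simp
  refine h1.trans (mul_le_mul (hG m) ?_ (Finset.sum_nonneg fun l _ => ?_) hV)
  · simp only [add_mul, Finset.sum_add_distrib, ← Finset.mul_sum]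
    have h2 : ∑ l ∈ Finset.range m, s l * f l ^ 2 ≤ t := by
      refine le_trans (le_of_eq (Finset.sum_congr rfl fun l _ => ?_))
        (sum_le_hasSum (Finset.range m) (fun l _ => ?_) ht)
      · ring
      · have := mul_nonneg (hs l) (mul_self_nonneg (f l)); linarith
    have h3 := mul_le_mul_of_nonneg_left (hF m) hl.le
    linarith
  · have := hs l; positivity

end Ridge

/-! ### The reproducing kernel Hilbert space as the image of the operator `sqrtKernelOp`. -/

section Kernel

variable {d : ℕ} {𝒯 : Set (Euc d)}

/-- The eigenvalues of a bounded kernel on a compact set are bounded. -/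
theorem IsEigensystem.exists_bound (h𝒯 : IsCompact 𝒯) {K : Euc d → Euc d → ℝ}
    (hK : IsKernel 𝒯 K) {ψ : HilbertBasis ℕ ℝ (L2 𝒯)} {θ : ℕ → ℝ} (hψ : IsEigensystem 𝒯 K ψ θ) :
    ∃ C, ∀ l, θ l ≤ C := by
  obtain ⟨C, hC⟩ := hK.bounded
  have : IsFiniteMeasure (volume.restrict 𝒯) :=
    ⟨by rw [Measure.restrict_apply_univ]; exact h𝒯.measure_lt_top⟩
  set v : ℝ := (volume.restrict 𝒯).real Set.univ with hv
  have hC' : ∀ u ∈ 𝒯, ∀ v ∈ 𝒯, |K u v| ≤ max C 0 := fun u hu v hv =>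
    (hC u hu v hv).trans (le_max_left _ _)
  set D := max C 0 * ((v + 1) / 2) with hD
  have hv0 : 0 ≤ v := measureReal_nonneg
  have hD0 : 0 ≤ D := mul_nonneg (le_max_right _ _) (by positivity)
  refine ⟨1 + D ^ 2 * v, fun l => ?_⟩
  have hf2 : MemLp (ψ l : L2 𝒯) 2 (volume.restrict 𝒯) := Lp.memLp _
  have hnorm : ∫ u in 𝒯, (ψ l : L2 𝒯) u ^ 2 = 1 := by
    have h1 : inner ℝ (ψ l) (ψ l) = (1 : ℝ) := by
      rw [real_inner_self_eq_norm_sq, ψ.orthonormal.1 l]; norm_num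
    rw [L2.inner_def] at h1
    rw [← h1]
    congr 1; ext u; simp [sq]
  have hI : ∫ u in 𝒯, |(ψ l : L2 𝒯) u| ≤ (v + 1) / 2 := by
    have h1 : ∫ u in 𝒯, |(ψ l : L2 𝒯) u| ≤ ∫ u in 𝒯, (1 / 2 + (1 / 2) * (ψ l : L2 𝒯) u ^ 2) := by
      refine integral_mono (hf2.integrable one_le_two).abs
        ((integrable_const _).add (hf2.integrable_sq.const_mul _)) fun u => ?_
      simp only
      rw [← sq_abs]
      nlinarith [sq_nonneg (|(ψ l : L2 𝒯) u| - 1)]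
    refine h1.trans (le_of_eq ?_)
    rw [integral_add (integrable_const _) (hf2.integrable_sq.const_mul _), integral_const_mul,
      hnorm, integral_const, smul_eq_mul, ← hv]
    ring
  -- The eigenvalue equation bounds `θ l * ψ l` uniformly by the bound of K and the L¹ norm of `ψ
  -- l`. Since `ψ l` has norm 1, integrating the square bounds `θ l`.
  have hpt : ∀ᵐ u ∂(volume.restrict 𝒯), (θ l * (ψ l : L2 𝒯) u) ^ 2 ≤ D ^ 2 := by
    filter_upwards [hψ.eigen l, ae_restrict_mem h𝒯.isClosed.measurableSet] with u hu hmem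
    rw [← hu, ← sq_abs]
    refine pow_le_pow_left₀ (abs_nonneg _) ?_ 2
    calc |∫ v in 𝒯, K u v * (ψ l : L2 𝒯) v| ≤ ∫ v in 𝒯, |K u v * (ψ l : L2 𝒯) v| :=
          abs_integral_le_integral_abs
      _ ≤ ∫ v in 𝒯, max C 0 * |(ψ l : L2 𝒯) v| := by
          refine integral_mono_of_nonneg (Eventually.of_forall fun _ => abs_nonneg _)
            ((hf2.integrable one_le_two).abs.const_mul _) ?_
          filter_upwards [ae_restrict_mem h𝒯.isClosed.measurableSet] with v hv
          rw [abs_mul]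
          exact mul_le_mul_of_nonneg_right (hC' u hmem v hv) (abs_nonneg _)
      _ ≤ D := by
          rw [integral_const_mul]
          exact mul_le_mul_of_nonneg_left hI (le_max_right _ _)
  have h2 : θ l ^ 2 ≤ D ^ 2 * v := by
    have h3 : ∫ u in 𝒯, (θ l * (ψ l : L2 𝒯) u) ^ 2 ≤ ∫ _ in 𝒯, D ^ 2 :=
      integral_mono_ae (hf2.const_mul _).integrable_sq (integrable_const _) hpt
    simp only [mul_pow] at h3
    rw [integral_const_mul, hnorm, mul_one, integral_const, smul_eq_mul, ← hv] at h3
    linarith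
  nlinarith [hψ.nonneg l, sq_nonneg (θ l - 1)]

section Operator

variable {ψ : HilbertBasis ℕ ℝ (L2 𝒯)} {θ : ℕ → ℝ}

theorem exists_repr (ψ : HilbertBasis ℕ ℝ (L2 𝒯)) {a : ℕ → ℝ} (ha : Summable fun l => a l ^ 2) :
    ∃ g : L2 𝒯, (∀ l, inner ℝ g (ψ l) = a l) ∧ HasSum (fun l => a l • ψ l) g := by
  let b : lp (fun _ : ℕ => ℝ) 2 := ⟨a, memℓp_gen (by simpa using ha)⟩
  refine ⟨ψ.repr.symm b, fun l => ?_, ψ.hasSum_repr_symm b⟩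
  rw [real_inner_comm, ← ψ.repr_apply_apply, LinearIsometryEquiv.apply_symm_apply]

theorem hasSum_sq_inner (ψ : HilbertBasis ℕ ℝ (L2 𝒯)) (g : L2 𝒯) :
    HasSum (fun l => inner ℝ g (ψ l) ^ 2) (‖g‖ ^ 2) := by
  have := ψ.hasSum_inner_mul_inner g g
  rw [real_inner_self_eq_norm_sq] at this
  refine this.congr_fun ?_ |> id
  intro l
  rw [real_inner_comm g (ψ l), sq]

theorem eq_of_inner_basis_eq (ψ : HilbertBasis ℕ ℝ (L2 𝒯)) {f g : L2 𝒯}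
    (h : ∀ l, inner ℝ f (ψ l) = inner ℝ g (ψ l)) : f = g := by
  refine ψ.repr.injective ?_
  ext l
  rw [ψ.repr_apply_apply, ψ.repr_apply_apply, real_inner_comm, h l, real_inner_comm]

/-- Bounded eigenvalues make the series defining the operator converge; without convergence the
`tsum` would be the default value 0. -/
theorem inner_sqrtKernelOp_basis (hθ : ∀ l, 0 ≤ θ l) {C : ℝ} (hC : ∀ l, θ l ≤ C) (f : L2 𝒯)
    (l : ℕ) : inner ℝ (sqrtKernelOp ψ θ f) (ψ l) = √(θ l) * inner ℝ f (ψ l) := by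
  have hs : Summable fun l => (√(θ l) * inner ℝ f (ψ l)) ^ 2 := by
    refine Summable.of_nonneg_of_le (fun _ => sq_nonneg _) (fun l => ?_)
      ((hasSum_sq_inner ψ f).summable.mul_left C)
    rw [mul_pow, Real.sq_sqrt (hθ l)]
    exact mul_le_mul_of_nonneg_right (hC l) (sq_nonneg _)
  obtain ⟨g, hg, hgs⟩ := exists_repr ψ hs
  rw [sqrtKernelOp, hgs.tsum_eq, hg]

theorem sqrtKernelOp_sub (hθ : ∀ l, 0 ≤ θ l) {C : ℝ} (hC : ∀ l, θ l ≤ C) (f g : L2 𝒯) :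
    sqrtKernelOp ψ θ (f - g) = sqrtKernelOp ψ θ f - sqrtKernelOp ψ θ g := by
  refine eq_of_inner_basis_eq ψ fun l => ?_
  simp only [inner_sub_left, inner_sqrtKernelOp_basis hθ hC]
  ring

theorem inner_sqrtKernelOp_comm (hθ : ∀ l, 0 ≤ θ l) {C : ℝ} (hC : ∀ l, θ l ≤ C) (f g : L2 𝒯) :
    inner ℝ (sqrtKernelOp ψ θ f) g = inner ℝ f (sqrtKernelOp ψ θ g) := by
  rw [← ψ.tsum_inner_mul_inner (sqrtKernelOp ψ θ f) g, ← ψ.tsum_inner_mul_inner f]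
  refine tsum_congr fun l => ?_
  rw [inner_sqrtKernelOp_basis hθ hC, real_inner_comm (sqrtKernelOp ψ θ g) (ψ l),
    inner_sqrtKernelOp_basis hθ hC, real_inner_comm (ψ l) g]
  ring

/-- The preimage has the coefficients of f divided by `√(θ l)`. Where `θ l = 0` the coefficient of f
vanishes, and division by zero returns the coefficient 0 that is wanted. -/
theorem InRKHS.exists_lift (hθ : ∀ l, 0 ≤ θ l) {C : ℝ} (hC : ∀ l, θ l ≤ C) {f : L2 𝒯}
    (hf : InRKHS ψ θ f) : ∃ g, sqrtKernelOp ψ θ g = f ∧ ‖g‖ ^ 2 = rkhsNormSq ψ θ f := by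
  have e : ∀ l, (inner ℝ f (ψ l) / √(θ l)) ^ 2 = inner ℝ f (ψ l) ^ 2 / θ l := fun l => by
    rw [div_pow, Real.sq_sqrt (hθ l)]
  obtain ⟨g, hg, -⟩ := exists_repr ψ (a := fun l => inner ℝ f (ψ l) / √(θ l))
    (by simp only [e]; exact hf.2)
  refine ⟨g, eq_of_inner_basis_eq ψ fun l => ?_, ?_⟩
  · rw [inner_sqrtKernelOp_basis hθ hC, hg]
    by_cases h : θ l = 0
    · simp [h, hf.1 l h]
    · have : √(θ l) ≠ 0 := (Real.sqrt_pos.2 (lt_of_le_of_ne (hθ l) (Ne.symm h))).ne'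
      field_simp
  · rw [← (hasSum_sq_inner ψ g).tsum_eq, rkhsNormSq]
    exact tsum_congr fun l => by rw [hg, e]

/-- The norm bound is only an inequality, because components of g with `θ l = 0` are lost. Together
with `InRKHS.exists_lift` it identifies the RKHS norm as the least norm of a preimage, so penalised
minimisation over ℋ(K) is a ridge problem over L². -/
theorem inRKHS_sqrtKernelOp (hθ : ∀ l, 0 ≤ θ l) {C : ℝ} (hC : ∀ l, θ l ≤ C) (g : L2 𝒯) :
    InRKHS ψ θ (sqrtKernelOp ψ θ g) ∧ rkhsNormSq ψ θ (sqrtKernelOp ψ θ g) ≤ ‖g‖ ^ 2 := by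
  have hle : ∀ l, inner ℝ (sqrtKernelOp ψ θ g) (ψ l) ^ 2 / θ l ≤ inner ℝ g (ψ l) ^ 2 := by
    intro l
    rw [inner_sqrtKernelOp_basis hθ hC, mul_pow, Real.sq_sqrt (hθ l)]
    by_cases h : θ l = 0
    · simp [h, sq_nonneg]
    · rw [mul_div_cancel_left₀ _ h]
  have hs := (hasSum_sq_inner ψ g)
  have hsum : Summable fun l => inner ℝ (sqrtKernelOp ψ θ g) (ψ l) ^ 2 / θ l :=
    Summable.of_nonneg_of_le (fun l => div_nonneg (sq_nonneg _) (hθ l)) hle hs.summable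
  refine ⟨⟨fun l h => ?_, hsum⟩, ?_⟩
  · rw [inner_sqrtKernelOp_basis hθ hC, h]; simp
  · rw [← hs.tsum_eq]
    exact hsum.tsum_le_tsum hle hs.summable

/-- The defining property of the residual sum of squares in terms of the ridge problem. -/
theorem exists_rss_eq (hθ : ∀ l, 0 ≤ θ l) {C : ℝ} (hC : ∀ l, θ l ≤ C) {ω r : ℝ} (hω : 0 < ω)
    (hr : 0 < r) (y : ℕ → ℝ) (x : ℕ → L2 𝒯) {s e : ℕ} (hse : s < e) :
    ∃ f₀ : L2 𝒯,
      rss ψ θ ω r y x s e = ∑ j ∈ Finset.Ioc s e, (y j - inner ℝ (sqrtKernelOp ψ θ (x j)) f₀) ^ 2 ∧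
      ∀ f : L2 𝒯, rss ψ θ ω r y x s e + ω * ((e - s : ℕ) : ℝ) ^ (1 / (2 * r + 1)) * ‖f₀‖ ^ 2
        ≤ ∑ j ∈ Finset.Ioc s e, (y j - inner ℝ (sqrtKernelOp ψ θ (x j)) f) ^ 2
          + ω * ((e - s : ℕ) : ℝ) ^ (1 / (2 * r + 1)) * ‖f‖ ^ 2 := by
  have hm : (0 : ℝ) < ((e - s : ℕ) : ℝ) := by exact_mod_cast Nat.sub_pos_of_lt hse
  have hcast : ((e - s : ℕ) : ℝ) = (e : ℝ) - s := Nat.cast_sub hse.le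
  have ha : 0 ≤ 1 / ((e : ℝ) - s) := by rw [← hcast]; positivity
  have hlam : 0 < regParam ω r (e - s) := mul_pos hω (Real.rpow_pos_of_pos hm _)
  have hsa := fun a b => inner_sqrtKernelOp_comm (ψ := ψ) hθ hC a b
  -- The estimator is obtained by choice, so its minimality needs an actual minimiser: the image of
  -- a ridge minimiser.
  have hmin : IsPenMin ψ θ ω r y x s e (betaHat ψ θ ω r y x s e) := by
    obtain ⟨f₁, hf₁⟩ := exists_ridge_minimizer (fun j => sqrtKernelOp ψ θ (x j)) y
      (Finset.Ioc s e) ha hlam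
    refine Classical.epsilon_spec (p := IsPenMin ψ θ ω r y x s e) ⟨sqrtKernelOp ψ θ f₁,
      (inRKHS_sqrtKernelOp hθ hC f₁).1, fun b' hb' => ?_⟩
    obtain ⟨g, hg, hgn⟩ := hb'.exists_lift hθ hC
    have h1 := hf₁ g
    have h2 := mul_le_mul_of_nonneg_left (inRKHS_sqrtKernelOp (ψ := ψ) hθ hC f₁).2 hlam.le
    simp only [hsa, hg] at h1
    rw [penLoss, penLoss, ← hgn]
    linarith
  obtain ⟨f₀, hf₀, hf₀n⟩ := hmin.1.exists_lift hθ hC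
  refine ⟨f₀, ?_, fun f => ?_⟩
  · simp only [rss, hsa, hf₀]
  · have h1 := hmin.2 _ (inRKHS_sqrtKernelOp (ψ := ψ) hθ hC f).1
    have h2 := mul_le_mul_of_nonneg_left (inRKHS_sqrtKernelOp (ψ := ψ) hθ hC f).2 hlam.le
    rw [penLoss, penLoss, ← hf₀n] at h1
    -- Passing from averages to sums multiplies the penalty by the length m, and `m * m^(-2r/(2r+1))
    -- = m^(1/(2r+1))`.
    have h3 : ((e - s : ℕ) : ℝ) * regParam ω r (e - s)
        = ω * ((e - s : ℕ) : ℝ) ^ (1 / (2 * r + 1)) := by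
      have h5 : 1 / (2 * r + 1) = 1 + -(2 * r) / (2 * r + 1) := by field_simp; ring
      rw [regParam, h5, Real.rpow_add hm, Real.rpow_one]; ring
    have h4 := mul_le_mul_of_nonneg_left (h1.trans (add_le_add_right h2 _)) hm.le
    rw [mul_add, mul_add, ← mul_assoc, ← mul_assoc, ← mul_assoc, ← mul_assoc, h3, ← hcast,
      mul_one_div_cancel hm.ne', one_mul, one_mul] at h4
    simp only [hsa]
    exact h4

end Operator

end Kernel


/-! ### Residual sums of squares on a good sample. -/

section Deterministic

variable {E : Type*} [NormedAddCommGroup E] [InnerProductSpace ℝ E]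

/-- Comparison of the residual sum of squares of ridge regression with the sum of squares of the
residuals of a fixed vector. -/
theorem ridge_residual_bounds {z : ℕ → E} {y : ℕ → ℝ} {S : Finset ℕ} {f₀ fs : E} {R m ω B b : ℝ}
    (hω : 1 / 2 ≤ ω) (hm : 0 ≤ m) (hR : R = ∑ j ∈ S, (y j - inner ℝ (z j) f₀) ^ 2)
    (hmin : R + ω * m * ‖f₀‖ ^ 2
      ≤ ∑ j ∈ S, (y j - inner ℝ (z j) fs) ^ 2 + ω * m * ‖fs‖ ^ 2)
    (hfs : ‖fs‖ ^ 2 ≤ B) (hb : ω * m * B ≤ b)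
    (hn : ∀ h : E, |∑ j ∈ S, (y j - inner ℝ (z j) fs) * inner ℝ (z j) h|
      ≤ 1 / 4 * ∑ j ∈ S, inner ℝ (z j) h ^ 2 + 1 / 16 * (m * ‖h‖ ^ 2) + b) :
    ∑ j ∈ S, (y j - inner ℝ (z j) fs) ^ 2 - 6 * b ≤ R ∧
      R ≤ ∑ j ∈ S, (y j - inner ℝ (z j) fs) ^ 2 + b := by
  have hωm : m ≤ 2 * (ω * m) := by nlinarith
  have h0 : 0 ≤ ω * m := by nlinarith
  have hB : ω * m * ‖fs‖ ^ 2 ≤ b := (mul_le_mul_of_nonneg_left hfs h0).trans hb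
  have hf0 : 0 ≤ ω * m * ‖f₀‖ ^ 2 := mul_nonneg h0 (sq_nonneg _)
  refine ⟨?_, by linarith⟩
  set D := ∑ j ∈ S, (y j - inner ℝ (z j) fs) ^ 2 with hD
  set h := f₀ - fs with hh
  have e1 : R = D - 2 * ∑ j ∈ S, (y j - inner ℝ (z j) fs) * inner ℝ (z j) h
      + ∑ j ∈ S, inner ℝ (z j) h ^ 2 := by
    rw [hR, hD, Finset.mul_sum, ← Finset.sum_sub_distrib, ← Finset.sum_add_distrib]
    refine Finset.sum_congr rfl fun j _ => ?_
    rw [hh, inner_sub_right]; ring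
  have h1 := (abs_le.1 (hn h)).2
  have h2 : 0 ≤ ∑ j ∈ S, inner ℝ (z j) h ^ 2 := Finset.sum_nonneg fun _ _ => sq_nonneg _
  have h3 : ‖h‖ ^ 2 ≤ 2 * ‖f₀‖ ^ 2 + 2 * ‖fs‖ ^ 2 := by
    have := norm_sub_le f₀ fs
    have h5 := norm_nonneg (f₀ - fs)
    rw [hh]
    nlinarith [sq_nonneg (‖f₀‖ - ‖fs‖), norm_nonneg f₀, norm_nonneg fs]
  -- Nothing bounds `‖f₀‖` in advance. An eighth of this quantity puts half of the penalty of `f₀`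
  -- into the lower bound for R; minimality bounds that penalty by `D + b - R`, and solving for R
  -- gives the constant 6.
  have h4 : m * ‖h‖ ^ 2 ≤ 4 * (ω * m * ‖f₀‖ ^ 2) + 4 * (ω * m * ‖fs‖ ^ 2) := by
    calc m * ‖h‖ ^ 2 ≤ (2 * (ω * m)) * (2 * ‖f₀‖ ^ 2 + 2 * ‖fs‖ ^ 2) :=
          mul_le_mul hωm h3 (sq_nonneg _) (by positivity)
      _ = _ := by ring
  linarith

/-- The deterministic properties of a sample from which the consistency of the segmentation
algorithm follows.  `G k` is the coefficient on `(η k, η (k + 1)]`, `A` is the set of end points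
of the intervals under consideration, and `b m` is the stochastic error on an interval of
length `m`. -/
structure GoodSample (z : ℕ → E) (ε y : ℕ → ℝ) (R : ℕ → ℕ → ℝ) (G : ℕ → E) (η : ℕ → ℕ)
    (κ : ℕ → ℝ) (𝒦 n Δ : ℕ) (A : Set ℕ) (q ω B : ℝ) (b : ℕ → ℝ) (M₀ : ℕ) : Prop where
  η_zero : η 0 = 0
  η_last : η (𝒦 + 1) = n
  spacing : ∀ k ≤ 𝒦, η k + Δ ≤ η (k + 1)
  spacing_pos : 1 ≤ Δ
  one_le : 1 ≤ 𝒦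
  response_eq : ∀ k ≤ 𝒦, ∀ j, η k < j → j ≤ η (k + 1) → y j = inner ℝ (z j) (G k) + ε j
  norm_coef : ∀ k ≤ 𝒦, ‖G k‖ ^ 2 ≤ B
  half_le : 1 / 2 ≤ ω
  q_nonneg : 0 ≤ q
  jump_pos : ∀ k, 1 ≤ k → k ≤ 𝒦 → 0 < κ k
  anchor : ∀ k, 1 ≤ k → k ≤ 𝒦 → η k ∈ A
  error_mono : Monotone b
  penalty_le : ∀ m : ℕ, ω * (m : ℝ) ^ q * B ≤ b m
  short_le : ∀ k, 1 ≤ k → k ≤ 𝒦 → κ k * M₀ ≤ b 0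
  rss_min : ∀ s e, s < e → ∃ f₀ : E, R s e = ∑ j ∈ Finset.Ioc s e, (y j - inner ℝ (z j) f₀) ^ 2 ∧
    ∀ f : E, R s e + ω * ((e - s : ℕ) : ℝ) ^ q * ‖f₀‖ ^ 2
      ≤ ∑ j ∈ Finset.Ioc s e, (y j - inner ℝ (z j) f) ^ 2 + ω * ((e - s : ℕ) : ℝ) ^ q * ‖f‖ ^ 2
  noise : ∀ s e, s < e → e ≤ n → s ∈ A ∨ e ∈ A → ∀ h : E,
    |∑ j ∈ Finset.Ioc s e, ε j * inner ℝ (z j) h|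
      ≤ 1 / 100 * ∑ j ∈ Finset.Ioc s e, inner ℝ (z j) h ^ 2
        + 1 / 100 * (((e - s : ℕ) : ℝ) ^ q * ‖h‖ ^ 2) + b (e - s)
  cross : ∃ T : ℕ → E → ℝ, ∀ k, 1 ≤ k → k ≤ 𝒦 → ∀ s e, s < e → e ≤ n → s = η k ∨ e = η k →
    M₀ ≤ e - s → ∀ h : E,
    |∑ j ∈ Finset.Ioc s e, inner ℝ (z j) (G k - G (k - 1)) * inner ℝ (z j) h
        - ((e - s : ℕ) : ℝ) * T k h|
      ≤ 1 / 100 * ∑ j ∈ Finset.Ioc s e, inner ℝ (z j) h ^ 2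
        + 1 / 100 * (((e - s : ℕ) : ℝ) ^ q * ‖h‖ ^ 2) + b (e - s)
  signal : ∀ k, 1 ≤ k → k ≤ 𝒦 → ∀ s e, s < e → e ≤ n → s = η k ∨ e = η k →
    |∑ j ∈ Finset.Ioc s e, inner ℝ (z j) (G k - G (k - 1)) ^ 2 - ((e - s : ℕ) : ℝ) * κ k|
      ≤ 1 / 100 * (((e - s : ℕ) : ℝ) * κ k) + b (e - s)
  signal_noise : ∀ k, 1 ≤ k → k ≤ 𝒦 → ∀ s e, s < e → e ≤ n → s = η k ∨ e = η k →
    |∑ j ∈ Finset.Ioc s e, ε j * inner ℝ (z j) (G k - G (k - 1))|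
      ≤ 1 / 100 * (((e - s : ℕ) : ℝ) * κ k) + b (e - s)

namespace GoodSample

variable {z : ℕ → E} {ε y : ℕ → ℝ} {R : ℕ → ℕ → ℝ} {G : ℕ → E} {η : ℕ → ℕ}
    {κ : ℕ → ℝ} {𝒦 n Δ : ℕ} {A : Set ℕ} {q ω B : ℝ} {b : ℕ → ℝ} {M₀ : ℕ}
    (hg : GoodSample z ε y R G η κ 𝒦 n Δ A q ω B b M₀)

include hg

theorem B_nonneg : 0 ≤ B := (sq_nonneg _).trans (hg.norm_coef 0 (Nat.zero_le _))

theorem error_nonneg (m : ℕ) : 0 ≤ b m := by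
  refine le_trans ?_ (hg.penalty_le m)
  have := hg.B_nonneg
  have := hg.half_le
  have : 0 ≤ ω := by linarith
  positivity

theorem rpow_le {m m' : ℕ} (h : m ≤ m') : (m : ℝ) ^ q ≤ (m' : ℝ) ^ q :=
  Real.rpow_le_rpow (Nat.cast_nonneg m) (by exact_mod_cast h) hg.q_nonneg

/-- Errors on the part of an interval that precedes or follows a change point, when the
coefficients from the other side of the change point are used. -/
theorem near_piece {k : ℕ} (hk : 1 ≤ k) (hk' : k ≤ 𝒦) {s e : ℕ} (hse : s < e) (hen : e ≤ n)
    (ha : s = η k ∨ e = η k) {v : ℝ} (hv : ((e - s : ℕ) : ℝ) * κ k ≤ v) {σ : ℝ} (hσ : |σ| = 1)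
    {u : ℕ → ℝ} (hu : ∀ j ∈ Finset.Ioc s e, u j = ε j + σ * inner ℝ (z j) (G k - G (k - 1))) :
    (∀ h : E, |∑ j ∈ Finset.Ioc s e, u j * inner ℝ (z j) h|
      ≤ 1 / 10 * ∑ j ∈ Finset.Ioc s e, inner ℝ (z j) h ^ 2
        + 1 / 100 * (((e - s : ℕ) : ℝ) ^ q * ‖h‖ ^ 2) + 5 * b (e - s) + 5 * v) ∧
    |∑ j ∈ Finset.Ioc s e, u j ^ 2 - ∑ j ∈ Finset.Ioc s e, ε j ^ 2| ≤ 3 * b (e - s) + 2 * v := by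
  have hA : s ∈ A ∨ e ∈ A := by
    rcases ha with h | h
    · exact Or.inl (h ▸ hg.anchor k hk hk')
    · exact Or.inr (h ▸ hg.anchor k hk hk')
  have hQ := hg.signal k hk hk' s e hse hen ha
  have hN := hg.signal_noise k hk hk' s e hse hen ha
  have hσ2 : σ ^ 2 = 1 := by rw [← sq_abs, hσ]; norm_num
  have hb := hg.error_nonneg (e - s)
  set hk0 := G k - G (k - 1) with hhk
  set Q := ∑ j ∈ Finset.Ioc s e, inner ℝ (z j) hk0 ^ 2 with hQd
  have hv0 : 0 ≤ v := le_trans (mul_nonneg (Nat.cast_nonneg _) (hg.jump_pos k hk hk').le) hv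
  have hQle : Q ≤ 101 / 100 * v + b (e - s) := by
    have := (abs_le.1 hQ).2
    linarith
  have hQ0 : 0 ≤ Q := Finset.sum_nonneg fun _ _ => sq_nonneg _
  constructor
  · intro h
    have e1 : ∑ j ∈ Finset.Ioc s e, u j * inner ℝ (z j) h
        = ∑ j ∈ Finset.Ioc s e, ε j * inner ℝ (z j) h
          + ∑ j ∈ Finset.Ioc s e, σ * inner ℝ (z j) hk0 * inner ℝ (z j) h := by
      rw [← Finset.sum_add_distrib]
      exact Finset.sum_congr rfl fun j hj => by rw [hu j hj]; ring
    have e2 : |∑ j ∈ Finset.Ioc s e, σ * inner ℝ (z j) hk0 * inner ℝ (z j) h|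
        ≤ 1 / 16 * ∑ j ∈ Finset.Ioc s e, inner ℝ (z j) h ^ 2 + 4 * Q := by
      refine (Finset.abs_sum_le_sum_abs _ _).trans ?_
      rw [hQd, Finset.mul_sum, Finset.mul_sum, ← Finset.sum_add_distrib]
      refine Finset.sum_le_sum fun j _ => ?_
      rw [abs_mul, abs_mul, hσ, one_mul, ← sq_abs (inner ℝ (z j) h), ← sq_abs (inner ℝ (z j) hk0)]
      nlinarith [sq_nonneg (|inner ℝ (z j) h| - 8 * |inner ℝ (z j) hk0|)]
    have e3 := hg.noise s e hse hen hA h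
    have e4 : 0 ≤ ∑ j ∈ Finset.Ioc s e, inner ℝ (z j) h ^ 2 :=
      Finset.sum_nonneg fun _ _ => sq_nonneg _
    rw [e1]
    refine (abs_add_le _ _).trans ?_
    linarith
  · have e1 : ∑ j ∈ Finset.Ioc s e, u j ^ 2 - ∑ j ∈ Finset.Ioc s e, ε j ^ 2
        = 2 * σ * ∑ j ∈ Finset.Ioc s e, ε j * inner ℝ (z j) hk0 + Q := by
      rw [hQd, Finset.mul_sum, ← Finset.sum_sub_distrib, ← Finset.sum_add_distrib]
      refine Finset.sum_congr rfl fun j hj => ?_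
      rw [hu j hj]
      linear_combination (inner ℝ (z j) hk0) ^ 2 * hσ2
    rw [e1]
    refine (abs_add_le _ _).trans ?_
    rw [abs_mul, abs_mul, hσ, abs_of_nonneg hQ0]
    norm_num
    linarith

/-- On an interval whose coefficients are constant apart from short pieces at the ends, the
residual sum of squares is close to the sum of the squared errors. -/
theorem abs_rss_sub_le {c p r e k : ℕ} (hk : k ≤ 𝒦) (hcp : c ≤ p) (hpr : p < r) (hre : r ≤ e)
    (hen : e ≤ n) (hpA : p ∈ A ∨ r ∈ A) (hp : η k ≤ p) (hr : r ≤ η (k + 1)) {v : ℝ} (hv : 0 ≤ v)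
    (hl : c = p ∨ (1 ≤ k ∧ p = η k ∧ η (k - 1) ≤ c ∧ ((p - c : ℕ) : ℝ) * κ k ≤ v))
    (hrt : r = e ∨ (k + 1 ≤ 𝒦 ∧ r = η (k + 1) ∧ e ≤ η (k + 1 + 1) ∧
      ((e - r : ℕ) : ℝ) * κ (k + 1) ≤ v)) :
    |R c e - ∑ j ∈ Finset.Ioc c e, ε j ^ 2| ≤ 100 * (b (e - c) + v) := by
  obtain ⟨f₀, hR, hmin⟩ := hg.rss_min c e (by omega)
  set u : ℕ → ℝ := fun j => y j - inner ℝ (z j) (G k) with hu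
  set m : ℝ := ((e - c : ℕ) : ℝ) ^ q with hm
  set β := b (e - c) with hβ
  have hβ0 : 0 ≤ β := hg.error_nonneg _
  -- the three pieces
  have piece_l : (∀ h : E, |∑ j ∈ Finset.Ioc c p, u j * inner ℝ (z j) h|
      ≤ 1 / 10 * ∑ j ∈ Finset.Ioc c p, inner ℝ (z j) h ^ 2
        + 1 / 100 * (m * ‖h‖ ^ 2) + 5 * β + 5 * v) ∧
      |∑ j ∈ Finset.Ioc c p, u j ^ 2 - ∑ j ∈ Finset.Ioc c p, ε j ^ 2| ≤ 3 * β + 2 * v := by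
    rcases hcp.eq_or_lt with rfl | hlt
    · simp only [Finset.Ioc_self, Finset.sum_empty, abs_zero, sub_zero, mul_zero, zero_add]
      exact ⟨fun h => by positivity, by positivity⟩
    · rcases hl with hl | ⟨h1, h2, h3, h4⟩
      · omega
      have hb1 : b (p - c) ≤ β := hg.error_mono (by omega)
      have hm1 := hg.rpow_le (by omega : p - c ≤ e - c)
      obtain ⟨ha, hb⟩ := hg.near_piece h1 hk hlt (by omega) (Or.inr h2) h4
        (σ := -1) (by norm_num) (u := u) (fun j hj => by
          have hj := Finset.mem_Ioc.1 hj
          have e1 : k - 1 + 1 = k := by omega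
          simp only [hu]
          rw [hg.response_eq (k - 1) (by omega) j (by omega) (by rw [e1]; omega), inner_sub_right]
          ring)
      refine ⟨fun h => (ha h).trans ?_, hb.trans (by linarith)⟩
      have := mul_le_mul_of_nonneg_right hm1 (sq_nonneg ‖h‖)
      linarith
  have piece_r : (∀ h : E, |∑ j ∈ Finset.Ioc r e, u j * inner ℝ (z j) h|
      ≤ 1 / 10 * ∑ j ∈ Finset.Ioc r e, inner ℝ (z j) h ^ 2
        + 1 / 100 * (m * ‖h‖ ^ 2) + 5 * β + 5 * v) ∧
      |∑ j ∈ Finset.Ioc r e, u j ^ 2 - ∑ j ∈ Finset.Ioc r e, ε j ^ 2| ≤ 3 * β + 2 * v := by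
    rcases hre.eq_or_lt with rfl | hlt
    · simp only [Finset.Ioc_self, Finset.sum_empty, abs_zero, sub_zero, mul_zero, zero_add]
      exact ⟨fun h => by positivity, by positivity⟩
    · rcases hrt with hrt | ⟨h1, h2, h3, h4⟩
      · omega
      have hb1 : b (e - r) ≤ β := hg.error_mono (by omega)
      have hm1 := hg.rpow_le (by omega : e - r ≤ e - c)
      obtain ⟨ha, hb⟩ := hg.near_piece (k := k + 1) (by omega) h1 hlt (by omega) (Or.inl h2) h4
        (σ := 1) (by norm_num) (u := u) (fun j hj => by
          have hj := Finset.mem_Ioc.1 hj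
          simp only [hu]
          rw [hg.response_eq (k + 1) (by omega) j (by omega) (by omega), inner_sub_right,
            Nat.add_sub_cancel]
          ring)
      refine ⟨fun h => (ha h).trans ?_, hb.trans (by linarith)⟩
      have := mul_le_mul_of_nonneg_right hm1 (sq_nonneg ‖h‖)
      linarith
  have hum : ∀ j ∈ Finset.Ioc p r, u j = ε j := by
    intro j hj
    have hj := Finset.mem_Ioc.1 hj
    simp only [hu]
    rw [hg.response_eq k hk j (by omega) (by omega)]; ring
  have piece_m : ∀ h : E, |∑ j ∈ Finset.Ioc p r, u j * inner ℝ (z j) h|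
      ≤ 1 / 10 * ∑ j ∈ Finset.Ioc p r, inner ℝ (z j) h ^ 2
        + 1 / 100 * (m * ‖h‖ ^ 2) + β := by
    intro h
    rw [Finset.sum_congr rfl fun j hj => by rw [hum j hj]]
    refine (hg.noise p r hpr (by omega) hpA h).trans ?_
    have hb1 : b (r - p) ≤ β := hg.error_mono (by omega)
    have hm1 := hg.rpow_le (by omega : r - p ≤ e - c)
    have := mul_le_mul_of_nonneg_right hm1 (sq_nonneg ‖h‖)
    have h0 : 0 ≤ ∑ j ∈ Finset.Ioc p r, inner ℝ (z j) h ^ 2 :=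
      Finset.sum_nonneg fun _ _ => sq_nonneg _
    linarith
  have split : ∀ f : ℕ → ℝ, ∑ j ∈ Finset.Ioc c e, f j = ∑ j ∈ Finset.Ioc c p, f j
      + ∑ j ∈ Finset.Ioc p r, f j + ∑ j ∈ Finset.Ioc r e, f j := by
    intro f
    rw [Finset.sum_Ioc_consecutive f hcp hpr.le, Finset.sum_Ioc_consecutive f (by omega) hre]
  have hm0 : 0 ≤ m := by positivity
  have hpen := hg.penalty_le (e - c)
  -- The error adds up the three pieces: `5β + 5v` from each end and `β` from the middle.
  obtain ⟨lo, hi⟩ := ridge_residual_bounds (b := 11 * β + 10 * v) hg.half_le hm0 hR (hmin (G k))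
    (hg.norm_coef k hk) (by linarith) (fun h => by
      rw [split, split]
      have h1 := piece_l.1 h
      have h2 := piece_m h
      have h3 := piece_r.1 h
      have h4 : ∀ a : ℕ, ∀ d : ℕ, 0 ≤ ∑ j ∈ Finset.Ioc a d, inner ℝ (z j) h ^ 2 :=
        fun a d => Finset.sum_nonneg fun _ _ => sq_nonneg _
      have h5 := h4 c p
      have h6 := h4 p r
      have h7 := h4 r e
      have h8 : 0 ≤ m * ‖h‖ ^ 2 := by positivity
      refine (abs_add_three _ _ _).trans ?_
      simp only [hu] at h1 h2 h3
      linarith)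
  have hd : |∑ j ∈ Finset.Ioc c e, u j ^ 2 - ∑ j ∈ Finset.Ioc c e, ε j ^ 2| ≤ 6 * β + 4 * v := by
    have h2 : ∑ j ∈ Finset.Ioc p r, u j ^ 2 = ∑ j ∈ Finset.Ioc p r, ε j ^ 2 :=
      Finset.sum_congr rfl fun j hj => by rw [hum j hj]
    have h1 := abs_le.1 piece_l.2
    have h3 := abs_le.1 piece_r.2
    rw [split, split, h2, abs_le]
    constructor <;> linarith
  have hd := abs_le.1 hd
  rw [abs_le]
  constructor <;> linarith

set_option maxHeartbeats 800000 in
/-- A change point increases the residual sum of squares. -/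
theorem le_rss_of_change {c e k : ℕ} (hk : 1 ≤ k) (hk' : k ≤ 𝒦) (hc : c < η k) (he : η k < e)
    (hc' : η (k - 1) ≤ c) (he' : e ≤ η (k + 1)) (hen : e ≤ n) :
    ∑ j ∈ Finset.Ioc c e, ε j ^ 2
      + 9 / 10 * (κ k * (((η k - c : ℕ) : ℝ) * ((e - η k : ℕ) : ℝ) / ((e - c : ℕ) : ℝ)))
      - 201 * b (e - c) ≤ R c e := by
  set m₁ : ℝ := ((η k - c : ℕ) : ℝ) with hm₁
  set m₂ : ℝ := ((e - η k : ℕ) : ℝ) with hm₂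
  have hm : ((e - c : ℕ) : ℝ) = m₁ + m₂ := by rw [hm₁, hm₂]; norm_cast; omega
  have h1 : 1 ≤ m₁ := by rw [hm₁]; exact_mod_cast (by omega : 1 ≤ η k - c)
  have h2 : 1 ≤ m₂ := by rw [hm₂]; exact_mod_cast (by omega : 1 ≤ e - η k)
  have hκ := hg.jump_pos k hk hk'
  have hanch := hg.anchor k hk hk'
  have e1 : k - 1 + 1 = k := by omega
  set β := b (e - c) with hβ
  have hβ0 : 0 ≤ β := hg.error_nonneg _
  have hM₀ : κ k * M₀ ≤ β := (hg.short_le k hk hk').trans (hg.error_mono (Nat.zero_le _))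
  rw [hm]
  -- If one side is shorter than `M₀`, the claimed gain is at most `κ k * M₀ ≤ β`. The coefficient
  -- of the other side then serves the whole interval, and `abs_rss_sub_le` suffices.
  by_cases hs1 : η k - c < M₀
  · have hM : m₁ ≤ M₀ := by rw [hm₁]; exact_mod_cast hs1.le
    have hv : m₁ * κ k ≤ β :=
      (mul_comm _ _).trans_le ((mul_le_mul_of_nonneg_left hM hκ.le).trans hM₀)
    have := hg.abs_rss_sub_le (c := c) (p := η k) (r := e) (e := e) (k := k) hk' hc.le he le_rfl
      hen (Or.inl hanch) le_rfl he' hβ0 (Or.inr ⟨hk, rfl, hc', hv⟩) (Or.inl rfl)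
    have h3 := (abs_le.1 this).1
    have h4 : m₁ * m₂ / (m₁ + m₂) ≤ m₁ := by
      rw [div_le_iff₀ (by linarith)]
      exact mul_le_mul_of_nonneg_left (by linarith) (by linarith)
    have h5 := mul_le_mul_of_nonneg_left h4 hκ.le
    linarith
  by_cases hs2 : e - η k < M₀
  · have hM : m₂ ≤ M₀ := by rw [hm₂]; exact_mod_cast hs2.le
    have hv : m₂ * κ k ≤ β :=
      (mul_comm _ _).trans_le ((mul_le_mul_of_nonneg_left hM hκ.le).trans hM₀)
    have := hg.abs_rss_sub_le (c := c) (p := c) (r := η k) (e := e) (k := k - 1) (by omega) le_rfl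
      hc he.le hen (Or.inr hanch) hc' (by rw [e1]) hβ0 (Or.inl rfl)
      (Or.inr ⟨by omega, by rw [e1], by rw [e1]; exact he',
        by rw [e1]; exact hv⟩)
    have h3 := (abs_le.1 this).1
    have h4 : m₁ * m₂ / (m₁ + m₂) ≤ m₂ := by
      rw [div_le_iff₀ (by linarith), mul_comm]
      exact mul_le_mul_of_nonneg_left (by linarith) (by linarith)
    have h5 := mul_le_mul_of_nonneg_left h4 hκ.le
    linarith
  obtain ⟨T, hT⟩ := hg.cross
  set h₀ := G k - G (k - 1) with hh₀
  set a₁ : ℝ := m₁ / (m₁ + m₂) with ha₁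
  set a₂ : ℝ := m₂ / (m₁ + m₂) with ha₂
  have hsum : a₁ + a₂ = 1 := by rw [ha₁, ha₂, ← add_div, div_self (by linarith)]
  have ha₁0 : 0 ≤ a₁ := by positivity
  have ha₂0 : 0 ≤ a₂ := by positivity
  -- The best constant coefficient for the population risk: the average of the two coefficients
  -- weighted by the lengths of the sides.
  set fs : E := a₁ • G (k - 1) + a₂ • G k with hfs
  have hnfs : ‖fs‖ ^ 2 ≤ B := by
    have n1 : ‖fs‖ ≤ a₁ * ‖G (k - 1)‖ + a₂ * ‖G k‖ := by
      refine (norm_add_le _ _).trans (le_of_eq ?_)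
      rw [norm_smul, norm_smul, Real.norm_of_nonneg ha₁0, Real.norm_of_nonneg ha₂0]
    have n2 : ‖G (k - 1)‖ ≤ √B := Real.le_sqrt_of_sq_le (hg.norm_coef _ (by omega))
    have n3 : ‖G k‖ ≤ √B := Real.le_sqrt_of_sq_le (hg.norm_coef _ hk')
    have n4 : ‖fs‖ ≤ √B := by
      calc ‖fs‖ ≤ a₁ * √B + a₂ * √B := n1.trans (by gcongr)
        _ = √B := by rw [← add_mul, hsum, one_mul]
    calc ‖fs‖ ^ 2 ≤ √B ^ 2 := pow_le_pow_left₀ (norm_nonneg _) n4 2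
      _ = B := Real.sq_sqrt hg.B_nonneg
  set u : ℕ → ℝ := fun j => y j - inner ℝ (z j) fs with hu
  have hu1 : ∀ j ∈ Finset.Ioc c (η k), u j = ε j - a₂ * inner ℝ (z j) h₀ := by
    intro j hj
    have hj := Finset.mem_Ioc.1 hj
    simp only [hu]
    rw [hg.response_eq (k - 1) (by omega) j (by omega) (by rw [e1]; omega), hfs, hh₀,
      inner_add_right, inner_sub_right, real_inner_smul_right, real_inner_smul_right]
    linear_combination (-(inner ℝ (z j) (G (k - 1)))) * hsum
  have hu2 : ∀ j ∈ Finset.Ioc (η k) e, u j = ε j + a₁ * inner ℝ (z j) h₀ := by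
    intro j hj
    have hj := Finset.mem_Ioc.1 hj
    simp only [hu]
    rw [hg.response_eq k hk' j (by omega) (by omega), hfs, hh₀,
      inner_add_right, inner_sub_right, real_inner_smul_right, real_inner_smul_right]
    linear_combination (-(inner ℝ (z j) (G k))) * hsum
  have split : ∀ f : ℕ → ℝ, ∑ j ∈ Finset.Ioc c e, f j = ∑ j ∈ Finset.Ioc c (η k), f j
      + ∑ j ∈ Finset.Ioc (η k) e, f j := fun f =>
    (Finset.sum_Ioc_consecutive f hc.le he.le).symm
  have hb1 : b (η k - c) ≤ β := hg.error_mono (by omega)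
  have hb2 : b (e - η k) ≤ β := hg.error_mono (by omega)
  obtain ⟨f₀, hR, hmin⟩ := hg.rss_min c e (by omega)
  rw [hm] at hmin
  set m : ℝ := (m₁ + m₂) ^ q with hmq
  have hm0 : 0 ≤ m := by positivity
  have hq1 : m₁ ^ q ≤ m := Real.rpow_le_rpow (by linarith) (by linarith) hg.q_nonneg
  have hq2 : m₂ ^ q ≤ m := Real.rpow_le_rpow (by linarith) (by linarith) hg.q_nonneg
  have hpen := hg.penalty_le (e - c)
  rw [hm, ← hmq] at hpen
  obtain ⟨lo, -⟩ := ridge_residual_bounds (b := 4 * β) hg.half_le hm0 hR (hmin fs) hnfs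
    (by linarith) (fun h => by
      have n1 := hg.noise c (η k) hc (by omega) (Or.inr hanch) h
      have n2 := hg.noise (η k) e he hen (Or.inl hanch) h
      have c1 := hT k hk hk' c (η k) hc (by omega) (Or.inr rfl) (by omega) h
      have c2 := hT k hk hk' (η k) e he hen (Or.inl rfl) (by omega) h
      rw [← hm₁] at n1 c1
      rw [← hm₂] at n2 c2
      rw [split, split]
      set Q₁ := ∑ j ∈ Finset.Ioc c (η k), inner ℝ (z j) h ^ 2 with hQ₁
      set Q₂ := ∑ j ∈ Finset.Ioc (η k) e, inner ℝ (z j) h ^ 2 with hQ₂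
      have hQ₁0 : 0 ≤ Q₁ := Finset.sum_nonneg fun _ _ => sq_nonneg _
      have hQ₂0 : 0 ≤ Q₂ := Finset.sum_nonneg fun _ _ => sq_nonneg _
      set S₁ := ∑ j ∈ Finset.Ioc c (η k), inner ℝ (z j) h₀ * inner ℝ (z j) h with hS₁
      set S₂ := ∑ j ∈ Finset.Ioc (η k) e, inner ℝ (z j) h₀ * inner ℝ (z j) h with hS₂
      set N₁ := ∑ j ∈ Finset.Ioc c (η k), ε j * inner ℝ (z j) h with hN₁
      set N₂ := ∑ j ∈ Finset.Ioc (η k) e, ε j * inner ℝ (z j) h with hN₂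
      have d1 : ∑ j ∈ Finset.Ioc c (η k), (y j - inner ℝ (z j) fs) * inner ℝ (z j) h
          = N₁ - a₂ * S₁ := by
        rw [hN₁, hS₁, Finset.mul_sum, ← Finset.sum_sub_distrib]
        refine Finset.sum_congr rfl fun j hj => ?_
        have := hu1 j hj
        simp only [hu] at this
        rw [this]; ring
      have d2 : ∑ j ∈ Finset.Ioc (η k) e, (y j - inner ℝ (z j) fs) * inner ℝ (z j) h
          = N₂ + a₁ * S₂ := by
        rw [hN₂, hS₂, Finset.mul_sum, ← Finset.sum_add_distrib]
        refine Finset.sum_congr rfl fun j hj => ?_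
        have := hu2 j hj
        simp only [hu] at this
        rw [this]; ring
      -- The residuals of `fs` have means of opposite sign on the two sides, so the population cross
      -- terms `T k h` cancel for every h. Only the deviations controlled by `cross` remain.
      have hcancel : a₂ * m₁ = a₁ * m₂ := by rw [ha₁, ha₂]; ring
      have d3 : N₁ - a₂ * S₁ + (N₂ + a₁ * S₂)
          = N₁ + N₂ - a₂ * (S₁ - m₁ * T k h) + a₁ * (S₂ - m₂ * T k h) := by
        linear_combination (T k h) * (-hcancel)
      rw [d1, d2, d3]
      have t1 := mul_le_mul_of_nonneg_right hq1 (sq_nonneg ‖h‖)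
      have t2 := mul_le_mul_of_nonneg_right hq2 (sq_nonneg ‖h‖)
      have p1 : |a₂ * (S₁ - m₁ * T k h)| ≤ |S₁ - m₁ * T k h| := by
        rw [abs_mul, abs_of_nonneg ha₂0]
        exact mul_le_of_le_one_left (abs_nonneg _) (by linarith)
      have p2 : |a₁ * (S₂ - m₂ * T k h)| ≤ |S₂ - m₂ * T k h| := by
        rw [abs_mul, abs_of_nonneg ha₁0]
        exact mul_le_of_le_one_left (abs_nonneg _) (by linarith)
      have p3 : 0 ≤ m * ‖h‖ ^ 2 := by positivity
      have p4 : |N₁ + N₂ - a₂ * (S₁ - m₁ * T k h) + a₁ * (S₂ - m₂ * T k h)|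
          ≤ |N₁| + |N₂| + |a₂ * (S₁ - m₁ * T k h)| + |a₁ * (S₂ - m₂ * T k h)| :=
        (abs_add_le _ _).trans (add_le_add ((abs_sub _ _).trans
          (add_le_add (abs_add_le _ _) le_rfl)) le_rfl)
      linarith)
  have s1 := hg.signal k hk hk' c (η k) hc (by omega) (Or.inr rfl)
  have s2 := hg.signal k hk hk' (η k) e he hen (Or.inl rfl)
  have w1 := hg.signal_noise k hk hk' c (η k) hc (by omega) (Or.inr rfl)
  have w2 := hg.signal_noise k hk hk' (η k) e he hen (Or.inl rfl)
  rw [← hm₁] at s1 w1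
  rw [← hm₂] at s2 w2
  have f1 : ∑ j ∈ Finset.Ioc c (η k), u j ^ 2 = ∑ j ∈ Finset.Ioc c (η k), ε j ^ 2
      - 2 * a₂ * ∑ j ∈ Finset.Ioc c (η k), ε j * inner ℝ (z j) h₀
      + a₂ ^ 2 * ∑ j ∈ Finset.Ioc c (η k), inner ℝ (z j) h₀ ^ 2 := by
    rw [Finset.mul_sum, Finset.mul_sum, ← Finset.sum_sub_distrib, ← Finset.sum_add_distrib]
    exact Finset.sum_congr rfl fun j hj => by rw [hu1 j hj]; ring
  have f2 : ∑ j ∈ Finset.Ioc (η k) e, u j ^ 2 = ∑ j ∈ Finset.Ioc (η k) e, ε j ^ 2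
      + 2 * a₁ * ∑ j ∈ Finset.Ioc (η k) e, ε j * inner ℝ (z j) h₀
      + a₁ ^ 2 * ∑ j ∈ Finset.Ioc (η k) e, inner ℝ (z j) h₀ ^ 2 := by
    rw [Finset.mul_sum, Finset.mul_sum, ← Finset.sum_add_distrib, ← Finset.sum_add_distrib]
    exact Finset.sum_congr rfl fun j hj => by rw [hu2 j hj]; ring
  have hsig : m₁ * m₂ / (m₁ + m₂) = a₂ * m₁ := by rw [ha₂]; ring
  have hsig' : a₁ * m₂ = a₂ * m₁ := by rw [ha₁, ha₂]; ring
  rw [hsig]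
  set Sg := κ k * (a₂ * m₁) with hSg
  have g1 : a₂ * (m₁ * κ k) = Sg := by rw [hSg]; ring
  have g2 : a₁ * (m₂ * κ k) = Sg := by rw [hSg, ← hsig']; ring
  have k1 := mul_le_mul_of_nonneg_left (abs_le.1 w1).2 ha₂0
  have k2 := mul_le_mul_of_nonneg_left (abs_le.1 w2).1 ha₁0
  have k3 := mul_le_mul_of_nonneg_left (abs_le.1 s1).1 (sq_nonneg a₂)
  have k4 := mul_le_mul_of_nonneg_left (abs_le.1 s2).1 (sq_nonneg a₁)
  have hSg0 : 0 ≤ Sg := by positivity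
  have g3 : a₂ ^ 2 * (m₁ * κ k) + a₁ ^ 2 * (m₂ * κ k) = Sg := by
    have : a₂ ^ 2 * (m₁ * κ k) + a₁ ^ 2 * (m₂ * κ k)
      = a₂ * (a₂ * (m₁ * κ k)) + a₁ * (a₁ * (m₂ * κ k)) := by ring
    rw [this, g1, g2, ← add_mul, add_comm a₂, hsum, one_mul]
  have bb1 : a₂ * b (η k - c) ≤ β := (mul_le_of_le_one_left (hg.error_nonneg _) (by linarith)).trans hb1
  have bb2 : a₁ * b (e - η k) ≤ β := (mul_le_of_le_one_left (hg.error_nonneg _) (by linarith)).trans hb2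
  have bb3 : a₂ ^ 2 * b (η k - c) ≤ β :=
    (mul_le_of_le_one_left (hg.error_nonneg _) (pow_le_one₀ (by assumption) (by linarith))).trans hb1
  have bb4 : a₁ ^ 2 * b (e - η k) ≤ β :=
    (mul_le_of_le_one_left (hg.error_nonneg _) (pow_le_one₀ (by assumption) (by linarith))).trans hb2
  simp only [hu] at f1 f2
  rw [split, f1, f2] at lo
  rw [split fun j => ε j ^ 2]
  linarith

end GoodSample

end Deterministic


/-- The signal `a c / (a + c)` is at least half of the shorter side, so a bound on the signal
becomes a bound on a distance. -/
theorem min_le_two_mul_mul_div_add {a c : ℝ} (ha : 0 < a) (hc : 0 < c) :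
    a ≤ 2 * (a * c / (a + c)) ∨ c ≤ 2 * (a * c / (a + c)) := by
  have h : 0 < a + c := by linarith
  rcases le_total a c with h' | h'
  · left
    rw [← mul_div_assoc, le_div_iff₀ h]; nlinarith
  · right
    rw [← mul_div_assoc, le_div_iff₀ h]; nlinarith

/-! ### The scan statistic, seeded intervals and localisation. -/

section Deterministic

variable {E : Type*} [NormedAddCommGroup E] [InnerProductSpace ℝ E]

/-- Every change point is well inside some seeded interval whose length is at most the minimal
spacing. -/
theorem exists_seededInterval {n Δ t : ℕ} (hΔ : 1 ≤ Δ) (h₁ : Δ ≤ t) (h₂ : t + Δ ≤ n) :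
    ∃ I ∈ seededIntervals n Δ, I.2 ≤ I.1 + Δ ∧ I.1 ≤ t ∧ t ≤ I.2 ∧ 4 * t ≤ 4 * I.1 + 3 * Δ ∧
      4 * I.2 ≤ 4 * t + 3 * Δ ∧ Δ ≤ 8 * (t - I.1) + 8 ∧ Δ ≤ 8 * (I.2 - t) + 8 := by
  have hΔ0 : (0 : ℝ) < Δ := by exact_mod_cast hΔ
  have hn0 : (0 : ℝ) < n := by exact_mod_cast (by omega : 0 < n)
  set x : ℝ := (n : ℝ) / Δ with hx
  have hx1 : 1 ≤ x := by
    rw [hx, one_le_div hΔ0]; exact_mod_cast (by omega : Δ ≤ n)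
  have hx0 : 0 < x := by linarith
  set m : ℕ := ⌈Real.logb 2 x⌉₊ with hm
  have hlog : 0 ≤ Real.logb 2 x := Real.logb_nonneg (by norm_num) hx1
  have hm1 : x ≤ 2 ^ m := by
    have := (Real.logb_le_iff_le_rpow (b := 2) (by norm_num) hx0).1 (Nat.le_ceil (Real.logb 2 x))
    rwa [Real.rpow_natCast] at this
  have hm2 : (2 : ℝ) ^ m < 2 * x := by
    have h := Nat.ceil_lt_add_one hlog
    have h3 : (m : ℝ) - 1 < Real.logb 2 x := by linarith
    have := (Real.lt_logb_iff_rpow_lt (b := 2) (by norm_num) hx0).1 h3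
    rw [Real.rpow_sub (by norm_num), Real.rpow_natCast, Real.rpow_one] at this
    linarith
  set h : ℝ := (n : ℝ) / 2 ^ (m + 1) with hh
  have hp : (0 : ℝ) < 2 ^ m := by positivity
  have hh0 : 0 < h := by positivity
  have hn : (n : ℝ) = 2 ^ (m + 1) * h := by rw [hh]; field_simp
  have hl : (n : ℝ) / 2 ^ m = 2 * h := by rw [hh, pow_succ]; field_simp
  have hxn : x * Δ = n := by rw [hx]; field_simp
  have hh1 : 2 * h ≤ Δ := by
    rw [← hl, div_le_iff₀ hp, ← hxn, mul_comm]; gcongr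
  have hh2 : (Δ : ℝ) < 4 * h := by
    have : (Δ : ℝ) / 2 < 2 * h := by
      rw [← hl, lt_div_iff₀ hp, ← hxn]; nlinarith
    linarith
  have ht1 : (Δ : ℝ) ≤ t := by exact_mod_cast h₁
  have ht2 : (t : ℝ) + Δ ≤ n := by exact_mod_cast h₂
  have hj0 : 0 ≤ (t : ℝ) / h - 1 / 2 := by
    have : 1 ≤ (t : ℝ) / h := by rw [le_div_iff₀ hh0]; linarith
    linarith
  -- Among the windows from `j h` to `j h + 2 h` this one has t in its middle half, at distance
  -- between `h/2` and `3h/2` from both ends. With `2h ≤ Δ < 4h` the distances lie between Δ/8 and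
  -- 3Δ/4; rounding the ends loses at most 1, which is the summand 8 in the statement.
  set j : ℕ := ⌊(t : ℝ) / h - 1 / 2⌋₊ with hj
  have hj1 : j * h ≤ t - h / 2 := by
    have := Nat.floor_le hj0
    have := mul_le_mul_of_nonneg_right this hh0.le
    rw [sub_mul, div_mul_cancel₀ _ hh0.ne'] at this
    linarith
  have hj2 : t - h / 2 < (j + 1) * h := by
    have := Nat.lt_floor_add_one ((t : ℝ) / h - 1 / 2)
    have := mul_lt_mul_of_pos_right this hh0
    rw [sub_mul, div_mul_cancel₀ _ hh0.ne'] at this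
    linarith
  have hj3 : j + 2 ≤ 2 ^ (m + 1) := by
    have : ((j : ℝ) + 2) * h ≤ 2 ^ (m + 1) * h := by rw [← hn]; linarith
    have := le_of_mul_le_mul_right this hh0
    exact_mod_cast this
  have a1 : (j : ℝ) * h ≤ ⌈(j : ℝ) * h⌉₊ := Nat.le_ceil _
  have a2 : (⌈(j : ℝ) * h⌉₊ : ℝ) < j * h + 1 := Nat.ceil_lt_add_one (by positivity)
  have c1 : (⌊(j : ℝ) * h + 2 * h⌋₊ : ℝ) ≤ j * h + 2 * h := Nat.floor_le (by positivity)
  have c2 : (j : ℝ) * h + 2 * h < ⌊(j : ℝ) * h + 2 * h⌋₊ + 1 := Nat.lt_floor_add_one _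
  have at' : ⌈(j : ℝ) * h⌉₊ ≤ t := Nat.ceil_le.2 (by linarith)
  have tc : t ≤ ⌊(j : ℝ) * h + 2 * h⌋₊ := Nat.le_floor (by linarith)
  refine ⟨(⌈(j : ℝ) * h⌉₊, ⌊(j : ℝ) * h + 2 * h⌋₊), ?_, ?_, at', tc, ?_, ?_, ?_, ?_⟩
  · rw [seededIntervals, Finset.mem_biUnion]
    refine ⟨m + 1, Finset.mem_Icc.2 ⟨by omega, le_rfl⟩, Finset.mem_image.2
      ⟨j + 1, Finset.mem_Icc.2 ⟨by omega, by omega⟩, ?_⟩⟩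
    rw [Nat.add_sub_cancel, hl, Nat.cast_add, Nat.cast_one, add_sub_cancel_right]
  · have : (⌊(j : ℝ) * h + 2 * h⌋₊ : ℝ) ≤ ⌈(j : ℝ) * h⌉₊ + Δ := by linarith
    exact_mod_cast this
  · have : 4 * (t : ℝ) ≤ 4 * ⌈(j : ℝ) * h⌉₊ + 3 * Δ := by linarith
    exact_mod_cast this
  · have : 4 * (⌊(j : ℝ) * h + 2 * h⌋₊ : ℝ) ≤ 4 * t + 3 * Δ := by linarith
    exact_mod_cast this
  · have : (Δ : ℝ) ≤ 8 * ((t : ℝ) - ⌈(j : ℝ) * h⌉₊) + 8 := by linarith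
    rw [← Nat.cast_sub at'] at this
    exact_mod_cast this
  · have : (Δ : ℝ) ≤ 8 * ((⌊(j : ℝ) * h + 2 * h⌋₊ : ℝ) - t) + 8 := by linarith
    rw [← Nat.cast_sub tc] at this
    exact_mod_cast this

namespace GoodSample

variable {z : ℕ → E} {ε y : ℕ → ℝ} {R : ℕ → ℕ → ℝ} {G : ℕ → E} {η : ℕ → ℕ}
    {κ : ℕ → ℝ} {𝒦 n Δ : ℕ} {A : Set ℕ} {q ω B : ℝ} {b : ℕ → ℝ} {M₀ : ℕ}
    (hg : GoodSample z ε y R G η κ 𝒦 n Δ A q ω B b M₀)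

include hg

/-- Windows inside a region without interior change points, up to change points close to its
ends. -/
theorem abs_rss_sub_le_of_region {s e k : ℕ} (hk : k ≤ 𝒦) (hen : e ≤ n) {v : ℝ} (hv : 0 ≤ v)
    (hl : η k ≤ s ∨ (1 ≤ k ∧ η (k - 1) ≤ s ∧ ((η k - s : ℕ) : ℝ) * κ k ≤ v))
    (hr : e ≤ η (k + 1) ∨ (k + 1 ≤ 𝒦 ∧ e ≤ η (k + 1 + 1) ∧
      ((e - η (k + 1) : ℕ) : ℝ) * κ (k + 1) ≤ v))
    {c f : ℕ} (hsc : s ≤ c) (hcf : c < f) (hfe : f ≤ e) (hA : c ∈ A ∨ f ∈ A) :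
    |R c f - ∑ j ∈ Finset.Ioc c f, ε j ^ 2| ≤ 100 * (b (f - c) + v) := by
  rcases le_or_gt f (η k) with h1 | h1
  · rcases hl with hl | ⟨k1, k2, -⟩
    · omega
    have e1 : k - 1 + 1 = k := by omega
    exact hg.abs_rss_sub_le (k := k - 1) (by omega) le_rfl hcf le_rfl (by omega) hA (by omega)
      (by rw [e1]; exact h1) hv (Or.inl rfl) (Or.inl rfl)
  rcases le_or_gt (η (k + 1)) c with h2 | h2
  · rcases hr with hr | ⟨k1, k2, -⟩
    · omega
    exact hg.abs_rss_sub_le (k := k + 1) k1 le_rfl hcf le_rfl (by omega) hA (by omega)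
      (by omega) hv (Or.inl rfl) (Or.inl rfl)
  have hsp := hg.spacing k hk
  have hsp' := hg.spacing_pos
  have mono : ∀ {x y : ℕ} {t : ℝ}, x ≤ y → 0 ≤ t → (y : ℝ) * t ≤ v → (x : ℝ) * t ≤ v :=
    fun h ht hy => (mul_le_mul_of_nonneg_right (by exact_mod_cast h) ht).trans hy
  -- The window is clipped to the k-th segment. What sticks out lies beyond an end change point of
  -- the region and is short by the assumption on v.
  refine hg.abs_rss_sub_le (k := k) (p := max c (η k)) (r := min f (η (k + 1))) hk
    (le_max_left _ _) ?_ (min_le_left _ _) (by omega) ?_ (le_max_right _ _) (min_le_right _ _) hv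
    ?_ ?_
  · simp only [max_lt_iff, lt_min_iff]; omega
  · rcases hA with hA | hA
    · left
      rcases le_or_gt (η k) c with h | h
      · rwa [max_eq_left h]
      · rw [max_eq_right h.le]
        rcases hl with hl | ⟨k1, -⟩
        · omega
        · exact hg.anchor k k1 hk
    · right
      rcases le_or_gt f (η (k + 1)) with h | h
      · rwa [min_eq_left h]
      · rw [min_eq_right h.le]
        rcases hr with hr | ⟨k1, -⟩
        · omega
        · exact hg.anchor _ (by omega) k1
  · rcases le_or_gt (η k) c with h | h
    · exact Or.inl (max_eq_left h).symm
    · rcases hl with hl | ⟨k1, k2, k3⟩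
      · omega
      rw [max_eq_right h.le]
      exact Or.inr ⟨k1, rfl, by omega, mono (by omega) (hg.jump_pos k k1 hk).le k3⟩
  · rcases le_or_gt f (η (k + 1)) with h | h
    · exact Or.inl (min_eq_left h)
    · rcases hr with hr | ⟨k1, k2, k3⟩
      · omega
      rw [min_eq_right h.le]
      exact Or.inr ⟨k1, rfl, by omega, mono (by omega) (hg.jump_pos _ (by omega) k1).le k3⟩

/-- The scan statistic is small in regions without interior change points. -/
theorem scan_le_of_region {s e k : ℕ} (hk : k ≤ 𝒦) (hen : e ≤ n) {v : ℝ} (hv : 0 ≤ v)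
    (hl : η k ≤ s ∨ (1 ≤ k ∧ η (k - 1) ≤ s ∧ ((η k - s : ℕ) : ℝ) * κ k ≤ v))
    (hr : e ≤ η (k + 1) ∨ (k + 1 ≤ 𝒦 ∧ e ≤ η (k + 1 + 1) ∧
      ((e - η (k + 1) : ℕ) : ℝ) * κ (k + 1) ≤ v))
    (hs : s ∈ A) (he : e ∈ A) {t : ℕ} (hst : s < t) (hte : t < e) :
    R s e - R s t - R t e ≤ 300 * (b (e - s) + v) := by
  have h1 := hg.abs_rss_sub_le_of_region hk hen hv hl hr le_rfl (hst.trans hte) le_rfl (Or.inl hs)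
  have h2 := hg.abs_rss_sub_le_of_region hk hen hv hl hr le_rfl hst hte.le (Or.inl hs)
  have h3 := hg.abs_rss_sub_le_of_region hk hen hv hl hr hst.le hte le_rfl (Or.inr he)
  have b1 : b (t - s) ≤ b (e - s) := hg.error_mono (by omega)
  have b2 : b (e - t) ≤ b (e - s) := hg.error_mono (by omega)
  rw [← Finset.sum_Ioc_consecutive (fun j => ε j ^ 2) hst.le hte.le] at h1
  have h1 := (abs_le.1 h1).2
  have h2 := (abs_le.1 h2).1
  have h3 := (abs_le.1 h3).1
  linarith

/-- Upper bound for the residual sum of squares on an interval with constant coefficients. -/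
theorem abs_rss_sub_le_of_pure {c f k : ℕ} (hk : k ≤ 𝒦) (hfn : f ≤ n) (hc : η k ≤ c) (hcf : c < f)
    (hf : f ≤ η (k + 1)) (hA : c ∈ A ∨ f ∈ A) :
    |R c f - ∑ j ∈ Finset.Ioc c f, ε j ^ 2| ≤ 100 * b (f - c) := by
  simpa using hg.abs_rss_sub_le (k := k) hk le_rfl hcf le_rfl hfn hA hc hf le_rfl (Or.inl rfl)
    (Or.inl rfl)

/-- The scan statistic at a change point. -/
theorem le_scan_of_change {c f k : ℕ} (hk : 1 ≤ k) (hk' : k ≤ 𝒦) (hfn : f ≤ n) (hc : c < η k)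
    (hf : η k < f) (hc' : η (k - 1) ≤ c) (hf' : f ≤ η (k + 1)) :
    9 / 10 * (κ k * (((η k - c : ℕ) : ℝ) * ((f - η k : ℕ) : ℝ) / ((f - c : ℕ) : ℝ)))
      - 401 * b (f - c) ≤ R c f - R c (η k) - R (η k) f := by
  have e1 : k - 1 + 1 = k := by omega
  have h1 := hg.le_rss_of_change hk hk' hc hf hc' hf' hfn
  have h2 := hg.abs_rss_sub_le_of_pure (k := k - 1) (by omega) (by omega) hc' hc (by rw [e1])
    (Or.inr (hg.anchor k hk hk'))
  have h3 := hg.abs_rss_sub_le_of_pure hk' hfn le_rfl hf hf' (Or.inl (hg.anchor k hk hk'))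
  have b1 : b (η k - c) ≤ b (f - c) := hg.error_mono (by omega)
  have b2 : b (f - η k) ≤ b (f - c) := hg.error_mono (by omega)
  rw [← Finset.sum_Ioc_consecutive (fun j => ε j ^ 2) hc.le hf.le] at h1
  have h2 := (abs_le.1 h2).2
  have h3 := (abs_le.1 h3).2
  linarith

/-- A maximiser of the scan statistic on a short interval with one change point is close to the
change point. -/
theorem localization {c f k t : ℕ} (hk : 1 ≤ k) (hk' : k ≤ 𝒦) (hfn : f ≤ n) (hc : c < η k)
    (hf : η k < f) (hlen : f ≤ c + Δ) (hcA : c ∈ A) (hfA : f ∈ A) (hct : c < t) (htf : t < f)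
    {τ : ℝ} (hτ : 300 * (b Δ + 1200 * b Δ) ≤ τ) (hsig : τ < R c f - R c t - R t f)
    (hmax : R c f - R c (η k) - R (η k) f ≤ R c f - R c t - R t f) :
    κ k * |(t : ℝ) - η k| ≤ 1200 * b Δ := by
  have e1 : k - 1 + 1 = k := by omega
  have sp1 := hg.spacing (k - 1) (by omega)
  rw [e1] at sp1
  have sp2 := hg.spacing k hk'
  have hkA := hg.anchor k hk hk'
  have hκ := hg.jump_pos k hk hk'
  have hb : ∀ m ≤ Δ, b m ≤ b Δ := fun m hm => hg.error_mono hm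
  have hb0 := hg.error_nonneg Δ
  have p1 := (abs_le.1 (hg.abs_rss_sub_le_of_pure (k := k - 1) (c := c) (f := η k) (by omega)
    (by omega) (by omega) hc (by rw [e1]) (Or.inr hkA))).2
  have p2 := (abs_le.1 (hg.abs_rss_sub_le_of_pure hk' hfn le_rfl hf (by omega) (Or.inl hkA))).2
  have q1 := hb (η k - c) (by omega)
  have q2 := hb (f - η k) (by omega)
  have hreg : ∀ {k' : ℕ}, k' ≤ 𝒦 → (η k' ≤ c ∨ (1 ≤ k' ∧ η (k' - 1) ≤ c ∧
      ((η k' - c : ℕ) : ℝ) * κ k' ≤ 1200 * b Δ)) → (f ≤ η (k' + 1) ∨ (k' + 1 ≤ 𝒦 ∧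
      f ≤ η (k' + 1 + 1) ∧ ((f - η (k' + 1) : ℕ) : ℝ) * κ (k' + 1) ≤ 1200 * b Δ)) → False := by
    intro k' h1 h2 h3
    have := hg.scan_le_of_region h1 hfn (by linarith) h2 h3 hcA hfA hct htf
    have := hb (f - c) (by omega)
    linarith
  rcases lt_trichotomy (η k) t with h | h | h
  · have l1 := hg.le_rss_of_change hk hk' hc h (by omega) (by omega) (by omega)
    have l2 := (abs_le.1 (hg.abs_rss_sub_le_of_pure hk' hfn h.le htf (by omega) (Or.inr hfA))).1
    have r1 := hb (t - c) (by omega)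
    have r2 := hb (f - t) (by omega)
    have s1 := Finset.sum_Ioc_consecutive (fun j => ε j ^ 2) hc.le h.le
    have s2 := Finset.sum_Ioc_consecutive (fun j => ε j ^ 2) h.le htf.le
    have hm : ((t - c : ℕ) : ℝ) = ((η k - c : ℕ) : ℝ) + ((t - η k : ℕ) : ℝ) := by
      norm_cast; omega
    have m1 : (0 : ℝ) < ((η k - c : ℕ) : ℝ) := by exact_mod_cast (by omega)
    have m2 : (0 : ℝ) < ((t - η k : ℕ) : ℝ) := by exact_mod_cast (by omega)
    rw [hm] at l1
    -- Maximality at t compares the two splits and gives `9/10` of the signal at most `501 b Δ`,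
    -- hence `κ k` times the shorter side at most `1200 b Δ`. If the shorter side were `η k - c`,
    -- the change point would sit at the end of the window and the scan statistic could not exceed
    -- τ.
    rcases min_le_two_mul_mul_div_add m1 m2 with h5 | h5
    · have := mul_le_mul_of_nonneg_left h5 hκ.le
      exact (hreg hk' (Or.inr ⟨hk, by omega, by linarith⟩) (Or.inl (by omega))).elim
    · have := mul_le_mul_of_nonneg_left h5 hκ.le
      rw [abs_of_pos (by rw [sub_pos]; exact_mod_cast h), ← Nat.cast_sub h.le]
      linarith
  · rw [h]; simpa using hb0
  · have l1 := hg.le_rss_of_change (c := t) (e := f) hk hk' h hf (by omega) (by omega) (by omega)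
    have l2 := (abs_le.1 (hg.abs_rss_sub_le_of_pure (k := k - 1) (c := c) (f := t) (by omega)
      (by omega) (by omega) hct (by rw [e1]; omega) (Or.inl hcA))).1
    have r1 := hb (f - t) (by omega)
    have r2 := hb (t - c) (by omega)
    have s1 := Finset.sum_Ioc_consecutive (fun j => ε j ^ 2) hct.le h.le
    have s2 := Finset.sum_Ioc_consecutive (fun j => ε j ^ 2) h.le hf.le
    have hm : ((f - t : ℕ) : ℝ) = ((η k - t : ℕ) : ℝ) + ((f - η k : ℕ) : ℝ) := by
      norm_cast; omega
    have m1 : (0 : ℝ) < ((η k - t : ℕ) : ℝ) := by exact_mod_cast (by omega)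
    have m2 : (0 : ℝ) < ((f - η k : ℕ) : ℝ) := by exact_mod_cast (by omega)
    rw [hm] at l1
    rcases min_le_two_mul_mul_div_add m1 m2 with h5 | h5
    · have := mul_le_mul_of_nonneg_left h5 hκ.le
      rw [abs_of_neg (by rw [sub_neg]; exact_mod_cast h), neg_sub, ← Nat.cast_sub h.le]
      linarith
    · have := mul_le_mul_of_nonneg_left h5 hκ.le
      refine (hreg (k' := k - 1) (by omega) (Or.inl (by omega)) (Or.inr ?_)).elim
      rw [e1]
      exact ⟨hk', by omega, by linarith⟩

/-- Every change point is detected on a short interval. -/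
theorem exists_signal (hΔ : 200 ≤ Δ) {k : ℕ} (hk : 1 ≤ k) (hk' : k ≤ 𝒦) {τ : ℝ}
    (hτ : τ ≤ κ k * Δ / 20) (hb : 10 ^ 7 * b Δ ≤ κ k * Δ) :
    ∃ I ∈ seededIntervals n Δ, I.2 ≤ I.1 + Δ ∧ 4 * η k ≤ 4 * I.1 + 3 * Δ ∧
      4 * I.2 ≤ 4 * η k + 3 * Δ ∧
      ∃ t, IsSignal (fun s e t => R s e - R s t - R t e) τ I t := by
  have e1 : k - 1 + 1 = k := by omega
  have sp1 := hg.spacing (k - 1) (by omega)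
  rw [e1] at sp1
  have sp2 := hg.spacing k hk'
  have mono : ∀ j, k + 1 + j ≤ 𝒦 + 1 → η (k + 1) ≤ η (k + 1 + j) := by
    intro j
    induction j with
    | zero => intro _; exact le_rfl
    | succ j ih =>
      intro hj
      have := hg.spacing (k + 1 + j) (by omega)
      have := ih (by omega)
      rw [← add_assoc]; omega
  have hn : η (k + 1) ≤ n := by
    have := mono (𝒦 - k) (by omega)
    rwa [show k + 1 + (𝒦 - k) = 𝒦 + 1 by omega, hg.η_last] at this
  have hκ := hg.jump_pos k hk hk'
  have hb0 := hg.error_nonneg Δ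
  obtain ⟨I, hI, hlen, h1, h2, h3, h4, h5, h6⟩ := exists_seededInterval (n := n) (Δ := Δ) (t := η k)
    (by omega) (by omega) (by omega)
  refine ⟨I, hI, hlen, h3, h4, ?_⟩
  have hne : (Finset.Ioo I.1 I.2).Nonempty := ⟨η k, Finset.mem_Ioo.2 ⟨by omega, by omega⟩⟩
  obtain ⟨t, ht, hmax⟩ := Finset.exists_max_image _ (fun t => R I.1 I.2 - R I.1 t - R t I.2) hne
  have ht := Finset.mem_Ioo.1 ht
  refine ⟨t, ht.1, ht.2, fun t' a1 a2 => hmax t' (Finset.mem_Ioo.2 ⟨a1, a2⟩), ?_⟩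
  have hW := hmax (η k) (Finset.mem_Ioo.2 ⟨by omega, by omega⟩)
  refine lt_of_lt_of_le ?_ hW
  have hsc := hg.le_scan_of_change hk hk' (c := I.1) (f := I.2) (by omega) (by omega) (by omega)
    (by omega) (by omega)
  have hbI : b (I.2 - I.1) ≤ b Δ := hg.error_mono (by omega)
  have hm : ((I.2 - I.1 : ℕ) : ℝ) = ((η k - I.1 : ℕ) : ℝ) + ((I.2 - η k : ℕ) : ℝ) := by
    norm_cast; omega
  have m1 : 12 / 100 * (Δ : ℝ) ≤ ((η k - I.1 : ℕ) : ℝ) := by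
    have a1 : (Δ : ℝ) ≤ 8 * ((η k - I.1 : ℕ) : ℝ) + 8 := by exact_mod_cast h5
    have a2 : (200 : ℝ) ≤ Δ := by exact_mod_cast hΔ
    linarith
  have m2 : 12 / 100 * (Δ : ℝ) ≤ ((I.2 - η k : ℕ) : ℝ) := by
    have a1 : (Δ : ℝ) ≤ 8 * ((I.2 - η k : ℕ) : ℝ) + 8 := by exact_mod_cast h6
    have a2 : (200 : ℝ) ≤ Δ := by exact_mod_cast hΔ
    linarith
  have hΔ0 : (200 : ℝ) ≤ Δ := by exact_mod_cast hΔ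
  rw [hm] at hsc
  -- Both sides have length at least 0.12 Δ, because `Δ ≥ 200` absorbs the rounding. Since `9/10 *
  -- 6/100` exceeds `1/20`, the surplus `0.004 κ k Δ` pays for the error `401 b Δ`.
  have hmin : 6 / 100 * (Δ : ℝ) ≤ ((η k - I.1 : ℕ) : ℝ) * ((I.2 - η k : ℕ) : ℝ) /
      (((η k - I.1 : ℕ) : ℝ) + ((I.2 - η k : ℕ) : ℝ)) := by
    rcases min_le_two_mul_mul_div_add (a := ((η k - I.1 : ℕ) : ℝ)) (c := ((I.2 - η k : ℕ) : ℝ))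
      (by linarith) (by linarith) with h | h <;> linarith
  have := mul_le_mul_of_nonneg_left hmin hκ.le
  have hpos : 0 < κ k * Δ := by positivity
  linarith

end GoodSample

end Deterministic


/-! ### Correctness of the recursive algorithm. -/

section Segmentation

variable {E : Type*} [NormedAddCommGroup E] [InnerProductSpace ℝ E]

/-- `s` is an accurate estimate of the change point `η i`; there is no error at the boundary. -/
def NearChange (η : ℕ → ℕ) (κ : ℕ → ℝ) (𝒦 : ℕ) (v : ℝ) (i s : ℕ) : Prop :=
  (i = 0 ∧ s = η i) ∨ (i = 𝒦 + 1 ∧ s = η i) ∨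
    (1 ≤ i ∧ i ≤ 𝒦 ∧ κ i * |(s : ℝ) - η i| ≤ v)

namespace GoodSample

variable {z : ℕ → E} {ε y : ℕ → ℝ} {R : ℕ → ℕ → ℝ} {G : ℕ → E} {η : ℕ → ℕ}
    {κ : ℕ → ℝ} {𝒦 n Δ : ℕ} {A : Set ℕ} {q ω B : ℝ} {b : ℕ → ℝ} {M₀ : ℕ}
    (hg : GoodSample z ε y R G η κ 𝒦 n Δ A q ω B b M₀)

include hg

theorem spacing_mono {i j : ℕ} (hij : i < j) (hj : j ≤ 𝒦 + 1) : η i + Δ ≤ η j := by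
  induction j, hij using Nat.le_induction with
  | base => exact hg.spacing i (by omega)
  | succ j hij ih =>
    have := hg.spacing j (by omega)
    have := ih (by omega)
    omega

/-- The condition on v makes every estimation error at most Δ/8. The form over ℕ lets `omega` handle
the positions of intervals. -/
theorem near_nat {v : ℝ} (hv : ∀ k, 1 ≤ k → k ≤ 𝒦 → 8 * v ≤ κ k * Δ) {i s : ℕ}
    (h : NearChange η κ 𝒦 v i s) : 8 * s ≤ 8 * η i + Δ ∧ 8 * η i ≤ 8 * s + Δ := by
  rcases h with ⟨-, rfl⟩ | ⟨-, rfl⟩ | ⟨h1, h2, h3⟩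
  · omega
  · omega
  · have hκ := hg.jump_pos i h1 h2
    have h4 := hv i h1 h2
    have h5 : 8 * |(s : ℝ) - η i| ≤ Δ := by
      refine le_of_mul_le_mul_left ?_ hκ
      linarith
    have h6 := abs_le.1 (show |(s : ℝ) - η i| ≤ Δ / 8 by linarith)
    constructor
    · have : 8 * (s : ℝ) ≤ 8 * η i + Δ := by linarith
      exact_mod_cast this
    · have : 8 * (η i : ℝ) ≤ 8 * s + Δ := by linarith
      exact_mod_cast this

variable {τ : ℝ} (hJ : ∀ I ∈ seededIntervals n Δ, I.1 ∈ A ∧ I.2 ∈ A) (hΔ : 200 ≤ Δ)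
  (hb : ∀ k, 1 ≤ k → k ≤ 𝒦 → 10 ^ 7 * b Δ ≤ κ k * Δ) (hτ : 300 * (b n + 1200 * b Δ) ≤ τ)
  (hτ' : ∀ k, 1 ≤ k → k ≤ 𝒦 → τ ≤ κ k * Δ / 20)

include hb in
theorem eight_mul_le (k : ℕ) (h1 : 1 ≤ k) (h2 : k ≤ 𝒦) : 8 * (1200 * b Δ) ≤ κ k * Δ := by
  have := hb k h1 h2
  have := hg.error_nonneg Δ
  linarith

include hJ hb hτ in
/-- A seeded interval with a signal has an interior change point which has not been found. -/
theorem exists_change_of_signal {i j s e : ℕ} (hij : i < j) (hj : j ≤ 𝒦 + 1) (hen : e ≤ n)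
    (hs : NearChange η κ 𝒦 (1200 * b Δ) i s) (he : NearChange η κ 𝒦 (1200 * b Δ) j e)
    {I : ℕ × ℕ} (hI : I ∈ seededIntervals n Δ) (hsI : s ≤ I.1) (hIe : I.2 ≤ e) {t : ℕ}
    (ht : IsSignal (fun s e t => R s e - R s t - R t e) τ I t) :
    ∃ k, i < k ∧ k < j ∧ I.1 < η k ∧ η k < I.2 := by
  -- Otherwise the interval lies in a region whose only change points are accurately estimated ones
  -- near its ends. There the scan statistic is at most `300 (b n + 1200 b Δ) ≤ τ`.
  by_contra hno
  push Not at hno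
  obtain ⟨ht1, ht2, -, ht3⟩ := ht
  have hs' := hg.near_nat (hg.eight_mul_le hb) hs
  have he' := hg.near_nat (hg.eight_mul_le hb) he
  have hbn : b (I.2 - I.1) ≤ b n := hg.error_mono (by omega)
  have hbΔ := hg.error_nonneg Δ
  have hsp := hg.spacing_pos
  -- the last change point among `i, …, j - 1` which is not after the interval's left end point
  let M := (Finset.Ico i j).filter fun k => k = i ∨ η k ≤ I.1
  have hMne : M.Nonempty := ⟨i, Finset.mem_filter.2 ⟨Finset.mem_Ico.2 ⟨le_rfl, hij⟩, Or.inl rfl⟩⟩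
  obtain ⟨hk1, hk2⟩ := Finset.mem_filter.1 (M.max'_mem hMne)
  have hkmax : ∀ k' ∈ M, k' ≤ M.max' hMne := fun k' h => M.le_max' k' h
  set k := M.max' hMne
  have hk1 := Finset.mem_Ico.1 hk1
  have hl : η k ≤ I.1 ∨ (1 ≤ k ∧ η (k - 1) ≤ I.1 ∧ ((η k - I.1 : ℕ) : ℝ) * κ k ≤ 1200 * b Δ) := by
    by_cases h : η k ≤ I.1
    · exact Or.inl h
    right
    have hki : k = i := hk2.resolve_right h
    rw [hki] at h ⊢
    rcases hs with ⟨h0, h1⟩ | ⟨h0, -⟩ | ⟨h1, h2, h3⟩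
    · omega
    · omega
    · have h4 := hg.spacing_mono (i := i - 1) (j := i) (by omega) (by omega)
      refine ⟨h1, by omega, ?_⟩
      refine le_trans ?_ h3
      rw [mul_comm, abs_sub_comm]
      refine mul_le_mul_of_nonneg_left (le_trans ?_ (le_abs_self _)) (hg.jump_pos i h1 h2).le
      rw [Nat.cast_sub (by omega)]
      have : (s : ℝ) ≤ I.1 := by exact_mod_cast hsI
      linarith
  have hr : I.2 ≤ η (k + 1) ∨ (k + 1 ≤ 𝒦 ∧ I.2 ≤ η (k + 1 + 1) ∧
      ((I.2 - η (k + 1) : ℕ) : ℝ) * κ (k + 1) ≤ 1200 * b Δ) := by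
    by_cases h : I.2 ≤ η (k + 1)
    · exact Or.inl h
    right
    have hkj : k + 1 = j := by
      by_contra hne
      have h1 : ¬ (k + 1 ∈ M) := fun h => by have := hkmax _ h; omega
      have h2 : ¬ (η (k + 1) ≤ I.1) := fun h' =>
        h1 (Finset.mem_filter.2 ⟨Finset.mem_Ico.2 ⟨by omega, by omega⟩, Or.inr h'⟩)
      have := hno (k + 1) (by omega) (by omega) (by omega)
      omega
    rw [hkj] at h ⊢
    rcases he with ⟨h0, -⟩ | ⟨h0, h1⟩ | ⟨h1, h2, h3⟩
    · omega
    · omega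
    · have h4 := hg.spacing_mono (i := j) (j := j + 1) (by omega) (by omega)
      refine ⟨h2, by omega, ?_⟩
      refine le_trans ?_ h3
      rw [mul_comm]
      refine mul_le_mul_of_nonneg_left (le_trans ?_ (le_abs_self _)) (hg.jump_pos j h1 h2).le
      rw [Nat.cast_sub (by omega)]
      have : (I.2 : ℝ) ≤ e := by exact_mod_cast hIe
      linarith
  have := hg.scan_le_of_region (k := k) (by omega) (hIe.trans hen) (by linarith) hl hr (hJ I hI).1
    (hJ I hI).2 ht1 ht2
  simp only at ht3
  linarith

include hJ hΔ hb hτ hτ' in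
-- Invariant of the recursion: both ends of the current interval are the boundary or accurate
-- estimates of the change points i < j. A remaining change point between them signals on a seeded
-- interval of length at most Δ, so the shortest signalling interval is no longer than Δ. It
-- contains a new change point by `exists_change_of_signal`, and only one by its length;
-- `localization` makes the split point an accurate estimate, which restores the invariant on both
-- halves.
theorem frbs_output {s e : ℕ} {S : Finset ℕ}
    (h : FRBS (seededIntervals n Δ) (fun s e t => R s e - R s t - R t e) τ s e S) :
    ∀ {i j : ℕ}, i < j → j ≤ 𝒦 + 1 → e ≤ n → NearChange η κ 𝒦 (1200 * b Δ) i s →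
      NearChange η κ 𝒦 (1200 * b Δ) j e →
      ∃ f : ℕ → ℕ, (∀ k, i < k → k < j → NearChange η κ 𝒦 (1200 * b Δ) k (f k)) ∧
        S = (Finset.Ioo i j).image f := by
  have near := fun {i s : ℕ} => hg.near_nat (i := i) (s := s) (hg.eight_mul_le hb)
  -- The interval of `exists_signal` reaches at most 3Δ/4 from its change point, while the ends s
  -- and e are at least 7Δ/8 away, so it survives all earlier splits.
  have detect : ∀ {i j s e : ℕ}, j ≤ 𝒦 + 1 → NearChange η κ 𝒦 (1200 * b Δ) i s →
      NearChange η κ 𝒦 (1200 * b Δ) j e → ∀ k, i < k → k < j → ∃ I ∈ seededIntervals n Δ,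
        s ≤ I.1 ∧ I.2 ≤ e ∧ I.2 ≤ I.1 + Δ ∧
        ∃ t, IsSignal (fun s e t => R s e - R s t - R t e) τ I t := by
    intro i j s e hj hs he k hik hkj
    obtain ⟨I, hI, h1, h2, h3, h4⟩ := hg.exists_signal hΔ (k := k) (by omega) (by omega)
      (hτ' k (by omega) (by omega)) (hb k (by omega) (by omega))
    have a1 := hg.spacing_mono hik (by omega)
    have a2 := hg.spacing_mono hkj hj
    have a3 := near hs
    have a4 := near he
    exact ⟨I, hI, by omega, by omega, h1, h4⟩
  induction h with
  | finish s e h =>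
    intro i j hij hj hen hs he
    refine ⟨id, fun k h1 h2 => ?_, ?_⟩
    · obtain ⟨I, hI, h3, h4, -, t, ht⟩ := detect hj hs he k h1 h2
      exact absurd ht (h I hI h3 h4 t)
    · rw [eq_comm, Finset.image_eq_empty, Finset.eq_empty_iff_forall_notMem]
      intro k hk
      have hk := Finset.mem_Ioo.1 hk
      obtain ⟨I, hI, h3, h4, -, t, ht⟩ := detect hj hs he k hk.1 hk.2
      exact h I hI h3 h4 t ht
  | split s e I t B₁ B₂ hI hsI hIe ht hmin h₁ h₂ ih₁ ih₂ =>
    intro i j hij hj hen hs he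
    obtain ⟨k₀, h1, h2, -⟩ := hg.exists_change_of_signal hJ hb hτ hij hj hen hs he hI hsI hIe ht
    obtain ⟨I', hI', h3, h4, h5, h6⟩ := detect hj hs he k₀ h1 h2
    have hlen := hmin I' hI' h3 h4 h6
    obtain ⟨k, hk1, hk2, hk3, hk4⟩ :=
      hg.exists_change_of_signal hJ hb hτ hij hj hen hs he hI hsI hIe ht
    obtain ⟨ht1, ht2, ht3, ht4⟩ := ht
    have hbn : b Δ ≤ b n := by
      refine hg.error_mono ?_
      have := hg.spacing_mono (i := 0) (j := 𝒦 + 1) (by omega) le_rfl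
      rw [hg.η_last] at this
      omega
    have hloc := hg.localization (k := k) (by omega) (by omega) (hIe.trans hen) hk3 hk4 (by omega)
      (hJ I hI).1 (hJ I hI).2 ht1 ht2 (τ := τ) (by linarith) ht4 (ht3 (η k) hk3 hk4)
    have ht : NearChange η κ 𝒦 (1200 * b Δ) k t := Or.inr (Or.inr ⟨by omega, by omega, hloc⟩)
    obtain ⟨f₁, n₁, r₁⟩ := ih₁ hk1 (by omega) (by omega) hs ht
    obtain ⟨f₂, n₂, r₂⟩ := ih₂ hk2 hj hen ht he
    refine ⟨fun l => if l < k then f₁ l else if l = k then t else f₂ l, fun l a1 a2 => ?_, ?_⟩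
    · rcases lt_trichotomy l k with h | h | h
      · simp only [h, if_true]; exact n₁ l a1 h
      · simp only [h, lt_irrefl, if_false, if_true]; exact ht
      · simp only [h.not_gt, h.ne', if_false]; exact n₂ l h a2
    · have e1 : Finset.Ioo i j = insert k (Finset.Ioo i k ∪ Finset.Ioo k j) := by
        ext l; simp only [Finset.mem_Ioo, Finset.mem_insert, Finset.mem_union]; omega
      rw [e1, Finset.image_insert, Finset.image_union, r₁, r₂]
      simp only [lt_irrefl, if_false, if_true]
      congr 2
      · exact Finset.image_congr fun l hl => by
          have := (Finset.mem_Ioo.1 hl).2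
          simp only [this, if_true]
      · exact Finset.image_congr fun l hl => by
          have := (Finset.mem_Ioo.1 hl).1
          simp only [this.not_gt, this.ne', if_false]

include hJ hΔ hb hτ hτ' in
/-- On a good sample, the segmentation algorithm is consistent. -/
theorem localizes {S : Finset ℕ}
    (h : FRBS (seededIntervals n Δ) (fun s e t => R s e - R s t - R t e) τ 0 n S) :
    Localizes S 𝒦 η κ (1200 * b Δ) := by
  obtain ⟨f, hf, rfl⟩ := hg.frbs_output hJ hΔ hb hτ hτ' h (i := 0) (j := 𝒦 + 1) (by omega) le_rfl
    le_rfl (Or.inl ⟨rfl, hg.η_zero.symm⟩) (Or.inr (Or.inl ⟨rfl, hg.η_last.symm⟩))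
  have near := fun {i s : ℕ} => hg.near_nat (i := i) (s := s) (hg.eight_mul_le hb)
  have mono : ∀ k l, 0 < k → k < l → l < 𝒦 + 1 → f k < f l := by
    intro k l h1 h2 h3
    have a1 := near (hf k h1 (by omega))
    have a2 := near (hf l (by omega) h3)
    have a3 := hg.spacing_mono h2 (by omega)
    omega
  have hinj : Set.InjOn f (Finset.Ioo 0 (𝒦 + 1) : Finset ℕ) := by
    intro k hk l hl hkl
    have hk := Finset.mem_Ioo.1 hk
    have hl := Finset.mem_Ioo.1 hl
    rcases lt_trichotomy k l with h | h | h
    · have := mono k l hk.1 h hl.2; omega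
    · exact h
    · have := mono l k hl.1 h hk.2; omega
  have hcard : ((Finset.Ioo 0 (𝒦 + 1)).image f).card = 𝒦 := by
    rw [Finset.card_image_of_injOn hinj, Nat.card_Ioo]; omega
  refine ⟨hcard, fun k => ?_⟩
  have huniq := Finset.orderEmbOfFin_unique hcard (f := fun k : Fin 𝒦 => f (k + 1))
    (fun k => Finset.mem_image.2 ⟨k + 1, Finset.mem_Ioo.2 ⟨by omega, by omega⟩, rfl⟩)
    (fun k l hkl => mono _ _ (by omega) (by simpa using hkl) (by omega))
  have := congrFun huniq k
  rw [← this]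
  rcases hf (k + 1) (by omega) (by omega) with ⟨h, -⟩ | ⟨h, -⟩ | ⟨-, -, h⟩
  · omega
  · omega
  · exact h

end GoodSample

end Segmentation


/-! ### Moments of the data and the spectrum of `K^{1/2} Σ K^{1/2}`. -/

section Moments

variable {d : ℕ} {𝒯 : Set (Euc d)} {Ω : Type*} [mΩ : MeasurableSpace Ω] {μ : Measure Ω}
  {X : ℕ → Ω → L2 𝒯} {ε : ℕ → Ω → ℝ}

theorem measurable_inner_left (g : L2 𝒯) : Measurable fun x : L2 𝒯 => (inner ℝ x g : ℝ) :=
  (continuous_id.inner continuous_const).measurable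

namespace DataAssumption

variable (hd : DataAssumption μ X ε)

include hd

theorem memLp_inner {j : ℕ} (hj : 1 ≤ j) (g : L2 𝒯) : MemLp (fun w => (inner ℝ (X j w) g : ℝ)) 2 μ :=
  (hd.sq_integrable j hj).inner_const g

theorem measurable_inner {j : ℕ} (hj : 1 ≤ j) (g : L2 𝒯) :
    Measurable fun w => (inner ℝ (X j w) g : ℝ) :=
  (measurable_inner_left g).comp (hd.measurable_X j hj)

theorem integrable_inner_mul_inner {j : ℕ} (hj : 1 ≤ j) (f g : L2 𝒯) :
    Integrable (fun w => (inner ℝ (X j w) f : ℝ) * inner ℝ (X j w) g) μ :=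
  (hd.memLp_inner hj f).integrable_mul (hd.memLp_inner hj g)

theorem integral_inner_mul_inner {j : ℕ} (hj : 1 ≤ j) (f g : L2 𝒯) :
    ∫ w, (inner ℝ (X j w) f : ℝ) * inner ℝ (X j w) g ∂μ = covForm μ (X 1) f g :=
  hd.integral_pair_eq hj (Φ := fun p => (inner ℝ p.1 f : ℝ) * inner ℝ p.1 g)
    (((measurable_inner_left f).comp measurable_fst).mul
      ((measurable_inner_left g).comp measurable_fst))

omit hd in
theorem covForm_self_nonneg (X₁ : Ω → L2 𝒯) (g : L2 𝒯) : 0 ≤ covForm μ X₁ g g :=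
  integral_nonneg fun _ => mul_self_nonneg _

/-- Sixth moments are controlled by the covariance form. -/
theorem exists_sixth_moment_le : ∃ c : ℝ, 0 < c ∧ ∀ j, 1 ≤ j → ∀ g : L2 𝒯,
    Integrable (fun w => (inner ℝ (X j w) g : ℝ) ^ 6) μ ∧
      ∫ w, (inner ℝ (X j w) g : ℝ) ^ 6 ∂μ ≤ (c * √(covForm μ (X 1) g g)) ^ 6 := by
  obtain ⟨c, hc, h⟩ := hd.sixth_moment
  refine ⟨c, hc, fun j hj g => ⟨(h j hj g).1, ?_⟩⟩
  have h2 := (h j hj g).2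
  have e : ∫ w, (inner ℝ (X j w) g : ℝ) ^ 2 ∂μ = covForm μ (X 1) g g := by
    rw [← hd.integral_inner_mul_inner hj]; simp only [sq]
  rw [e, ← Real.sqrt_eq_rpow] at h2
  have h0 : 0 ≤ ∫ w, (inner ℝ (X j w) g : ℝ) ^ 6 ∂μ :=
    integral_nonneg fun w => Even.pow_nonneg (by decide) _
  have h3 := pow_le_pow_left₀ (Real.rpow_nonneg h0 _) h2 6
  rwa [← Real.rpow_natCast, ← Real.rpow_mul h0, show (1 / 6 : ℝ) * (6 : ℕ) = 1 by norm_num,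
    Real.rpow_one] at h3

theorem exists_noise_sixth_moment_le : ∃ a : ℝ, 0 < a ∧ ∀ j, 1 ≤ j →
    Integrable (fun w => ε j w ^ 6) μ ∧ ∫ w, ε j w ^ 6 ∂μ ≤ a ^ 6 := by
  have h0 : 0 ≤ ∫ w, ε 1 w ^ 6 ∂μ := integral_nonneg fun w => Even.pow_nonneg (by decide) _
  refine ⟨1 + ∫ w, ε 1 w ^ 6 ∂μ, by linarith, fun j hj => ⟨?_, ?_⟩⟩
  · have := (hd.noise_sixth_moment j hj).integrable_norm_pow (by norm_num : (6 : ℕ) ≠ 0)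
    refine this.congr (Eventually.of_forall fun w => ?_)
    simp only [Real.norm_eq_abs]
    exact Even.pow_abs (by decide) _
  · rw [hd.integral_pair_eq hj (Φ := fun p => p.2 ^ 6) (measurable_snd.pow_const 6)]
    refine le_trans ?_ (le_self_pow₀ (by linarith) (by norm_num : (6 : ℕ) ≠ 0))
    linarith

theorem integral_noise_mul_inner [IsProbabilityMeasure μ] {j : ℕ} (hj : 1 ≤ j) (g : L2 𝒯) :
    ∫ w, ε j w * inner ℝ (X j w) g ∂μ = 0 := by
  have hm : MeasurableSpace.comap (X j) inferInstance ≤ mΩ := (hd.measurable_X j hj).comap_le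
  rw [integral_mul_condExp hm ((hd.noise_sixth_moment j hj).mono_exponent (by norm_num))
    (hd.memLp_inner hj g)
    ((measurable_inner_left g).comp (comap_measurable (X j))).stronglyMeasurable]
  refine integral_eq_zero_of_ae ?_
  filter_upwards [hd.noise_centered j hj] with w hw
  simp [hw]

end DataAssumption

/-- The eigenfunctions and eigenvalues of `K^{1/2} Σ K^{1/2}`. -/
structure SpectralSystem (μ : Measure Ω) (X₁ : Ω → L2 𝒯) (ψ : HilbertBasis ℕ ℝ (L2 𝒯)) (θ : ℕ → ℝ)
    (r : ℝ) (φ : ℕ → L2 𝒯) (𝔰 : ℕ → ℝ) : Prop where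
  theta_nonneg : ∀ l, 0 ≤ θ l
  theta_le : ∃ C, ∀ l, θ l ≤ C
  one_lt : 1 < r
  orthonormal : Orthonormal ℝ φ
  hasSum : ∀ f g : L2 𝒯, HasSum (fun l => 𝔰 l * inner ℝ f (φ l) * inner ℝ g (φ l))
      (covForm μ X₁ (sqrtKernelOp ψ θ f) (sqrtKernelOp ψ θ g))
  pos : ∀ l, 0 < 𝔰 l
  decay : ∃ b : ℝ, ∀ l : ℕ, 𝔰 l ≤ b * ((l : ℝ) + 1) ^ (-2 * r)

namespace SpectralSystem

variable {X₁ : Ω → L2 𝒯} {ψ : HilbertBasis ℕ ℝ (L2 𝒯)} {θ : ℕ → ℝ}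
    {r : ℝ} {φ : ℕ → L2 𝒯} {𝔰 : ℕ → ℝ} (hS : SpectralSystem μ X₁ ψ θ r φ 𝔰)

include hS

theorem covForm_right (h : L2 𝒯) (l : ℕ) :
    covForm μ X₁ (sqrtKernelOp ψ θ h) (sqrtKernelOp ψ θ (φ l)) = 𝔰 l * inner ℝ h (φ l) := by
  refine (hS.hasSum h (φ l)).unique ?_
  have := hasSum_single (f := fun m => 𝔰 m * inner ℝ h (φ m) * inner ℝ (φ l) (φ m)) l
    (fun m hm => by simp only [hS.orthonormal.2 (Ne.symm hm), mul_zero])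
  simpa [real_inner_self_eq_norm_sq, hS.orthonormal.1 l] using this

theorem covForm_self (l : ℕ) :
    covForm μ X₁ (sqrtKernelOp ψ θ (φ l)) (sqrtKernelOp ψ θ (φ l)) = 𝔰 l := by
  rw [hS.covForm_right, real_inner_self_eq_norm_sq, hS.orthonormal.1 l]; norm_num

theorem summable : Summable 𝔰 := by
  obtain ⟨b, hb⟩ := hS.decay
  have h1 : Summable fun n : ℕ => (n : ℝ) ^ (-2 * r) :=
    Real.summable_nat_rpow.2 (by linarith [hS.one_lt])
  have h2 := ((summable_nat_add_iff 1).2 h1).mul_left b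
  exact Summable.of_nonneg_of_le (fun l => (hS.pos l).le) (fun l => by simpa using hb l) h2

/-- The effective dimension at the regularisation level `D^{-2r}` is of the order `D`. -/
theorem exists_sum_div_le : ∃ C : ℝ, 0 < C ∧ ∀ D : ℝ, 1 ≤ D → ∀ m : ℕ,
    ∑ l ∈ Finset.range m, 𝔰 l / (𝔰 l + D ^ (-2 * r)) ≤ C * D := by
  obtain ⟨b, hb⟩ := hS.decay
  have hb0 : 0 < b := by
    have h1 := hb 0
    have h2 := hS.pos 0
    simp only [Nat.cast_zero, zero_add, Real.one_rpow, mul_one] at h1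
    linarith
  refine ⟨1 + 2 * b, by positivity, fun D hD m => ?_⟩
  have hD0 : 0 < D := by linarith
  have hr := hS.one_lt
  have hlam : 0 < D ^ (-2 * r) := Real.rpow_pos_of_pos hD0 _
  have t1 : ∀ l, 𝔰 l / (𝔰 l + D ^ (-2 * r)) ≤ 1 := fun l => by
    have := hS.pos l
    rw [div_le_one (by positivity)]; linarith
  have t2 : ∀ l : ℕ, D < (l : ℝ) + 1 →
      𝔰 l / (𝔰 l + D ^ (-2 * r)) ≤ b * D ^ 2 * (((l : ℝ) + 1) ^ 2)⁻¹ := fun l hl => by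
    have hl0 : (0 : ℝ) < (l : ℝ) + 1 := by positivity
    have h0 := hS.pos l
    calc 𝔰 l / (𝔰 l + D ^ (-2 * r)) ≤ 𝔰 l / D ^ (-2 * r) := by
          gcongr; linarith
      _ ≤ b * ((l : ℝ) + 1) ^ (-2 * r) / D ^ (-2 * r) := by gcongr; exact hb l
      _ = b * (D / ((l : ℝ) + 1)) ^ (2 * r) := by
          rw [Real.div_rpow hD0.le hl0.le, neg_mul, Real.rpow_neg hl0.le, Real.rpow_neg hD0.le]
          field_simp
      _ ≤ b * (D / ((l : ℝ) + 1)) ^ (2 : ℝ) := by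
          refine mul_le_mul_of_nonneg_left ?_ hb0.le
          exact Real.rpow_le_rpow_of_exponent_ge (by positivity) ((div_le_one hl0).2 hl.le)
            (by linarith)
      _ = b * D ^ 2 * (((l : ℝ) + 1) ^ 2)⁻¹ := by
          rw [Real.rpow_two, div_pow]; ring
  -- Below N each term is at most 1. Beyond D the decay gives terms `b (D/(l+1))^(2r)`, where the
  -- exponent may be lowered to 2; both parts sum to order D.
  set N := ⌊D⌋₊ with hN
  have hN1 : (N : ℝ) ≤ D := Nat.floor_le hD0.le
  have hN2 : D < N + 1 := Nat.lt_floor_add_one D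
  have hpt : ∀ l ∈ Finset.range m, 𝔰 l / (𝔰 l + D ^ (-2 * r))
      ≤ (if l < N then 1 else 0) + (if N ≤ l then b * D ^ 2 * (((l : ℝ) + 1) ^ 2)⁻¹ else 0) := by
    intro l _
    by_cases h : l < N
    · simpa [h, h.not_ge] using t1 l
    · have h' : N ≤ l := not_lt.1 h
      simp only [h, if_false, h', if_true, zero_add]
      refine t2 l ?_
      have : (N : ℝ) ≤ l := by exact_mod_cast h'
      linarith
  refine (Finset.sum_le_sum hpt).trans ?_
  rw [Finset.sum_add_distrib]
  have s1 : ∑ l ∈ Finset.range m, (if l < N then (1 : ℝ) else 0) ≤ D := by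
    rw [← Finset.sum_filter, Finset.sum_const, nsmul_eq_mul, mul_one]
    refine le_trans ?_ hN1
    have : (Finset.range m).filter (· < N) ⊆ Finset.range N := fun l hl =>
      Finset.mem_range.2 (Finset.mem_filter.1 hl).2
    exact_mod_cast (Finset.card_le_card this).trans (Finset.card_range N).le
  have s2 : ∑ l ∈ Finset.range m, (if N ≤ l then b * D ^ 2 * (((l : ℝ) + 1) ^ 2)⁻¹ else 0)
      ≤ b * D ^ 2 * (2 / (N + 1)) := by
    rw [← Finset.sum_filter, ← Finset.mul_sum]
    refine mul_le_mul_of_nonneg_left ?_ (by positivity)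
    refine le_trans ?_ (sum_Ioo_inv_sq_le N (m + 1))
    rw [← Finset.sum_image (g := fun l => l + 1) (f := fun i : ℕ => ((i : ℝ) ^ 2)⁻¹)
      (fun x _ y _ h => by simpa using h) |>.trans (Finset.sum_congr rfl fun l _ => by push_cast; rfl)]
    refine Finset.sum_le_sum_of_subset_of_nonneg (fun i hi => ?_) fun i _ _ => by positivity
    obtain ⟨l, hl, rfl⟩ := Finset.mem_image.1 hi
    have := Finset.mem_filter.1 hl
    have := Finset.mem_range.1 this.1
    exact Finset.mem_Ioo.2 ⟨by omega, by omega⟩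
  have s3 : b * D ^ 2 * (2 / (N + 1)) ≤ 2 * b * D := by
    rw [← mul_div_assoc, div_le_iff₀ (by positivity)]
    have := mul_le_mul_of_nonneg_left hN2.le (show 0 ≤ 2 * b * D by positivity)
    linarith
  linarith

omit hS in
/-- The functions `L_{K^{1/2}} X_j` belong almost surely to the closed span of the `φ_l`. -/
theorem ae_parseval {ε : ℕ → Ω → ℝ} (hd : DataAssumption μ X ε)
    (hS : SpectralSystem μ (X 1) ψ θ r φ 𝔰) {j : ℕ} (hj : 1 ≤ j) :
    ∀ᵐ w ∂μ, HasSum (fun l => (inner ℝ (sqrtKernelOp ψ θ (X j w)) (φ l) : ℝ) ^ 2)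
      (‖sqrtKernelOp ψ θ (X j w)‖ ^ 2) := by
  obtain ⟨C, hC⟩ := hS.theta_le
  have hcomm := fun a b => inner_sqrtKernelOp_comm (ψ := ψ) hS.theta_nonneg hC a b
  set Z : Ω → L2 𝒯 := fun w => sqrtKernelOp ψ θ (X j w) with hZ
  have hmeas : ∀ g : L2 𝒯, Measurable fun w => ENNReal.ofReal ((inner ℝ (Z w) g : ℝ) ^ 2) := by
    intro g
    simp only [hZ, hcomm]
    exact ((hd.measurable_inner hj _).pow_const 2).ennreal_ofReal
  have hint : ∀ g : L2 𝒯, ∫⁻ w, ENNReal.ofReal ((inner ℝ (Z w) g : ℝ) ^ 2) ∂μ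
      = ENNReal.ofReal (covForm μ (X 1) (sqrtKernelOp ψ θ g) (sqrtKernelOp ψ θ g)) := by
    intro g
    rw [← hd.integral_inner_mul_inner hj, ofReal_integral_eq_lintegral_ofReal
      (hd.integrable_inner_mul_inner hj _ _) (Eventually.of_forall fun _ => mul_self_nonneg _)]
    simp only [hZ, hcomm, sq]
  have hnorm : ∀ w, ENNReal.ofReal (‖Z w‖ ^ 2)
      = ∑' k, ENNReal.ofReal ((inner ℝ (Z w) (ψ k) : ℝ) ^ 2) := fun w => by
    rw [← (hasSum_sq_inner ψ (Z w)).tsum_eq, ENNReal.ofReal_tsum_of_nonneg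
      (fun _ => sq_nonneg _) (hasSum_sq_inner ψ (Z w)).summable]
  have hsumm : ∀ w, Summable fun l => (inner ℝ (Z w) (φ l) : ℝ) ^ 2 := fun w =>
    summable_of_sum_le (fun _ => sq_nonneg _) (fun s => sum_sq_inner_le hS.orthonormal (Z w) s)
  have hle : ∀ w, ∑' l, ENNReal.ofReal ((inner ℝ (Z w) (φ l) : ℝ) ^ 2) ≤ ENNReal.ofReal (‖Z w‖ ^ 2) := by
    intro w
    rw [← ENNReal.ofReal_tsum_of_nonneg (fun _ => sq_nonneg _) (hsumm w)]
    exact ENNReal.ofReal_le_ofReal ((hsumm w).tsum_le_of_sum_le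
      fun s => sum_sq_inner_le hS.orthonormal (Z w) s)
  have hf : ∫⁻ w, ∑' l, ENNReal.ofReal ((inner ℝ (Z w) (φ l) : ℝ) ^ 2) ∂μ
      = ∑' l, ENNReal.ofReal (𝔰 l) := by
    rw [lintegral_tsum fun l => (hmeas _).aemeasurable]
    exact tsum_congr fun l => by rw [hint, hS.covForm_self]
  -- The `φ l` need not be complete. Computing the mean of `‖Z‖²` in the complete basis ψ gives the
  -- finite value `∑ 𝔰 l`, which is also the mean of the Bessel sum along φ, so Bessel's inequality
  -- is almost surely an equality.
  have hgi : ∫⁻ w, ENNReal.ofReal (‖Z w‖ ^ 2) ∂μ = ∑' l, ENNReal.ofReal (𝔰 l) := by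
    simp only [hnorm]
    rw [lintegral_tsum fun l => (hmeas _).aemeasurable]
    have e1 : ∀ k, ∫⁻ w, ENNReal.ofReal ((inner ℝ (Z w) (ψ k) : ℝ) ^ 2) ∂μ
        = ∑' l, ENNReal.ofReal (𝔰 l * (inner ℝ (φ l) (ψ k) : ℝ) ^ 2) := by
      intro k
      have h := hS.hasSum (ψ k) (ψ k)
      rw [hint, ← h.tsum_eq, ENNReal.ofReal_tsum_of_nonneg (fun l => ?_) h.summable]
      · exact tsum_congr fun l => by rw [real_inner_comm (ψ k) (φ l)]; ring_nf
      · rw [mul_assoc]; exact mul_nonneg (hS.pos l).le (mul_self_nonneg _)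
    rw [tsum_congr e1, ENNReal.tsum_comm]
    refine tsum_congr fun l => ?_
    have h := (hasSum_sq_inner ψ (φ l)).mul_left (𝔰 l)
    rw [← ENNReal.ofReal_tsum_of_nonneg (fun k => mul_nonneg (hS.pos l).le (sq_nonneg _))
      h.summable, h.tsum_eq, hS.orthonormal.1 l]
    norm_num
  have hfin : ∑' l, ENNReal.ofReal (𝔰 l) ≠ ⊤ := by
    rw [← ENNReal.ofReal_tsum_of_nonneg (fun l => (hS.pos l).le) hS.summable]
    exact ENNReal.ofReal_ne_top
  have hae := ae_eq_of_ae_le_of_lintegral_le (Eventually.of_forall hle) (by rw [hf]; exact hfin)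
    (by simp only [hnorm]; exact (Measurable.tsum fun k => hmeas _).aemeasurable)
    (by rw [hf, hgi])
  filter_upwards [hae] with w hw
  rw [← ENNReal.ofReal_tsum_of_nonneg (fun _ => sq_nonneg _) (hsumm w),
    ENNReal.ofReal_eq_ofReal_iff (tsum_nonneg fun _ => sq_nonneg _) (sq_nonneg _)] at hw
  rw [← hw]
  exact (hsumm w).hasSum

omit hS in
-- One null set serves all j and all h: Parseval for each `L_{K^{1/2}} X_j` is a countable family of
-- almost sure statements, and the expansion against h follows from it without probability.
theorem ae_hasSum_inner {ε : ℕ → Ω → ℝ} (hd : DataAssumption μ X ε)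
    (hS : SpectralSystem μ (X 1) ψ θ r φ 𝔰) : ∀ᵐ w ∂μ, ∀ j, 1 ≤ j → ∀ h : L2 𝒯,
    HasSum (fun l => (inner ℝ (X j w) (sqrtKernelOp ψ θ (φ l)) : ℝ) * inner ℝ h (φ l))
      (inner ℝ (sqrtKernelOp ψ θ (X j w)) h) := by
  obtain ⟨C, hC⟩ := hS.theta_le
  have := ae_all_iff.2 fun j => ae_all_iff.2 fun hj : 1 ≤ j => ae_parseval (j := j) hd hS hj
  filter_upwards [this] with w hw j hj h
  have := hasSum_inner_mul_inner_of_parseval hS.orthonormal (hw j hj) h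
  simpa only [inner_sqrtKernelOp_comm (ψ := ψ) hS.theta_nonneg hC] using this

end SpectralSystem

end Moments


/-! ### Uniform bounds for stochastic errors and for the empirical covariance. -/

theorem sum_Ioc_eq_sum_range {M : Type*} [AddCommMonoid M] (f : ℕ → M) (a m : ℕ) :
    ∑ j ∈ Finset.Ioc a (a + m), f j = ∑ i ∈ Finset.range m, f (a + i + 1) := by
  induction m with
  | zero => simp
  | succ m ih =>
    rw [Finset.sum_range_succ, ← ih, ← add_assoc, Finset.sum_Ioc_succ_top (by omega)]

/-- A quadratic version of the weighted Cauchy–Schwarz inequality. -/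
theorem sq_le_of_weighted_matrix {s G f : ℕ → ℝ} {D : ℕ → ℕ → ℝ} {lam V g t F : ℝ}
    (hs : ∀ l, 0 ≤ s l) (hl : 0 < lam)
    (hD : ∀ m k, ∑ l ∈ Finset.range m, ∑ l' ∈ Finset.range k,
      D l l' ^ 2 / ((s l + lam) * (s l' + lam)) ≤ V)
    (hG : ∀ l, HasSum (fun l' => D l l' * f l') (G l)) (hg : HasSum (fun l => G l * f l) g)
    (ht : HasSum (fun l => s l * f l * f l) t)
    (hF : ∀ m, ∑ l ∈ Finset.range m, f l ^ 2 ≤ F) : g ^ 2 ≤ V * (t + lam * F) ^ 2 := by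
  have hw : ∀ l, 0 < s l + lam := fun l => by have := hs l; positivity
  have hV : 0 ≤ V := by simpa using hD 0 0
  -- Cauchy–Schwarz in the inner index turns the weighted Hilbert–Schmidt bound on the matrix D into
  -- a weighted bound on the vector G, and the vector inequality finishes.
  have key : ∀ m, ∑ l ∈ Finset.range m, G l ^ 2 / (s l + lam) ≤ V * (t + lam * F) := by
    intro m
    have hlim : Tendsto (fun k => ∑ l ∈ Finset.range m,
        (∑ l' ∈ Finset.range k, D l l' * f l') ^ 2 / (s l + lam)) atTop
        (𝓝 (∑ l ∈ Finset.range m, G l ^ 2 / (s l + lam))) :=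
      tendsto_finsetSum _ fun l _ => ((hG l).tendsto_sum_nat.pow 2).div_const _
    refine le_of_tendsto hlim (Eventually.of_forall fun k => ?_)
    have h2 : ∑ l' ∈ Finset.range k, (s l' + lam) * f l' ^ 2 ≤ t + lam * F := by
      have a1 : ∑ l' ∈ Finset.range k, s l' * f l' * f l' ≤ t :=
        sum_le_hasSum _ (fun l _ => by
          have := mul_nonneg (hs l) (mul_self_nonneg (f l)); linarith) ht
      have a2 := mul_le_mul_of_nonneg_left (hF k) hl.le
      rw [Finset.mul_sum] at a2
      refine le_trans (le_of_eq ?_) (add_le_add a1 a2)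
      rw [← Finset.sum_add_distrib]
      exact Finset.sum_congr rfl fun l _ => by ring
    calc ∑ l ∈ Finset.range m, (∑ l' ∈ Finset.range k, D l l' * f l') ^ 2 / (s l + lam)
        ≤ ∑ l ∈ Finset.range m, (∑ l' ∈ Finset.range k,
            D l l' ^ 2 / ((s l + lam) * (s l' + lam))) * (t + lam * F) := by
          refine Finset.sum_le_sum fun l _ => ?_
          have h1 : (∑ l' ∈ Finset.range k, D l l' * f l') ^ 2
              ≤ (∑ l' ∈ Finset.range k, D l l' ^ 2 / (s l' + lam))
                * ∑ l' ∈ Finset.range k, (s l' + lam) * f l' ^ 2 := by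
            refine Finset.sum_sq_le_sum_mul_sum_of_sq_le_mul _ (fun l' _ => ?_) (fun l' _ => ?_)
              fun l' _ => le_of_eq ?_
            · have := hw l'; positivity
            · have := hw l'; positivity
            · have := (hw l').ne'; field_simp
          have h3 : 0 ≤ ∑ l' ∈ Finset.range k, D l l' ^ 2 / (s l' + lam) :=
            Finset.sum_nonneg fun l' _ => by have := hw l'; positivity
          rw [div_le_iff₀ (hw l)]
          refine (h1.trans (mul_le_mul_of_nonneg_left h2 h3)).trans (le_of_eq ?_)
          rw [mul_right_comm]
          congr 1
          rw [Finset.sum_mul]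
          refine Finset.sum_congr rfl fun l' _ => ?_
          have := (hw l').ne'
          have := (hw l).ne'
          field_simp
      _ ≤ V * (t + lam * F) := by
          rw [← Finset.sum_mul]
          refine mul_le_mul_of_nonneg_right (hD m k) (le_trans ?_ h2)
          exact Finset.sum_nonneg fun l' _ => mul_nonneg (hw l').le (sq_nonneg (f l'))
  have := sq_le_of_weighted_coeff hs hl key hg ht hF
  linarith [this]

section Events

variable {d : ℕ} {𝒯 : Set (Euc d)} {Ω : Type*} [mΩ : MeasurableSpace Ω] {μ : Measure Ω}
  [IsProbabilityMeasure μ] {X : ℕ → Ω → L2 𝒯} {ε : ℕ → Ω → ℝ}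
  {ψ : HilbertBasis ℕ ℝ (L2 𝒯)} {θ : ℕ → ℝ} {r : ℝ} {φ : ℕ → L2 𝒯} {𝔰 : ℕ → ℝ}

omit [IsProbabilityMeasure μ] in
theorem measure_ge_le_of_lintegral_le {Y : Ω → ENNReal} (hY : AEMeasurable Y μ) {V p : ℝ}
    (hV : 0 < V) (h : ∫⁻ w, Y w ∂μ ≤ ENNReal.ofReal (V * p)) :
    μ {w | ENNReal.ofReal V ≤ Y w} ≤ ENNReal.ofReal p := by
  have h1 := meas_ge_le_lintegral_div hY (ε := ENNReal.ofReal V)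
    (by rwa [Ne, ENNReal.ofReal_eq_zero, not_le]) ENNReal.ofReal_ne_top
  refine h1.trans ((ENNReal.div_le_div_right h _).trans ?_)
  rw [← ENNReal.ofReal_div_of_pos hV, mul_div_cancel_left₀ _ hV.ne']

/-- With `D = M^(1/(2r+1))` the level `λ = D^(-2r)` satisfies `M λ = D`: the effective dimension and
the penalty are balanced. -/
theorem rpow_neg_two_mul_eq {r : ℝ} (hr : 1 < r) {x : ℝ} (hx : 0 < x) :
    (x ^ (1 / (2 * r + 1))) ^ (-2 * r) = x ^ (1 / (2 * r + 1)) / x := by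
  rw [← Real.rpow_mul hx.le, ← Real.rpow_sub_one hx.ne']
  congr 1
  have : 2 * r + 1 ≠ 0 := by linarith
  field_simp
  ring

/-- Uniform bound for the stochastic error on the subintervals of an interval. -/
theorem exists_uniform_bound (hd : DataAssumption μ X ε)
    (hS : SpectralSystem μ (X 1) ψ θ r φ 𝔰) : ∃ C : ℝ, 0 < C ∧
    ∀ (u : ℕ → Ω → ℝ) (a : ℝ) (t : ℕ → ℝ), 0 < a →
      (∀ j, 1 ≤ j → Measurable[MeasurableSpace.comap (fun w => (X j w, ε j w)) inferInstance] (u j)) →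
      (∀ j, 1 ≤ j → Integrable (fun w => u j w ^ 6) μ ∧ ∫ w, u j w ^ 6 ∂μ ≤ a ^ 6) →
      (∀ j, 1 ≤ j → ∀ l, ∫ w, u j w * inner ℝ (X j w) (sqrtKernelOp ψ θ (φ l)) ∂μ = t l) →
      ∀ (s₀ M : ℕ) (x : ℝ), 1 ≤ M → 0 < x →
      ∃ Bd : Set Ω, μ Bd ≤ ENNReal.ofReal (1 / x) ∧ ∀ w ∉ Bd, ∀ c f, s₀ ≤ c → c ≤ f → f ≤ s₀ + M →
        ∀ (h : L2 𝒯) (T : ℝ), HasSum (fun l => t l * inner ℝ h (φ l)) T →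
        (∑ j ∈ Finset.Ioc c f, u j w * inner ℝ (sqrtKernelOp ψ θ (X j w)) h
          - ((f - c : ℕ) : ℝ) * T) ^ 2
          ≤ C * a ^ 2 * x * (M : ℝ) ^ (1 / (2 * r + 1)) *
            (M * covForm μ (X 1) (sqrtKernelOp ψ θ h) (sqrtKernelOp ψ θ h)
              + (M : ℝ) ^ (1 / (2 * r + 1)) * ‖h‖ ^ 2) := by
  obtain ⟨C₀, hC₀, hmaj⟩ := hd.exists_majorant
  obtain ⟨c₆, hc₆, hX6⟩ := hd.exists_sixth_moment_le
  obtain ⟨C₁, hC₁, heff⟩ := hS.exists_sum_div_le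
  refine ⟨4 * ((C₀ + 1) * c₆ ^ 2 * C₁), by positivity, ?_⟩
  intro u a t ha hum hu6 hut s₀ M x hM hx
  have hM0 : (0 : ℝ) < M := by exact_mod_cast hM
  have hM1 : (1 : ℝ) ≤ M := by exact_mod_cast hM
  set D : ℝ := (M : ℝ) ^ (1 / (2 * r + 1)) with hD
  have hr := hS.one_lt
  have hD1 : 1 ≤ D := Real.one_le_rpow hM1 (by positivity)
  set lam : ℝ := D ^ (-2 * r) with hlam
  have hlam' : lam = D / M := rpow_neg_two_mul_eq hr hM0
  have hlam0 : 0 < lam := Real.rpow_pos_of_pos (by linarith) _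
  set g : ℕ → L2 𝒯 := fun l => sqrtKernelOp ψ θ (φ l) with hg
  have hw : ∀ l, 0 < 𝔰 l + lam := fun l => by have := hS.pos l; positivity
  have hU : ∀ l, ∃ U : Ω → ℝ, Integrable U μ ∧
      (∀ᵐ w ∂μ, ∀ m ≤ M, (∑ i ∈ Finset.range m,
        (u (s₀ + i + 1) w * inner ℝ (X (s₀ + i + 1) w) (g l) - t l)) ^ 2 ≤ U w) ∧
      ∫ w, U w ∂μ ≤ C₀ * (a * (c₆ * √(𝔰 l))) ^ 2 * M := by
    intro l
    have hle : ∀ j, 1 ≤ j → MeasurableSpace.comap (fun w => (X j w, ε j w)) inferInstance ≤ mΩ :=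
      fun j hj => (hd.measurable_pair hj).comap_le
    have h3 : ∀ j, 1 ≤ j → _ := fun j hj =>
      integrable_abs_mul_pow_three (μ := μ) (u := u j) (v := fun w => inner ℝ (X j w) (g l))
      ((hum j hj).mono (hle j hj) le_rfl).aestronglyMeasurable
      (hd.measurable_inner hj (g l)).aestronglyMeasurable (hu6 j hj).1 (hX6 j hj (g l)).1 ha.le
      (b := c₆ * √(𝔰 l)) (by positivity) (hu6 j hj).2
      (by have := (hX6 j hj (g l)).2; rwa [hg, hS.covForm_self] at this)
    obtain ⟨U, h1, h2, h4⟩ := hmaj (fun j w => u j w * inner ℝ (X j w) (g l)) (a * (c₆ * √(𝔰 l)))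
      (by positivity) (fun j hj => (hum j hj).mul (by
        exact (((measurable_inner_left (g l)).comp measurable_fst).comp
          (comap_measurable (fun w => (X j w, ε j w))))))
      (fun j hj => (h3 j hj).1) (fun j hj => (h3 j hj).2) s₀ M
    refine ⟨U, h1, ?_, h4⟩
    filter_upwards [h2] with w hw m hm
    have := hw m hm
    have e : ∀ i, ∫ w', u (s₀ + i + 1) w' * inner ℝ (X (s₀ + i + 1) w') (g l) ∂μ = t l :=
      fun i => hut _ (Nat.le_add_left 1 _) l
    simpa only [e] using this
  choose U hUi hUb hUm using hU
  have hUb' := ae_all_iff.2 hUb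
  have hU0 : ∀ l, 0 ≤ᵐ[μ] U l := fun l => by
    filter_upwards [hUb l] with w hw
    simpa using hw 0 (Nat.zero_le _)
  -- This one variable dominates all coefficients and all partial sums. Its mean is at most a
  -- multiple of `a² M D` by the effective dimension, so a single use of Markov's inequality gives
  -- uniformity in h.
  set Y : Ω → ENNReal := fun w => ∑' l, ENNReal.ofReal (U l w / (𝔰 l + lam)) with hY
  have hYm : AEMeasurable Y μ := AEMeasurable.tsum fun l =>
    ((hUi l).aestronglyMeasurable.aemeasurable.div_const _).ennreal_ofReal
  -- `C₀` is only nonnegative; `C₀ + 1` keeps V positive, as Markov's inequality needs.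
  set V : ℝ := (C₀ + 1) * c₆ ^ 2 * C₁ * a ^ 2 * x * M * D with hV
  have hV0 : 0 < V := by positivity
  have hYint : ∫⁻ w, Y w ∂μ ≤ ENNReal.ofReal (V * (1 / x)) := by
    rw [hY, lintegral_tsum fun l =>
      ((hUi l).aestronglyMeasurable.aemeasurable.div_const _).ennreal_ofReal]
    refine ENNReal.tsum_le_of_sum_range_le fun m => ?_
    have e1 : ∀ l, ∫⁻ w, ENNReal.ofReal (U l w / (𝔰 l + lam)) ∂μ
        ≤ ENNReal.ofReal ((C₀ + 1) * a ^ 2 * c₆ ^ 2 * M * (𝔰 l / (𝔰 l + lam))) := by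
      intro l
      rw [← ofReal_integral_eq_lintegral_ofReal ((hUi l).div_const _) (by
        filter_upwards [hU0 l] with w h
        exact div_nonneg h (hw l).le), integral_div]
      refine ENNReal.ofReal_le_ofReal ?_
      rw [← mul_div_assoc]
      refine div_le_div_of_nonneg_right ((hUm l).trans ?_) (hw l).le
      have h0 := (hS.pos l).le
      rw [mul_pow, mul_pow, Real.sq_sqrt h0]
      have : 0 ≤ a ^ 2 * c₆ ^ 2 * M * 𝔰 l := by positivity
      linarith
    refine (Finset.sum_le_sum fun l _ => e1 l).trans ?_
    rw [← ENNReal.ofReal_sum_of_nonneg fun l _ => by have := hw l; have := hS.pos l; positivity]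
    refine ENNReal.ofReal_le_ofReal ?_
    rw [← Finset.mul_sum]
    refine (mul_le_mul_of_nonneg_left (heff D hD1 m) (by positivity)).trans (le_of_eq ?_)
    rw [hV]; field_simp
  have hbad := measure_ge_le_of_lintegral_le hYm hV0 hYint
  have hae := hUb'.and (hS.ae_hasSum_inner hd)
  refine ⟨{w | ENNReal.ofReal V ≤ Y w} ∪ {w | ¬ ((∀ l, ∀ m ≤ M, (∑ i ∈ Finset.range m,
        (u (s₀ + i + 1) w * inner ℝ (X (s₀ + i + 1) w) (g l) - t l)) ^ 2 ≤ U l w) ∧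
        ∀ j, 1 ≤ j → ∀ h : L2 𝒯, HasSum (fun l => (inner ℝ (X j w) (sqrtKernelOp ψ θ (φ l)) : ℝ)
          * inner ℝ h (φ l)) (inner ℝ (sqrtKernelOp ψ θ (X j w)) h))}, ?_, ?_⟩
  · refine (measure_union_le _ _).trans ?_
    rw [ae_iff.1 hae, add_zero]
    exact hbad
  intro w hwB c f hsc hcf hfM h T hT
  simp only [Set.mem_union, Set.mem_ofPred_eq, not_or, not_le, not_not] at hwB
  obtain ⟨hYw, hUw, hsumw⟩ := hwB
  set S : ℕ → ℝ := fun l => ∑ j ∈ Finset.Ioc c f, (u j w * inner ℝ (X j w) (g l) - t l) with hSd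
  -- A sum over `(c, f]` is the difference of two partial sums started at `s₀`, hence the factor 4.
  have hSU : ∀ l, S l ^ 2 ≤ 4 * U l w := by
    intro l
    have h1 := hUw l (c - s₀) (by omega)
    have h2 := hUw l (f - s₀) (by omega)
    rw [← sum_Ioc_eq_sum_range (fun j => u j w * inner ℝ (X j w) (g l) - t l),
      show s₀ + (c - s₀) = c by omega] at h1
    rw [← sum_Ioc_eq_sum_range (fun j => u j w * inner ℝ (X j w) (g l) - t l),
      show s₀ + (f - s₀) = f by omega, ← Finset.sum_Ioc_consecutive _ hsc hcf] at h2
    nlinarith [sq_nonneg (2 * (∑ j ∈ Finset.Ioc s₀ c, (u j w * inner ℝ (X j w) (g l) - t l)) + S l)]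
  have hpart : ∀ m, ∑ l ∈ Finset.range m, S l ^ 2 / (𝔰 l + lam) ≤ 4 * V := by
    intro m
    have hUnn : ∀ l, 0 ≤ U l w := fun l => by simpa using hUw l 0 (Nat.zero_le _)
    have h1 : ∑ l ∈ Finset.range m, U l w / (𝔰 l + lam) ≤ V := by
      rw [← ENNReal.ofReal_le_ofReal_iff hV0.le,
        ENNReal.ofReal_sum_of_nonneg fun l _ => div_nonneg (hUnn l) (hw l).le]
      exact (ENNReal.sum_le_tsum _).trans hYw.le
    calc ∑ l ∈ Finset.range m, S l ^ 2 / (𝔰 l + lam)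
        ≤ ∑ l ∈ Finset.range m, 4 * (U l w / (𝔰 l + lam)) := by
          refine Finset.sum_le_sum fun l _ => ?_
          rw [← mul_div_assoc]
          exact div_le_div_of_nonneg_right (hSU l) (hw l).le
      _ ≤ 4 * V := by rw [← Finset.mul_sum]; linarith
  have hsum : HasSum (fun l => S l * inner ℝ h (φ l))
      (∑ j ∈ Finset.Ioc c f, u j w * inner ℝ (sqrtKernelOp ψ θ (X j w)) h
          - ((f - c : ℕ) : ℝ) * T) := by
    have h1 : HasSum (fun l => ∑ j ∈ Finset.Ioc c f,
        (u j w * (inner ℝ (X j w) (g l) * inner ℝ h (φ l)) - t l * inner ℝ h (φ l)))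
        (∑ j ∈ Finset.Ioc c f, (u j w * inner ℝ (sqrtKernelOp ψ θ (X j w)) h - T)) :=
      hasSum_sum fun j hj => ((hsumw j (by have := Finset.mem_Ioc.1 hj; omega) h).mul_left _).sub hT
    rw [Finset.sum_sub_distrib, Finset.sum_const, Nat.card_Ioc, nsmul_eq_mul] at h1
    refine h1.congr_fun ?_ |> id
    intro l
    simp only [hSd, Finset.sum_mul]
    exact Finset.sum_congr rfl fun j _ => by ring
  have := sq_le_of_weighted_coeff (fun l => (hS.pos l).le) hlam0 hpart hsum (hS.hasSum h h)
    (fun m => sum_sq_inner_le hS.orthonormal h _)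
  refine this.trans (le_of_eq ?_)
  rw [hV, hlam']
  field_simp

end Events


theorem measurable_sum_sub_const {Ω : Type*} {m : MeasurableSpace Ω} {s : Finset ℕ}
    {f : ℕ → Ω → ℝ} {c : ℝ} (h : ∀ j ∈ s, Measurable (f j)) :
    Measurable fun w => ∑ j ∈ s, (f j w - c) :=
  Finset.measurable_fun_sum _ fun j hj => (h j hj).sub_const c

theorem measurable_tsum_tsum_sq_div {Ω : Type*} {m : MeasurableSpace Ω} {D : ℕ → ℕ → Ω → ℝ}
    {W : ℕ → ℕ → ℝ} (h : ∀ l l', Measurable (D l l')) :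
    Measurable fun w => ∑' l, ∑' l', ENNReal.ofReal (D l l' w ^ 2 / W l l') :=
  Measurable.tsum fun l => Measurable.tsum fun l' =>
    (((h l l').pow_const 2).div_const _).ennreal_ofReal

theorem exists_null_of_ae {Ω : Type*} {m : MeasurableSpace Ω} {μ : Measure Ω} {p : Ω → Prop}
    (h : ∀ᵐ w ∂μ, p w) : ∃ N : Set Ω, μ N = 0 ∧ ∀ w ∉ N, p w :=
  ⟨{w | ¬ p w}, ae_iff.1 h, fun _ hw => not_not.1 hw⟩

section Events

variable {d : ℕ} {𝒯 : Set (Euc d)} {Ω : Type*} [mΩ : MeasurableSpace Ω] {μ : Measure Ω}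
  [IsProbabilityMeasure μ] {X : ℕ → Ω → L2 𝒯} {ε : ℕ → Ω → ℝ}
  {ψ : HilbertBasis ℕ ℝ (L2 𝒯)} {θ : ℕ → ℝ} {r : ℝ} {φ : ℕ → L2 𝒯} {𝔰 : ℕ → ℝ}

/-- The sum of the squared errors over a block is of the order of the length of the block. -/
theorem exists_noise_sq_bound (hd : DataAssumption μ X ε) : ∃ C : ℝ, 0 < C ∧ ∀ s₀ M : ℕ, 1 ≤ M →
    ∃ Bd : Set Ω, μ Bd ≤ ENNReal.ofReal (C / M) ∧ ∀ w ∉ Bd,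
      ∑ j ∈ Finset.Ioc s₀ (s₀ + M), ε j w ^ 2 ≤ C * M := by
  obtain ⟨C₀, hC₀, hmaj⟩ := hd.exists_majorant
  obtain ⟨a, ha, hε⟩ := hd.exists_noise_sixth_moment_le
  set v : ℝ := ∫ w, ε 1 w ^ 2 ∂μ with hv
  have hv0 : 0 ≤ v := integral_nonneg fun _ => sq_nonneg _
  have hvj : ∀ j, 1 ≤ j → ∫ w, ε j w ^ 2 ∂μ = v := fun j hj =>
    hd.integral_pair_eq hj (Φ := fun p => p.2 ^ 2) (measurable_snd.pow_const 2)
  have habs : ∀ j w, |ε j w ^ 2| ^ 3 = ε j w ^ 6 := fun j w => by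
    rw [abs_of_nonneg (sq_nonneg _), ← pow_mul]
  refine ⟨C₀ * a ^ 4 + (v + 1), by positivity, fun s₀ M hM => ?_⟩
  have hM0 : (0 : ℝ) < M := by exact_mod_cast hM
  obtain ⟨U, hUi, hUb, hUm⟩ := hmaj (fun j w => ε j w ^ 2) (a ^ 2) (by positivity)
    (fun j hj => (measurable_snd.comp (comap_measurable (fun w => (X j w, ε j w)))).pow_const 2)
    (fun j hj => by simpa only [habs] using (hε j hj).1)
    (fun j hj => by simp only [habs]; rw [← pow_mul]; exact (hε j hj).2) s₀ M
  have hU0 : 0 ≤ᵐ[μ] U := by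
    filter_upwards [hUb] with w hw
    simpa using hw 0 (Nat.zero_le _)
  have hbad := measure_ge_le_of_lintegral_le (μ := μ) (V := (M : ℝ) ^ 2) (p := C₀ * a ^ 4 / M)
    (hUi.aestronglyMeasurable.aemeasurable.ennreal_ofReal) (by positivity) (by
      rw [← ofReal_integral_eq_lintegral_ofReal hUi hU0]
      refine ENNReal.ofReal_le_ofReal (hUm.trans (le_of_eq ?_))
      field_simp)
  refine ⟨{w | ENNReal.ofReal ((M : ℝ) ^ 2) ≤ ENNReal.ofReal (U w)} ∪
    {w | ¬ ∀ m ≤ M, (∑ i ∈ Finset.range m,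
      (ε (s₀ + i + 1) w ^ 2 - ∫ w', ε (s₀ + i + 1) w' ^ 2 ∂μ)) ^ 2 ≤ U w}, ?_, ?_⟩
  · refine (measure_union_le _ _).trans ?_
    rw [ae_iff.1 hUb, add_zero]
    refine hbad.trans (ENNReal.ofReal_le_ofReal ?_)
    gcongr
    linarith
  · intro w hw
    simp only [Set.mem_union, Set.mem_ofPred_eq, not_or, not_le, not_not] at hw
    have h1 := hw.2 M le_rfl
    have h2 : U w < (M : ℝ) ^ 2 := (ENNReal.ofReal_lt_ofReal_iff (by positivity)).1 hw.1
    have e : ∀ i, ∫ w', ε (s₀ + i + 1) w' ^ 2 ∂μ = v := fun i => hvj _ (Nat.le_add_left 1 _)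
    simp only [e] at h1
    rw [← sum_Ioc_eq_sum_range (fun j => ε j w ^ 2 - v), Finset.sum_sub_distrib, Finset.sum_const,
      Nat.card_Ioc, nsmul_eq_mul, Nat.add_sub_cancel_left] at h1
    have h3 := abs_le.1 (abs_le_of_sq_le_sq (h1.trans h2.le) hM0.le)
    have h4 : 0 ≤ C₀ * a ^ 4 * M := by positivity
    have := h3.2
    linarith

/-- The empirical covariance on a block dominates half of the covariance, outside an event which
depends on the block only. -/
theorem exists_block_event (hd : DataAssumption μ X ε)
    (hS : SpectralSystem μ (X 1) ψ θ r φ 𝔰) : ∃ C : ℝ, 0 < C ∧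
    ∀ (s₀ p : ℕ) (D : ℝ), 1 ≤ p → 1 ≤ D →
      ∃ Bd : Set Ω, MeasurableSet[sigmaGen X ε (Set.Ioc s₀ (s₀ + p))] Bd ∧
        μ.real Bd ≤ C * D ^ 2 / p ∧
        ∀ᵐ w ∂μ, w ∉ Bd → ∀ h : L2 𝒯,
          p * covForm μ (X 1) (sqrtKernelOp ψ θ h) (sqrtKernelOp ψ θ h)
            ≤ 2 * ∑ j ∈ Finset.Ioc s₀ (s₀ + p), inner ℝ (sqrtKernelOp ψ θ (X j w)) h ^ 2
              + p * D ^ (-2 * r) * ‖h‖ ^ 2 := by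
  obtain ⟨C₀, hC₀, hmaj⟩ := hd.exists_majorant
  obtain ⟨c₆, hc₆, hX6⟩ := hd.exists_sixth_moment_le
  obtain ⟨C₁, hC₁, heff⟩ := hS.exists_sum_div_le
  refine ⟨4 * ((C₀ + 1) * c₆ ^ 4 * C₁ ^ 2), by positivity, ?_⟩
  intro s₀ p D hp hD1
  have hp0 : (0 : ℝ) < p := by exact_mod_cast hp
  set lam : ℝ := D ^ (-2 * r) with hlam
  have hlam0 : 0 < lam := Real.rpow_pos_of_pos (by linarith) _
  set g : ℕ → L2 𝒯 := fun l => sqrtKernelOp ψ θ (φ l) with hg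
  have hw : ∀ l, 0 < 𝔰 l + lam := fun l => by have := hS.pos l; positivity
  set t : ℕ → ℕ → ℝ := fun l l' => 𝔰 l' * inner ℝ (φ l) (φ l') with ht
  have hmean : ∀ j, 1 ≤ j → ∀ l l',
      ∫ w, (inner ℝ (X j w) (g l) : ℝ) * inner ℝ (X j w) (g l') ∂μ = t l l' := fun j hj l l' => by
    rw [hd.integral_inner_mul_inner hj, hg, hS.covForm_right]
  set Dm : ℕ → ℕ → Ω → ℝ := fun l l' w => ∑ j ∈ Finset.Ioc s₀ (s₀ + p),
    ((inner ℝ (X j w) (g l) : ℝ) * inner ℝ (X j w) (g l') - t l l') with hDm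
  have hle : ∀ j, 1 ≤ j → MeasurableSpace.comap (fun w => (X j w, ε j w)) inferInstance ≤ mΩ :=
    fun j hj => (hd.measurable_pair hj).comap_le
  have hzm : ∀ j l, Measurable[MeasurableSpace.comap (fun w => (X j w, ε j w)) inferInstance]
      fun w => (inner ℝ (X j w) (g l) : ℝ) := fun j l =>
    ((measurable_inner_left (g l)).comp measurable_fst).comp
      (comap_measurable (fun w => (X j w, ε j w)))
  -- second moments of the coefficients
  have hD2 : ∀ l l', ∫⁻ w, ENNReal.ofReal (Dm l l' w ^ 2) ∂μ
      ≤ ENNReal.ofReal ((C₀ + 1) * c₆ ^ 4 * p * (𝔰 l * 𝔰 l')) := by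
    intro l l'
    have h3 : ∀ j, 1 ≤ j → _ := fun j hj =>
      integrable_abs_mul_pow_three (μ := μ) (u := fun w => inner ℝ (X j w) (g l))
      (v := fun w => inner ℝ (X j w) (g l'))
      (hd.measurable_inner hj (g l)).aestronglyMeasurable
      (hd.measurable_inner hj (g l')).aestronglyMeasurable (hX6 j hj (g l)).1 (hX6 j hj (g l')).1
      (a := c₆ * √(𝔰 l)) (b := c₆ * √(𝔰 l')) (by positivity) (by positivity)
      (by have := (hX6 j hj (g l)).2; rwa [hg, hS.covForm_self] at this)
      (by have := (hX6 j hj (g l')).2; rwa [hg, hS.covForm_self] at this)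
    obtain ⟨U, h1, h2, h4⟩ := hmaj (fun j w => inner ℝ (X j w) (g l) * inner ℝ (X j w) (g l'))
      (c₆ * √(𝔰 l) * (c₆ * √(𝔰 l'))) (by positivity) (fun j hj => (hzm j l).mul (hzm j l'))
      (fun j hj => (h3 j hj).1) (fun j hj => (h3 j hj).2) s₀ p
    have hU0 : 0 ≤ᵐ[μ] U := by
      filter_upwards [h2] with w hw
      simpa using hw 0 (Nat.zero_le _)
    have hDU : ∀ᵐ w ∂μ, ENNReal.ofReal (Dm l l' w ^ 2) ≤ ENNReal.ofReal (U w) := by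
      filter_upwards [h2] with w hw
      have := hw p le_rfl
      have e : ∀ i, ∫ w', (inner ℝ (X (s₀ + i + 1) w') (g l) : ℝ) *
          inner ℝ (X (s₀ + i + 1) w') (g l') ∂μ = t l l' :=
        fun i => hmean _ (Nat.le_add_left 1 _) l l'
      simp only [e] at this
      rw [← sum_Ioc_eq_sum_range (fun j =>
        (inner ℝ (X j w) (g l) : ℝ) * inner ℝ (X j w) (g l') - t l l')] at this
      exact ENNReal.ofReal_le_ofReal this
    refine (lintegral_mono_ae hDU).trans ?_
    rw [← ofReal_integral_eq_lintegral_ofReal h1 hU0]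
    refine ENNReal.ofReal_le_ofReal (h4.trans ?_)
    have s1 := Real.sq_sqrt (hS.pos l).le
    have s2 := Real.sq_sqrt (hS.pos l').le
    have e : (c₆ * √(𝔰 l) * (c₆ * √(𝔰 l'))) ^ 2 = c₆ ^ 4 * (𝔰 l * 𝔰 l') := by
      rw [mul_pow, mul_pow, mul_pow, s1, s2]; ring
    rw [e]
    have : 0 ≤ c₆ ^ 4 * (𝔰 l * 𝔰 l') * p := by
      have := hS.pos l; have := hS.pos l'; positivity
    linarith
  -- The deviations themselves appear here and not their majorants, because the bad event must be
  -- measurable for the block in order that mixing between blocks can be applied to it.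
  set Y : Ω → ENNReal := fun w => ∑' l, ∑' l', ENNReal.ofReal
    (Dm l l' w ^ 2 / ((𝔰 l + lam) * (𝔰 l' + lam))) with hY
  have hDmeas : ∀ l l', Measurable[sigmaGen X ε (Set.Ioc s₀ (s₀ + p))] (Dm l l') := by
    intro l l'
    refine measurable_sum_sub_const fun j hj => ?_
    have hj' : j ∈ Set.Ioc s₀ (s₀ + p) := by simpa using hj
    exact ((hzm j l).mono (comap_le_sigmaGen X ε hj') le_rfl).mul
      ((hzm j l').mono (comap_le_sigmaGen X ε hj') le_rfl)
  have hYmeas : Measurable[sigmaGen X ε (Set.Ioc s₀ (s₀ + p))] Y :=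
    measurable_tsum_tsum_sq_div hDmeas
  have hsg : sigmaGen X ε (Set.Ioc s₀ (s₀ + p)) ≤ mΩ := hd.sigmaGen_le fun j hj => by
    have := hj.1; omega
  -- Chosen so that the quadratic form deviates by at most `p/2 * (T + λ ‖h‖²)`, which leaves half
  -- of the covariance.
  set V : ℝ := (p : ℝ) ^ 2 / 4 with hV
  have hV0 : 0 < V := by positivity
  have hYint : ∫⁻ w, Y w ∂μ
      ≤ ENNReal.ofReal (V * (4 * ((C₀ + 1) * c₆ ^ 4 * C₁ ^ 2) * D ^ 2 / p)) := by
    have hm : ∀ l l', Measurable fun w =>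
        ENNReal.ofReal (Dm l l' w ^ 2 / ((𝔰 l + lam) * (𝔰 l' + lam))) := fun l l' =>
      ((((hDmeas l l').mono hsg le_rfl).pow_const 2).div_const _).ennreal_ofReal
    have e1 : ∀ l l', ∫⁻ w, ENNReal.ofReal (Dm l l' w ^ 2 / ((𝔰 l + lam) * (𝔰 l' + lam))) ∂μ
        ≤ ENNReal.ofReal ((C₀ + 1) * c₆ ^ 4 * p *
          (𝔰 l / (𝔰 l + lam)) * (𝔰 l' / (𝔰 l' + lam))) := by
      intro l l'
      have hww : 0 < (𝔰 l + lam) * (𝔰 l' + lam) := mul_pos (hw l) (hw l')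
      have e2 : ∀ w, ENNReal.ofReal (Dm l l' w ^ 2 / ((𝔰 l + lam) * (𝔰 l' + lam)))
          = ENNReal.ofReal (Dm l l' w ^ 2) * ENNReal.ofReal (((𝔰 l + lam) * (𝔰 l' + lam))⁻¹) :=
        fun w => by rw [← ENNReal.ofReal_mul (sq_nonneg _), div_eq_mul_inv]
      simp only [e2]
      rw [lintegral_mul_const _ (((hDmeas l l').mono hsg le_rfl).pow_const 2).ennreal_ofReal]
      refine (mul_le_mul_left (hD2 l l') _).trans ?_
      rw [← ENNReal.ofReal_mul (by have := hS.pos l; have := hS.pos l'; positivity)]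
      refine ENNReal.ofReal_le_ofReal (le_of_eq ?_)
      have := (hw l).ne'
      have := (hw l').ne'
      field_simp
    rw [hY, lintegral_tsum fun l => (Measurable.tsum fun l' => hm l l').aemeasurable]
    refine ENNReal.tsum_le_of_sum_range_le fun m => ?_
    have e3 : ∀ l, ∫⁻ w, ∑' l', ENNReal.ofReal (Dm l l' w ^ 2 / ((𝔰 l + lam) * (𝔰 l' + lam))) ∂μ
        ≤ ENNReal.ofReal ((C₀ + 1) * c₆ ^ 4 * p * (C₁ * D) * (𝔰 l / (𝔰 l + lam))) := by
      intro l
      rw [lintegral_tsum fun l' => (hm l l').aemeasurable]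
      refine ENNReal.tsum_le_of_sum_range_le fun m' => ?_
      refine (Finset.sum_le_sum fun l' _ => e1 l l').trans ?_
      have hl0 := hS.pos l
      have hl1 := hw l
      rw [← ENNReal.ofReal_sum_of_nonneg fun l' _ => by
        have := hw l'; have := hS.pos l'; positivity]
      refine ENNReal.ofReal_le_ofReal ?_
      rw [← Finset.mul_sum]
      refine (mul_le_mul_of_nonneg_left (heff D hD1 m') (by positivity)).trans (le_of_eq ?_)
      ring
    refine (Finset.sum_le_sum fun l _ => e3 l).trans ?_
    rw [← ENNReal.ofReal_sum_of_nonneg fun l _ => by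
      have := hw l; have := hS.pos l; positivity]
    refine ENNReal.ofReal_le_ofReal ?_
    rw [← Finset.mul_sum]
    refine (mul_le_mul_of_nonneg_left (heff D hD1 m) (by positivity)).trans (le_of_eq ?_)
    rw [hV]; field_simp
  refine ⟨{w | ENNReal.ofReal V ≤ Y w}, hYmeas measurableSet_Ici, ?_, ?_⟩
  · have := measure_ge_le_of_lintegral_le (hYmeas.mono hsg le_rfl).aemeasurable hV0 hYint
    rw [measureReal_def]
    exact ENNReal.toReal_le_of_le_ofReal (by positivity) this
  · filter_upwards [hS.ae_hasSum_inner hd] with w hsumw hYw h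
    simp only [not_le] at hYw
    have hDV : ∀ m k, ∑ l ∈ Finset.range m, ∑ l' ∈ Finset.range k,
        Dm l l' w ^ 2 / ((𝔰 l + lam) * (𝔰 l' + lam)) ≤ V := by
      intro m k
      have hnn : ∀ l l', 0 ≤ Dm l l' w ^ 2 / ((𝔰 l + lam) * (𝔰 l' + lam)) := fun l l' =>
        div_nonneg (sq_nonneg _) (mul_pos (hw l) (hw l')).le
      rw [← ENNReal.ofReal_le_ofReal_iff hV0.le,
        ENNReal.ofReal_sum_of_nonneg fun l _ => Finset.sum_nonneg fun l' _ => hnn l l']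
      refine le_trans (Finset.sum_le_sum fun l _ => ?_) ((ENNReal.sum_le_tsum _).trans hYw.le)
      rw [ENNReal.ofReal_sum_of_nonneg fun l' _ => hnn l l']
      exact ENNReal.sum_le_tsum _
    have hj : ∀ j ∈ Finset.Ioc s₀ (s₀ + p), 1 ≤ j := fun j hj => by
      have := Finset.mem_Ioc.1 hj; omega
    set T := covForm μ (X 1) (sqrtKernelOp ψ θ h) (sqrtKernelOp ψ θ h) with hT
    have hTs := hS.hasSum h h
    -- the inner series
    have hG : ∀ l, HasSum (fun l' => Dm l l' w * inner ℝ h (φ l'))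
        (∑ j ∈ Finset.Ioc s₀ (s₀ + p), ((inner ℝ (X j w) (g l) : ℝ) *
          inner ℝ (sqrtKernelOp ψ θ (X j w)) h - 𝔰 l * inner ℝ h (φ l))) := by
      intro l
      have ht1 : HasSum (fun l' => t l l' * inner ℝ h (φ l')) (𝔰 l * inner ℝ h (φ l)) := by
        have := hasSum_single (f := fun l' => t l l' * inner ℝ h (φ l')) l (fun m hm => by
          simp only [ht, hS.orthonormal.2 (Ne.symm hm), mul_zero, zero_mul])
        simpa [ht, real_inner_self_eq_norm_sq, hS.orthonormal.1 l] using this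
      have h1 : HasSum (fun l' => ∑ j ∈ Finset.Ioc s₀ (s₀ + p),
          ((inner ℝ (X j w) (g l) : ℝ) * (inner ℝ (X j w) (g l') * inner ℝ h (φ l'))
            - t l l' * inner ℝ h (φ l'))) _ :=
        hasSum_sum fun j hjm => ((hsumw j (hj j hjm) h).mul_left _).sub ht1
      refine h1.congr_fun ?_ |> id
      intro l'
      simp only [hDm, Finset.sum_mul]
      exact Finset.sum_congr rfl fun j _ => by ring
    have hg' : HasSum (fun l => (∑ j ∈ Finset.Ioc s₀ (s₀ + p), ((inner ℝ (X j w) (g l) : ℝ) *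
          inner ℝ (sqrtKernelOp ψ θ (X j w)) h - 𝔰 l * inner ℝ h (φ l))) * inner ℝ h (φ l))
        (∑ j ∈ Finset.Ioc s₀ (s₀ + p), (inner ℝ (sqrtKernelOp ψ θ (X j w)) h *
          inner ℝ (sqrtKernelOp ψ θ (X j w)) h - T)) := by
      have h1 : HasSum (fun l => ∑ j ∈ Finset.Ioc s₀ (s₀ + p),
          (inner ℝ (sqrtKernelOp ψ θ (X j w)) h *
            ((inner ℝ (X j w) (g l) : ℝ) * inner ℝ h (φ l))
            - 𝔰 l * inner ℝ h (φ l) * inner ℝ h (φ l))) _ :=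
        hasSum_sum fun j hjm => ((hsumw j (hj j hjm) h).mul_left _).sub hTs
      refine h1.congr_fun ?_ |> id
      intro l
      simp only [Finset.sum_mul]
      exact Finset.sum_congr rfl fun j _ => by ring
    have hmain := sq_le_of_weighted_matrix (fun l => (hS.pos l).le) hlam0 hDV hG hg' hTs
      (fun m => sum_sq_inner_le hS.orthonormal h _)
    have hT0 : 0 ≤ T := DataAssumption.covForm_self_nonneg (μ := μ) _ _
    have e4 : V * (T + lam * ‖h‖ ^ 2) ^ 2 = (p / 2 * (T + lam * ‖h‖ ^ 2)) ^ 2 := by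
      rw [hV]; ring
    rw [e4] at hmain
    have h5 := (abs_le.1 (abs_le_of_sq_le_sq hmain (by positivity))).1
    rw [Finset.sum_sub_distrib, Finset.sum_const, Nat.card_Ioc, nsmul_eq_mul,
      Nat.add_sub_cancel_left] at h5
    simp only [← sq] at h5
    linarith

/-- The empirical covariance on an interval dominates a multiple of the covariance. -/
theorem exists_lower_bound (hd : DataAssumption μ X ε)
    (hS : SpectralSystem μ (X 1) ψ θ r φ 𝔰) : ∃ C : ℝ, 0 < C ∧ ∀ s₀ m : ℕ, 1 ≤ m →
    ∃ Bd : Set Ω, μ Bd ≤ ENNReal.ofReal (C / m) ∧ ∀ w ∉ Bd, ∀ h : L2 𝒯,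
      m * covForm μ (X 1) (sqrtKernelOp ψ θ h) (sqrtKernelOp ψ θ h)
        ≤ C * (∑ j ∈ Finset.Ioc s₀ (s₀ + m), inner ℝ (sqrtKernelOp ψ θ (X j w)) h ^ 2
          + (m : ℝ) ^ (1 / (2 * r + 1)) * ‖h‖ ^ 2) := by
  obtain ⟨C, hC, hblock⟩ := exists_block_event hd hS
  obtain ⟨Cα, hCα, hα⟩ := hd.exists_mul_alphaMixing_le
  have hr := hS.one_lt
  refine ⟨(10 * C) ^ 3 + 20 * Cα + 20, by positivity, fun s₀ m hm => ?_⟩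
  have hm0 : (0 : ℝ) < m := by exact_mod_cast hm
  have hm1 : (1 : ℝ) ≤ m := by exact_mod_cast hm
  rcases lt_or_ge m 5 with hm5 | hm5
  · refine ⟨Set.univ, ?_, fun w hw => absurd (Set.mem_univ w) hw⟩
    rw [measure_univ, ENNReal.one_le_ofReal, one_le_div hm0]
    have : (m : ℝ) ≤ 5 := by exact_mod_cast hm5.le
    have : 0 ≤ (10 * C) ^ 3 + 20 * Cα := by positivity
    linarith
  -- One block fails with probability of order `D²/m`, which is too large. Three blocks separated by
  -- gaps of length p fail together with probability of order `(D²/m)³ + α(p)`, which is O(1/m)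
  -- because `D⁶ ≤ m²`, and one good block is enough for a lower bound.
  set p := m / 5 with hp
  have hp1 : 1 ≤ p := by omega
  have hp0 : (0 : ℝ) < p := by exact_mod_cast hp1
  have hpm : (m : ℝ) ≤ 10 * p := by exact_mod_cast (by omega : m ≤ 10 * p)
  have hpm' : (p : ℝ) ≤ m := by exact_mod_cast (by omega : p ≤ m)
  set D : ℝ := (m : ℝ) ^ (1 / (2 * r + 1)) with hD
  have hD1 : 1 ≤ D := Real.one_le_rpow hm1 (by positivity)
  have hlam : D ^ (-2 * r) = D / m := rpow_neg_two_mul_eq hr hm0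
  have hD3 : D ^ 6 ≤ m ^ 2 := by
    rw [hD, ← Real.rpow_natCast, ← Real.rpow_mul hm0.le, ← Real.rpow_natCast]
    refine Real.rpow_le_rpow_of_exponent_le hm1 ?_
    rw [one_div, inv_mul_le_iff₀ (by linarith)]
    push_cast
    linarith
  obtain ⟨B₁, hB₁m, hB₁, hB₁w⟩ := hblock s₀ p D hp1 hD1
  obtain ⟨B₂, hB₂m, hB₂, hB₂w⟩ := hblock (s₀ + 2 * p) p D hp1 hD1
  obtain ⟨B₃, hB₃m, hB₃, hB₃w⟩ := hblock (s₀ + 4 * p) p D hp1 hD1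
  have hαp : alphaMixing μ X ε p ≤ Cα / p := by
    rw [le_div_iff₀ hp0, mul_comm]; exact hα p
  have hle : ∀ {S S' : Set ℕ} {B : Set Ω}, S ⊆ S' → MeasurableSet[sigmaGen X ε S] B →
      MeasurableSet[sigmaGen X ε S'] B := fun h hB => sigmaGen_mono X ε h _ hB
  have hprob : μ.real ((B₁ ∩ B₂) ∩ B₃) ≤ ((10 * C) ^ 3 + 20 * Cα) / m := by
    have m1 := abs_le_alphaMixing (μ := μ) (X := X) (ε := ε) (t := s₀ + p) (k := p) (A := B₁)
      (B := B₂) (by omega) (hle (fun j hj => ⟨by have := hj.1; omega, hj.2⟩) hB₁m)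
      (hle (fun j hj => by have := hj.1; simp only [Set.mem_Ici]; omega) hB₂m)
    have m2 := abs_le_alphaMixing (μ := μ) (X := X) (ε := ε) (t := s₀ + 3 * p) (k := p)
      (A := B₁ ∩ B₂) (B := B₃) (by omega)
      ((hle (S' := Set.Icc 1 (s₀ + 3 * p))
        (fun j hj => ⟨by have := hj.1; omega, by have := hj.2; omega⟩) hB₁m).inter
        (hle (S' := Set.Icc 1 (s₀ + 3 * p)) (fun j hj => ⟨by have := hj.1; omega, by have := hj.2; omega⟩) hB₂m))
      (hle (fun j hj => by have := hj.1; simp only [Set.mem_Ici]; omega) hB₃m)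
    have m1 := (abs_le.1 m1).2
    have m2 := (abs_le.1 m2).2
    set π : ℝ := C * D ^ 2 / p with hπ
    have hπ0 : 0 ≤ π := by positivity
    have n1 : 0 ≤ μ.real B₁ := measureReal_nonneg
    have n2 : 0 ≤ μ.real B₂ := measureReal_nonneg
    have n3 : 0 ≤ μ.real B₃ := measureReal_nonneg
    have n4 : μ.real B₃ ≤ 1 := measureReal_le_one
    have n5 := alphaMixing_nonneg (μ := μ) (X := X) (ε := ε) p
    have p1 : μ.real B₁ * μ.real B₂ ≤ π * π := mul_le_mul hB₁ hB₂ n2 hπ0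
    have p2 : μ.real B₁ * μ.real B₂ * μ.real B₃ ≤ π * π * π := mul_le_mul p1 hB₃ n3 (by positivity)
    have p3 : μ.real (B₁ ∩ B₂) * μ.real B₃
        ≤ (μ.real B₁ * μ.real B₂ + alphaMixing μ X ε p) * μ.real B₃ :=
      mul_le_mul_of_nonneg_right (by linarith) n3
    have p4 : alphaMixing μ X ε p * μ.real B₃ ≤ alphaMixing μ X ε p := mul_le_of_le_one_right n5 n4
    have p5 : π * π * π ≤ (10 * C) ^ 3 / m := by
      have a1 : π ≤ 10 * C * D ^ 2 / m := by
        rw [hπ, div_le_div_iff₀ hp0 hm0]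
        have := mul_le_mul_of_nonneg_left hpm (show 0 ≤ C * D ^ 2 by positivity)
        linarith
      calc π * π * π = π ^ 3 := by ring
        _ ≤ (10 * C * D ^ 2 / m) ^ 3 := pow_le_pow_left₀ hπ0 a1 3
        _ = (10 * C) ^ 3 * D ^ 6 / m ^ 3 := by ring
        _ ≤ (10 * C) ^ 3 * m ^ 2 / m ^ 3 := by gcongr
        _ = (10 * C) ^ 3 / m := by field_simp
    have p6 : Cα / p ≤ 10 * Cα / m := by
      rw [div_le_div_iff₀ hp0 hm0]
      have := mul_le_mul_of_nonneg_left hpm hCα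
      linarith
    have p7 : ((10 * C) ^ 3 + 20 * Cα) / m = (10 * C) ^ 3 / m + 2 * (10 * Cα / m) := by ring
    rw [p7]
    linarith
  obtain ⟨N, hN, hNw⟩ := exists_null_of_ae ((hB₁w.and hB₂w).and hB₃w)
  refine ⟨((B₁ ∩ B₂) ∩ B₃) ∪ N, ?_, ?_⟩
  · refine (measure_union_le _ _).trans ?_
    rw [hN, add_zero, ← ofReal_measureReal]
    refine ENNReal.ofReal_le_ofReal (hprob.trans ?_)
    exact div_le_div_of_nonneg_right (by linarith) hm0.le
  · intro w hw h
    obtain ⟨hwB, hwN⟩ := not_or.1 hw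
    obtain ⟨⟨hw1, hw2⟩, hw3⟩ := hNw w hwN
    set T := covForm μ (X 1) (sqrtKernelOp ψ θ h) (sqrtKernelOp ψ θ h) with hT
    set Q := ∑ j ∈ Finset.Ioc s₀ (s₀ + m), inner ℝ (sqrtKernelOp ψ θ (X j w)) h ^ 2 with hQ
    have hQ0 : 0 ≤ Q := Finset.sum_nonneg fun _ _ => sq_nonneg _
    have hsub : ∀ i, s₀ ≤ i → i + p ≤ s₀ + m → ∑ j ∈ Finset.Ioc i (i + p),
        inner ℝ (sqrtKernelOp ψ θ (X j w)) h ^ 2 ≤ Q := fun i h1 h2 =>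
      Finset.sum_le_sum_of_subset_of_nonneg (Finset.Ioc_subset_Ioc h1 h2)
        fun _ _ _ => sq_nonneg _
    have hlast : ∀ q' ≤ Q, p * T ≤ 2 * q' + p * D ^ (-2 * r) * ‖h‖ ^ 2 →
        m * T ≤ ((10 * C) ^ 3 + 20 * Cα + 20) * (Q + D * ‖h‖ ^ 2) := by
      intro q' hq' hle
      have hT0 : 0 ≤ T := DataAssumption.covForm_self_nonneg (μ := μ) _ _
      have a1 : p * D ^ (-2 * r) ≤ D := by
        rw [hlam, ← mul_div_assoc, div_le_iff₀ hm0, mul_comm]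
        gcongr
      have a2 := mul_le_mul_of_nonneg_right a1 (sq_nonneg ‖h‖)
      have a3 := mul_le_mul_of_nonneg_right hpm hT0
      have a4 : 0 ≤ D * ‖h‖ ^ 2 := by positivity
      have a5 : 0 ≤ ((10 * C) ^ 3 + 20 * Cα) * (Q + D * ‖h‖ ^ 2) := by positivity
      linarith
    by_cases c1 : w ∈ B₁
    · by_cases c2 : w ∈ B₂
      · exact hlast _ (hsub _ (by omega) (by omega)) (hw3 (fun c3 => hwB ⟨⟨c1, c2⟩, c3⟩) h)
      · exact hlast _ (hsub _ (by omega) (by omega)) (hw2 c2 h)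
    · exact hlast _ (hsub _ (by omega) (by omega)) (hw1 c1 h)

end Events


/-! ### From stochastic bounds to good samples. -/

theorem abs_le_of_sq_le_mul {F Y K : ℝ} (hY : 0 ≤ Y) (hK : 0 ≤ K) (h : F ^ 2 ≤ K * Y) :
    |F| ≤ 1 / 100 * Y + 25 * K := by
  refine abs_le_of_sq_le_sq (h.trans ?_) (by positivity)
  nlinarith [sq_nonneg (1 / 100 * Y - 25 * K)]

theorem abs_sum_mul_le {S : Finset ℕ} (u v : ℕ → ℝ) :
    |∑ j ∈ S, u j * v j| ≤ 1 / 100 * ∑ j ∈ S, v j ^ 2 + 25 * ∑ j ∈ S, u j ^ 2 := by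
  refine (Finset.abs_sum_le_sum_abs _ _).trans ?_
  rw [Finset.mul_sum, Finset.mul_sum, ← Finset.sum_add_distrib]
  refine Finset.sum_le_sum fun j _ => abs_le_of_sq_le_mul (sq_nonneg _) (sq_nonneg _) ?_
  rw [mul_pow]

section Deterministic

variable {E : Type*} [NormedAddCommGroup E] [InnerProductSpace ℝ E]

/-- Criterion for a sample to be good. -/
theorem GoodSample.of_bounds {z : ℕ → E} {ε y : ℕ → ℝ} {R : ℕ → ℕ → ℝ} {G : ℕ → E} {η : ℕ → ℕ}
    {κ : ℕ → ℝ} {𝒦 n Δ : ℕ} {A : Set ℕ} {q ω B : ℝ} {M₀ : ℕ} (T : E → ℝ) (Tc : ℕ → E → ℝ)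
    {K Cl Cn x C κmax : ℝ} (hK0 : 0 ≤ K) (hCl : 0 ≤ Cl) (hCn : 0 ≤ Cn) (hx : 1 ≤ x) (hq0 : 0 ≤ q)
    (hη0 : η 0 = 0) (hηn : η (𝒦 + 1) = n) (hsp : ∀ k ≤ 𝒦, η k + Δ ≤ η (k + 1)) (hΔ : 1 ≤ Δ)
    (h𝒦 : 1 ≤ 𝒦)
    (hy : ∀ k ≤ 𝒦, ∀ j, η k < j → j ≤ η (k + 1) → y j = inner ℝ (z j) (G k) + ε j)
    (hG : ∀ k ≤ 𝒦, ‖G k‖ ^ 2 ≤ B) (hω : 1 / 2 ≤ ω)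
    (hκ : ∀ k, 1 ≤ k → k ≤ 𝒦 → 0 < κ k ∧ κ k ≤ κmax ∧ T (G k - G (k - 1)) = κ k ∧
      Tc k (G k - G (k - 1)) = κ k ∧ ‖G k - G (k - 1)‖ ^ 2 ≤ 4 * B)
    (hηA : ∀ k, 1 ≤ k → k ≤ 𝒦 → η k ∈ A)
    (hM₀x : (M₀ : ℝ) ≤ x * (Δ : ℝ) ^ q)
    (hrss : ∀ s e, s < e → ∃ f₀ : E, R s e = ∑ j ∈ Finset.Ioc s e, (y j - inner ℝ (z j) f₀) ^ 2 ∧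
      ∀ f : E, R s e + ω * ((e - s : ℕ) : ℝ) ^ q * ‖f₀‖ ^ 2
        ≤ ∑ j ∈ Finset.Ioc s e, (y j - inner ℝ (z j) f) ^ 2
          + ω * ((e - s : ℕ) : ℝ) ^ q * ‖f‖ ^ 2)
    (noise : ∀ a ∈ A, ∀ c f, c < f → f ≤ n → (c = a ∨ f = a) → ∀ h : E,
      (∑ j ∈ Finset.Ioc c f, ε j * inner ℝ (z j) h) ^ 2
        ≤ K * x * ((f - c : ℕ) : ℝ) ^ q *
          (((f - c : ℕ) : ℝ) * T h + ((f - c : ℕ) : ℝ) ^ q * ‖h‖ ^ 2))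
    (cross : ∀ k, 1 ≤ k → k ≤ 𝒦 → ∀ c f, c < f → f ≤ n → (c = η k ∨ f = η k) → ∀ h : E,
      (∑ j ∈ Finset.Ioc c f, inner ℝ (z j) (G k - G (k - 1)) * inner ℝ (z j) h
        - ((f - c : ℕ) : ℝ) * Tc k h) ^ 2
        ≤ K * x * ((f - c : ℕ) : ℝ) ^ q *
          (((f - c : ℕ) : ℝ) * T h + ((f - c : ℕ) : ℝ) ^ q * ‖h‖ ^ 2))
    (lower : ∀ a ∈ A, ∀ c f, c < f → f ≤ n → (c = a ∨ f = a) → M₀ ≤ f - c → ∀ h : E,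
      ((f - c : ℕ) : ℝ) * T h ≤ 2 * Cl * (∑ j ∈ Finset.Ioc c f,
        inner ℝ (z j) h ^ 2 + ((f - c : ℕ) : ℝ) ^ q * ‖h‖ ^ 2))
    (small : ∀ a ∈ A, ∀ c f, c < f → f ≤ n → (c = a ∨ f = a) → f - c ≤ M₀ →
      ∑ j ∈ Finset.Ioc c f, ε j ^ 2 ≤ Cn * M₀)
    (hC : ω * B + κmax + 25 * Cn + 25 * (K * (2 * Cl + 1)) + 25 * K + B ≤ C) :
    GoodSample z ε y R G η κ 𝒦 n Δ A q ω B
      (fun m => C * x * ((max m Δ : ℕ) : ℝ) ^ q) M₀ := by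
  have hx0 : 0 < x := by linarith
  have hM₀0 : (0 : ℝ) ≤ M₀ := Nat.cast_nonneg _
  have hB : 0 ≤ B := (sq_nonneg _).trans (hG 0 (Nat.zero_le _))
  have hωB : 0 ≤ ω * B := mul_nonneg (by linarith) hB
  have hκm : 0 ≤ κmax := (hκ 1 le_rfl h𝒦).1.le.trans (hκ 1 le_rfl h𝒦).2.1
  set K' : ℝ := K * (2 * Cl + 1) with hK'
  have hK'0 : 0 ≤ K' := by positivity
  have hC0 : 0 ≤ C := by linarith
  -- the error terms
  have hbm : ∀ (m : ℕ) (D : ℝ), 0 ≤ D → D ≤ C → D * x * (m : ℝ) ^ q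
      ≤ C * x * ((max m Δ : ℕ) : ℝ) ^ q := by
    intro m D hD hDC
    have : (m : ℝ) ^ q ≤ ((max m Δ : ℕ) : ℝ) ^ q :=
      Real.rpow_le_rpow (by positivity) (by exact_mod_cast le_max_left _ _) hq0
    gcongr
  -- Through the maximum with Δ even the shortest interval carries an error of order `x Δ^q`, and
  -- this pays for all terms of order `M₀`.
  have hbM : ∀ (m : ℕ) (D : ℝ), 0 ≤ D → D ≤ C → D * M₀ ≤ C * x * ((max m Δ : ℕ) : ℝ) ^ q := by
    intro m D hD hDC
    have h1 : (Δ : ℝ) ^ q ≤ ((max m Δ : ℕ) : ℝ) ^ q :=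
      Real.rpow_le_rpow (by positivity) (by exact_mod_cast le_max_right _ _) hq0
    calc D * M₀ ≤ C * (x * (Δ : ℝ) ^ q) := mul_le_mul hDC hM₀x hM₀0 (by positivity)
      _ ≤ C * (x * ((max m Δ : ℕ) : ℝ) ^ q) := by gcongr
      _ = _ := by ring
  -- On long intervals the lower covariance bound replaces the population form `m * T h` by the
  -- empirical Q plus penalty, and the arithmetic–geometric mean inequality then moves all but 1/100
  -- of it into the error term.
  have hmain : ∀ {F Q : ℝ} {m : ℕ}, 0 ≤ Q → M₀ ≤ m →
      ∀ h : E, m * T h ≤ 2 * Cl * (Q + (m : ℝ) ^ q * ‖h‖ ^ 2) →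
      F ^ 2 ≤ K * x * (m : ℝ) ^ q * (m * T h + (m : ℝ) ^ q * ‖h‖ ^ 2) →
      |F| ≤ 1 / 100 * Q + 1 / 100 * ((m : ℝ) ^ q * ‖h‖ ^ 2)
        + C * x * ((max m Δ : ℕ) : ℝ) ^ q := by
    intro F Q m hQ hm h hl hF
    have h0 : 0 ≤ (m : ℝ) ^ q * ‖h‖ ^ 2 := by positivity
    have h1 : F ^ 2 ≤ K' * x * (m : ℝ) ^ q * (Q + (m : ℝ) ^ q * ‖h‖ ^ 2) := by
      refine hF.trans ?_
      have e : K' * x * (m : ℝ) ^ q * (Q + (m : ℝ) ^ q * ‖h‖ ^ 2)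
        = K * x * (m : ℝ) ^ q * ((2 * Cl + 1) * (Q + (m : ℝ) ^ q * ‖h‖ ^ 2)) := by
        rw [hK']; ring
      rw [e]
      refine mul_le_mul_of_nonneg_left ?_ (by positivity)
      linarith
    have h2 := abs_le_of_sq_le_mul (add_nonneg hQ h0) (by positivity) h1
    have h3 := hbm m (25 * K') (by positivity) (by linarith)
    linarith
  have hsig : ∀ {F : ℝ} {m k : ℕ}, 1 ≤ k → k ≤ 𝒦 →
      F ^ 2 ≤ K * x * (m : ℝ) ^ q * (m * T (G k - G (k - 1)) + (m : ℝ) ^ q * ‖G k - G (k - 1)‖ ^ 2) →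
      |F| ≤ 1 / 100 * (m * κ k) + C * x * ((max m Δ : ℕ) : ℝ) ^ q := by
    intro F m k hk1 hk2 hF
    have hκk := hκ k hk1 hk2
    have hTk : T (G k - G (k - 1)) = κ k := hκk.2.2.1
    rw [hTk] at hF
    have h2 := abs_le_of_sq_le_mul (add_nonneg (mul_nonneg (Nat.cast_nonneg m) hκk.1.le) (by positivity)) (by positivity) hF
    have h3 : (m : ℝ) ^ q * ‖G k - G (k - 1)‖ ^ 2 ≤ (m : ℝ) ^ q * (4 * B) :=
      mul_le_mul_of_nonneg_left hκk.2.2.2.2 (by positivity)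
    have h4 := hbm m (25 * K + B) (by positivity) (by linarith)
    have h5 : B * (m : ℝ) ^ q ≤ B * x * (m : ℝ) ^ q := by
      refine mul_le_mul_of_nonneg_right (le_mul_of_one_le_right hB hx) (by positivity)
    have h6 : 0 ≤ B * (m : ℝ) ^ q := by positivity
    linarith
  exact {
    η_zero := hη0
    η_last := hηn
    spacing := hsp
    spacing_pos := hΔ
    one_le := h𝒦
    response_eq := hy
    norm_coef := hG
    half_le := hω
    q_nonneg := hq0
    jump_pos := fun k h1 h2 => (hκ k h1 h2).1
    anchor := fun k h1 h2 => hηA k h1 h2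
    error_mono := fun m m' hm => by
      refine mul_le_mul_of_nonneg_left (Real.rpow_le_rpow (by positivity) ?_ hq0) (by positivity)
      exact_mod_cast max_le_max_right _ hm
    penalty_le := fun m => by
      refine le_trans ?_ (hbm m (ω * B) hωB (by linarith))
      have : 0 ≤ ω * B * (m : ℝ) ^ q := by positivity
      nlinarith
    short_le := fun k h1 h2 =>
      (mul_le_mul_of_nonneg_right (hκ k h1 h2).2.1 hM₀0).trans
        (hbM 0 κmax hκm (by linarith))
    rss_min := hrss
    noise := fun s e hse hen hA h => by
      obtain ⟨a, ha, hca⟩ : ∃ a ∈ A, s = a ∨ e = a := by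
        rcases hA with hA | hA
        · exact ⟨s, hA, Or.inl rfl⟩
        · exact ⟨e, hA, Or.inr rfl⟩
      rcases le_or_gt M₀ (e - s) with hM | hM
      · exact hmain (Finset.sum_nonneg fun _ _ => sq_nonneg _) hM h
          (lower a ha s e hse hen hca hM h) (noise a ha s e hse hen hca h)
      -- On short intervals no lower covariance bound is available. Cauchy–Schwarz and the total
      -- squared noise `Cn * M₀` suffice.
      · have h1 := small a ha s e hse hen hca hM.le
        have h2 := abs_sum_mul_le (S := Finset.Ioc s e) ε (fun j => inner ℝ (z j) h)
        have h3 := hbM (e - s) (25 * Cn) (by positivity) (by linarith)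
        have h4 : 0 ≤ ((e - s : ℕ) : ℝ) ^ q * ‖h‖ ^ 2 := by positivity
        linarith
    cross := ⟨Tc,
      fun k h1 h2 s e hse hen hs hM h =>
        hmain (Finset.sum_nonneg fun _ _ => sq_nonneg _) hM h
          (lower (η k) (hηA k h1 h2) s e hse hen hs hM h) (cross k h1 h2 s e hse hen hs h)⟩
    signal := fun k h1 h2 s e hse hen hs => by
      have := hsig h1 h2 (cross k h1 h2 s e hse hen hs (G k - G (k - 1)))
      rw [(hκ k h1 h2).2.2.2.1] at this
      simpa only [sq] using this
    signal_noise := fun k h1 h2 s e hse hen hs =>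
      hsig h1 h2 (noise (η k) (hηA k h1 h2) s e hse hen hs (G k - G (k - 1))) }

end Deterministic

section Events

variable {d : ℕ} {𝒯 : Set (Euc d)} {Ω : Type*} [mΩ : MeasurableSpace Ω] {μ : Measure Ω}
  {X : ℕ → Ω → L2 𝒯} {ε : ℕ → Ω → ℝ}
  {ψ : HilbertBasis ℕ ℝ (L2 𝒯)} {θ : ℕ → ℝ} {r : ℝ} {φ : ℕ → L2 𝒯} {𝔰 : ℕ → ℝ}

theorem SpectralSystem.exists_covForm_le {X₁ : Ω → L2 𝒯} (hS : SpectralSystem μ X₁ ψ θ r φ 𝔰) :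
    ∃ C : ℝ, 0 < C ∧ ∀ h : L2 𝒯,
      covForm μ X₁ (sqrtKernelOp ψ θ h) (sqrtKernelOp ψ θ h) ≤ C * ‖h‖ ^ 2 := by
  have hle : ∀ l, 𝔰 l ≤ ∑' l, 𝔰 l := fun l => hS.summable.le_tsum l fun k _ => (hS.pos k).le
  refine ⟨∑' l, 𝔰 l, (hS.pos 0).trans_le (hle 0), fun h => ?_⟩
  refine le_of_tendsto (hS.hasSum h h).tendsto_sum_nat (Eventually.of_forall fun m => ?_)
  have h1 := sum_sq_inner_le hS.orthonormal h (Finset.range m)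
  refine le_trans ?_ (mul_le_mul_of_nonneg_left h1 ((hS.pos 0).le.trans (hle 0)))
  rw [Finset.mul_sum]
  refine Finset.sum_le_sum fun l _ => ?_
  rw [mul_assoc, ← sq]
  exact mul_le_mul_of_nonneg_right (hle l) (sq_nonneg _)

/-- Rounding a length to a power of two changes it and its q-th power by at most a factor 2, so one
event per dyadic scale covers all lengths. -/
theorem dyadic_rpow_le {q : ℝ} (hq : 0 ≤ q) (hq1 : q ≤ 1) {m : ℕ} (hm : 1 ≤ m) :
    m ≤ 2 ^ (Nat.log 2 m + 1) ∧ 2 ^ Nat.log 2 m ≤ m ∧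
      ((2 ^ (Nat.log 2 m + 1) : ℕ) : ℝ) ≤ 2 * m ∧
      ((2 ^ (Nat.log 2 m + 1) : ℕ) : ℝ) ^ q ≤ 2 * (m : ℝ) ^ q ∧
      ((2 ^ Nat.log 2 m : ℕ) : ℝ) ^ q ≤ (m : ℝ) ^ q ∧
      (m : ℝ) ≤ 2 * ((2 ^ Nat.log 2 m : ℕ) : ℝ) := by
  have h1 : m < 2 ^ (Nat.log 2 m + 1) := Nat.lt_pow_succ_log_self (by norm_num) m
  have h2 : 2 ^ Nat.log 2 m ≤ m := Nat.pow_log_le_self 2 (by omega)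
  have h3 : ((2 ^ (Nat.log 2 m + 1) : ℕ) : ℝ) ≤ 2 * m := by
    exact_mod_cast (by rw [pow_succ]; omega : 2 ^ (Nat.log 2 m + 1) ≤ 2 * m)
  refine ⟨h1.le, h2, h3, ?_, Real.rpow_le_rpow (by positivity) (by exact_mod_cast h2) hq, ?_⟩
  · calc ((2 ^ (Nat.log 2 m + 1) : ℕ) : ℝ) ^ q ≤ (2 * (m : ℝ)) ^ q :=
          Real.rpow_le_rpow (by positivity) h3 hq
      _ = 2 ^ q * (m : ℝ) ^ q := Real.mul_rpow (by norm_num) (by positivity)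
      _ ≤ 2 * (m : ℝ) ^ q := by
          refine mul_le_mul_of_nonneg_right ?_ (by positivity)
          exact (Real.rpow_le_rpow_of_exponent_le (by norm_num) hq1).trans_eq (Real.rpow_one 2)
  · exact_mod_cast (by rw [pow_succ] at h1; omega : m ≤ 2 * 2 ^ Nat.log 2 m)

/-- With large probability, a sample is good. -/
theorem exists_goodSample [IsProbabilityMeasure μ] (hd : DataAssumption μ X ε)
    (hS : SpectralSystem μ (X 1) ψ θ r φ 𝔰) {B ω : ℝ} (hω : 1 / 2 ≤ ω) : ∃ C : ℝ, 0 < C ∧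
    ∀ (n Δ 𝒦 M₀ J : ℕ) (η : ℕ → ℕ) (β G : ℕ → L2 𝒯) (κ : ℕ → ℝ) (A : Finset ℕ) (x P : ℝ),
      η 0 = 0 → η (𝒦 + 1) = n → (∀ k ≤ 𝒦, η k + Δ ≤ η (k + 1)) → 1 ≤ Δ → 1 ≤ 𝒦 →
      (∀ k ≤ 𝒦, ∀ j, η k < j → j ≤ η (k + 1) → β j = sqrtKernelOp ψ θ (G k)) →
      (∀ k ≤ 𝒦, ‖G k‖ ^ 2 ≤ B) →
      (∀ k, 1 ≤ k → k ≤ 𝒦 → 0 < κ k ∧ κ k = covForm μ (X 1)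
        (sqrtKernelOp ψ θ (G k - G (k - 1))) (sqrtKernelOp ψ θ (G k - G (k - 1)))) →
      (∀ k, 1 ≤ k → k ≤ 𝒦 → η k ∈ A) → (A.card : ℝ) ≤ P → (𝒦 : ℝ) ≤ P → n < 2 ^ J →
      1 ≤ M₀ → 1 ≤ x → (M₀ : ℝ) ≤ x * (Δ : ℝ) ^ (1 / (2 * r + 1)) →
      ∃ Bd : Set Ω, μ Bd ≤ ENNReal.ofReal (C * (P * J * (1 / x + 1 / M₀))) ∧ ∀ w ∉ Bd,
        GoodSample (fun j => sqrtKernelOp ψ θ (X j w)) (fun j => ε j w) (response β X ε w)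
          (rss ψ θ ω r (response β X ε w) fun j => X j w) G η κ 𝒦 n Δ A (1 / (2 * r + 1)) ω B
          (fun m => C * x * ((max m Δ : ℕ) : ℝ) ^ (1 / (2 * r + 1))) M₀ := by
  obtain ⟨Cu, hCu, hunif⟩ := exists_uniform_bound hd hS
  obtain ⟨Cl, hCl, hlow⟩ := exists_lower_bound hd hS
  obtain ⟨Cn, hCn, hnsq⟩ := exists_noise_sq_bound hd
  obtain ⟨aε, haε, hε6⟩ := hd.exists_noise_sixth_moment_le
  obtain ⟨c₆, hc₆, hX6⟩ := hd.exists_sixth_moment_le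
  obtain ⟨S, hS0, hSle⟩ := hS.exists_covForm_le
  obtain ⟨Cθ, hCθ⟩ := hS.theta_le
  have hcomm := fun a b => inner_sqrtKernelOp_comm (ψ := ψ) hS.theta_nonneg hCθ a b
  have hr := hS.one_lt
  rcases lt_or_ge B 0 with hB | hB
  · refine ⟨1, one_pos, ?_⟩
    intro n Δ 𝒦 M₀ J η β G κ A x P _ _ _ _ _ _ hG
    exact absurd ((sq_nonneg _).trans (hG 0 (Nat.zero_le _))) (not_le.2 hB)
  set q : ℝ := 1 / (2 * r + 1) with hq
  have hq0 : 0 ≤ q := by positivity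
  have hq1 : q ≤ 1 := by rw [hq, div_le_one (by linarith)]; linarith
  -- the constants in the bounds for the noise and for the cross products
  set K : ℝ := 4 * (Cu * (aε ^ 2 + c₆ ^ 2 * (S * (4 * B)))) with hK
  have hK0 : 0 < K := by positivity
  set K' : ℝ := K * (2 * Cl + 1) with hK'
  have hK'0 : 0 < K' := by positivity
  refine ⟨4 + 4 * Cl + 2 * Cn + ω * B + S * (4 * B) + 25 * Cn + 25 * K' + 25 * K + B,
    by positivity, ?_⟩
  set C : ℝ := 4 + 4 * Cl + 2 * Cn + ω * B + S * (4 * B) + 25 * Cn + 25 * K' + 25 * K + B with hC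
  have hωB : 0 ≤ ω * B := by positivity
  have hSB : 0 ≤ S * (4 * B) := by positivity
  intro n Δ 𝒦 M₀ J η β G κ A x P hη0 hηn hsp hΔ h𝒦 hβG hG hκ hηA hAP h𝒦P hnJ hM₀ hx hM₀x
  have hx0 : 0 < x := by linarith
  have hM₀0 : (0 : ℝ) < M₀ := by exact_mod_cast hM₀
  have hP0 : 0 ≤ P := (Nat.cast_nonneg _).trans hAP
  set h₀ : ℕ → L2 𝒯 := fun k => G k - G (k - 1) with hh₀
  have hh₀n : ∀ k, 1 ≤ k → k ≤ 𝒦 → ‖h₀ k‖ ^ 2 ≤ 4 * B := by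
    intro k h1 h2
    have a1 := hG k h2
    have a2 := hG (k - 1) (by omega)
    have a3 := norm_sub_le (G k) (G (k - 1))
    have a4 := pow_le_pow_left₀ (norm_nonneg _) a3 2
    simp only [hh₀]
    nlinarith [sq_nonneg (‖G k‖ - ‖G (k - 1)‖)]
  have hκle : ∀ k, 1 ≤ k → k ≤ 𝒦 → κ k ≤ S * (4 * B) := fun k h1 h2 => by
    rw [(hκ k h1 h2).2]
    exact (hSle _).trans (mul_le_mul_of_nonneg_left (hh₀n k h1 h2) hS0.le)
  have hpair : ∀ j, Measurable[MeasurableSpace.comap (fun w => (X j w, ε j w)) inferInstance]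
      fun w => (X j w, ε j w) := fun j => comap_measurable _
  -- the bad events
  have E1 := fun s₀ i : ℕ => hunif ε aε (fun _ => 0) haε
    (fun j hj => measurable_snd.comp (hpair j)) hε6
    (fun j hj l => hd.integral_noise_mul_inner hj _) s₀ (2 ^ (i + 1)) x Nat.one_le_two_pow hx0
  have E2 : ∀ k s₀ i : ℕ, ∃ Bd : Set Ω, μ Bd ≤ ENNReal.ofReal (1 / x) ∧ (1 ≤ k → k ≤ 𝒦 →
      ∀ w ∉ Bd, ∀ c f, s₀ ≤ c → c ≤ f → f ≤ s₀ + 2 ^ (i + 1) → ∀ h : L2 𝒯,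
        (∑ j ∈ Finset.Ioc c f, inner ℝ (X j w) (sqrtKernelOp ψ θ (h₀ k)) *
            inner ℝ (sqrtKernelOp ψ θ (X j w)) h
          - ((f - c : ℕ) : ℝ) * covForm μ (X 1) (sqrtKernelOp ψ θ (h₀ k)) (sqrtKernelOp ψ θ h)) ^ 2
          ≤ Cu * (c₆ * √(κ k)) ^ 2 * x * ((2 ^ (i + 1) : ℕ) : ℝ) ^ q *
            (((2 ^ (i + 1) : ℕ) : ℝ) * covForm μ (X 1) (sqrtKernelOp ψ θ h) (sqrtKernelOp ψ θ h)
              + ((2 ^ (i + 1) : ℕ) : ℝ) ^ q * ‖h‖ ^ 2)) := by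
    intro k s₀ i
    by_cases hk : 1 ≤ k ∧ k ≤ 𝒦
    · have hκk := hκ k hk.1 hk.2
      obtain ⟨Bd, h1, h2⟩ := hunif (fun j w => inner ℝ (X j w) (sqrtKernelOp ψ θ (h₀ k)))
        (c₆ * √(κ k)) (fun l => 𝔰 l * inner ℝ (h₀ k) (φ l))
        (mul_pos hc₆ (Real.sqrt_pos.2 hκk.1))
        (fun j hj => ((measurable_inner_left _).comp measurable_fst).comp (hpair j))
        (fun j hj => by
          have := hX6 j hj (sqrtKernelOp ψ θ (h₀ k))
          rwa [← hκk.2] at this)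
        (fun j hj l => by rw [hd.integral_inner_mul_inner hj, hS.covForm_right])
        s₀ (2 ^ (i + 1)) x Nat.one_le_two_pow hx0
      exact ⟨Bd, h1, fun _ _ w hw c f a1 a2 a3 h => h2 w hw c f a1 a2 a3 h _ (hS.hasSum (h₀ k) h)⟩
    · exact ⟨∅, by simp, fun a1 a2 => absurd ⟨a1, a2⟩ hk⟩
  have E3 := fun s₀ i : ℕ => hlow s₀ (2 ^ i) Nat.one_le_two_pow
  have E4 := fun s₀ : ℕ => hnsq s₀ M₀ hM₀
  choose F1 hF1 hF1w using E1
  choose F2 hF2 hF2w using E2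
  choose F3 hF3 hF3w using E3
  choose F4 hF4 hF4w using E4
  -- The covariance bound at scale `2 ^ i` fails with probability of order `2 ^ (-i)`, so it is
  -- required only at scales that intervals of length at least `M₀` can reach.
  set F3' : ℕ → ℕ → Set Ω := fun s₀ i => if M₀ < 2 ^ (i + 1) then F3 s₀ i else ∅ with hF3'
  have hF3'le : ∀ s₀ i, μ (F3' s₀ i) ≤ ENNReal.ofReal (2 * Cl / M₀) := by
    intro s₀ i
    simp only [hF3']
    split_ifs with h
    · refine (hF3 s₀ i).trans (ENNReal.ofReal_le_ofReal ?_)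
      have : (M₀ : ℝ) ≤ 2 * ((2 ^ i : ℕ) : ℝ) := by
        exact_mod_cast (by rw [pow_succ] at h; omega : M₀ ≤ 2 * 2 ^ i)
      rw [div_le_div_iff₀ (by positivity) hM₀0]
      nlinarith
    · simp
  -- An anchor can be the left or the right end of an interval, so blocks starting at a and blocks
  -- ending at a are both included. Truncated subtraction starts the latter at 0 if a is smaller
  -- than the block.
  set B1 : ℕ → ℕ → Set Ω := fun a i => (F1 a i ∪ F1 (a - 2 ^ (i + 1)) i) ∪
    (F3' a i ∪ F3' (a - 2 ^ i) i) ∪ (F4 a ∪ F4 (a - M₀)) with hB1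
  set B2 : ℕ → ℕ → Set Ω := fun k i => F2 k (η k) i ∪ F2 k (η k - 2 ^ (i + 1)) i with hB2
  have hB1le : ∀ a i, μ (B1 a i) ≤ ENNReal.ofReal (2 / x + (4 * Cl + 2 * Cn) / M₀) := by
    intro a i
    have e : 2 / x + (4 * Cl + 2 * Cn) / M₀
        = (1 / x + 1 / x) + (2 * Cl / M₀ + 2 * Cl / M₀) + (Cn / M₀ + Cn / M₀) := by ring
    rw [e, ENNReal.ofReal_add (by positivity) (by positivity),
      ENNReal.ofReal_add (by positivity) (by positivity),
      ENNReal.ofReal_add (by positivity) (by positivity),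
      ENNReal.ofReal_add (by positivity) (by positivity),
      ENNReal.ofReal_add (by positivity) (by positivity)]
    refine (measure_union_le _ _).trans (add_le_add ((measure_union_le _ _).trans (add_le_add
      ((measure_union_le _ _).trans (add_le_add (hF1 _ _) (hF1 _ _)))
      ((measure_union_le _ _).trans (add_le_add (hF3'le _ _) (hF3'le _ _)))))
      ((measure_union_le _ _).trans (add_le_add (hF4 _) (hF4 _))))
  have hB2le : ∀ k i, μ (B2 k i) ≤ ENNReal.ofReal (2 / x) := by
    intro k i
    have e : 2 / x = 1 / x + 1 / x := by ring
    rw [e, ENNReal.ofReal_add (by positivity) (by positivity)]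
    exact (measure_union_le _ _).trans (add_le_add (hF2 _ _ _) (hF2 _ _ _))
  have hunion : ∀ (s : Finset ℕ) (D : ℕ → ℕ → Set Ω) (v : ℝ), 0 ≤ v → (s.card : ℝ) ≤ P →
      (∀ a i, μ (D a i) ≤ ENNReal.ofReal v) →
      μ (⋃ a ∈ s, ⋃ i ∈ Finset.range J, D a i) ≤ ENNReal.ofReal (P * J * v) := by
    intro s D v hv hs hD
    refine (measure_biUnion_finset_le _ _).trans ?_
    refine (Finset.sum_le_sum fun a _ => (measure_biUnion_finset_le _ _).trans
      (Finset.sum_le_sum fun i _ => hD a i)).trans ?_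
    rw [Finset.sum_const, Finset.sum_const, Finset.card_range, nsmul_eq_mul, nsmul_eq_mul,
      ← ENNReal.ofReal_natCast, ← ENNReal.ofReal_natCast, ← ENNReal.ofReal_mul (by positivity),
      ← ENNReal.ofReal_mul (by positivity), ← mul_assoc]
    refine ENNReal.ofReal_le_ofReal ?_
    gcongr
  refine ⟨(⋃ a ∈ A, ⋃ i ∈ Finset.range J, B1 a i) ∪
    ⋃ k ∈ Finset.Icc 1 𝒦, ⋃ i ∈ Finset.range J, B2 k i, ?_, ?_⟩
  · refine (measure_union_le _ _).trans ((add_le_add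
      (hunion A B1 _ (by positivity) hAP hB1le)
      (hunion (Finset.Icc 1 𝒦) B2 _ (by positivity) (by simpa using h𝒦P) hB2le)).trans ?_)
    rw [← ENNReal.ofReal_add (by positivity) (by positivity)]
    refine ENNReal.ofReal_le_ofReal ?_
    have hPJ : 0 ≤ P * J := by positivity
    have e : P * J * (2 / x + (4 * Cl + 2 * Cn) / M₀) + P * J * (2 / x)
        = P * J * (4 * (1 / x) + (4 * Cl + 2 * Cn) * (1 / M₀)) := by ring
    rw [e, mul_left_comm]
    refine mul_le_mul_of_nonneg_left ?_ hPJ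
    rw [mul_add]
    refine add_le_add (mul_le_mul_of_nonneg_right ?_ (by positivity))
      (mul_le_mul_of_nonneg_right ?_ (by positivity)) <;> linarith
  intro w hw
  obtain ⟨hwA, hwB⟩ := not_or.1 hw
  simp only [Set.mem_iUnion, not_exists] at hwA hwB
  have hlogJ : ∀ m, 1 ≤ m → m ≤ n → Nat.log 2 m ∈ Finset.range J := fun m h1 h2 =>
    Finset.mem_range.2 (Nat.log_lt_of_lt_pow (by omega) (by omega))
  set T : L2 𝒯 → ℝ := fun h => covForm μ (X 1) (sqrtKernelOp ψ θ h) (sqrtKernelOp ψ θ h) with hT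
  have hT0 : ∀ h, 0 ≤ T h := fun h => DataAssumption.covForm_self_nonneg (μ := μ) _ _
  have hscale : ∀ (m : ℕ) (Fsq a : ℝ) (h : L2 𝒯), 1 ≤ m → 0 ≤ a → 4 * (Cu * a) ≤ K →
      Fsq ≤ Cu * a * x * ((2 ^ (Nat.log 2 m + 1) : ℕ) : ℝ) ^ q *
        (((2 ^ (Nat.log 2 m + 1) : ℕ) : ℝ) * T h
          + ((2 ^ (Nat.log 2 m + 1) : ℕ) : ℝ) ^ q * ‖h‖ ^ 2) →
      Fsq ≤ K * x * (m : ℝ) ^ q * (m * T h + (m : ℝ) ^ q * ‖h‖ ^ 2) := by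
    intro m Fsq a h hm ha haK hle
    obtain ⟨-, -, d1, d2, -, -⟩ := dyadic_rpow_le hq0 hq1 hm
    have := hT0 h
    calc Fsq ≤ _ := hle
      _ ≤ Cu * a * x * (2 * (m : ℝ) ^ q) * (2 * m * T h + 2 * (m : ℝ) ^ q * ‖h‖ ^ 2) := by
          gcongr
      _ = 4 * (Cu * a) * (x * (m : ℝ) ^ q * (m * T h + (m : ℝ) ^ q * ‖h‖ ^ 2)) := by ring
      _ ≤ K * (x * (m : ℝ) ^ q * (m * T h + (m : ℝ) ^ q * ‖h‖ ^ 2)) := by gcongr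
      _ = _ := by ring
  have hCa : ∀ a, 0 ≤ a → a ≤ aε ^ 2 + c₆ ^ 2 * (S * (4 * B)) → 4 * (Cu * a) ≤ K := by
    intro a h1 h2
    rw [hK]; gcongr
  have hstart : ∀ {a c f : ℕ}, c < f → (c = a ∨ f = a) →
      ∃ s₀, (s₀ = a ∨ s₀ = a - 2 ^ (Nat.log 2 (f - c) + 1)) ∧ s₀ ≤ c ∧
        f ≤ s₀ + 2 ^ (Nat.log 2 (f - c) + 1) := by
    intro a c f hcf ha
    obtain ⟨d1, -⟩ := dyadic_rpow_le hq0 hq1 (show 1 ≤ f - c by omega)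
    rcases ha with rfl | rfl
    · exact ⟨c, Or.inl rfl, le_rfl, by omega⟩
    · exact ⟨_, Or.inr rfl, by omega, by omega⟩
  -- bounds for the sums
  have noise : ∀ a ∈ A, ∀ c f, c < f → f ≤ n → (c = a ∨ f = a) → ∀ h : L2 𝒯,
      (∑ j ∈ Finset.Ioc c f, ε j w * inner ℝ (sqrtKernelOp ψ θ (X j w)) h) ^ 2
        ≤ K * x * ((f - c : ℕ) : ℝ) ^ q *
          (((f - c : ℕ) : ℝ) * T h + ((f - c : ℕ) : ℝ) ^ q * ‖h‖ ^ 2) := by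
    intro a ha c f hcf hfn hca h
    have hb := hwA a ha _ (hlogJ (f - c) (by omega) (by omega))
    simp only [hB1, Set.mem_union, not_or] at hb
    refine hscale _ _ (aε ^ 2) h (by omega) (by positivity) (hCa _ (by positivity) ?_) ?_
    · have : 0 ≤ c₆ ^ 2 * (S * (4 * B)) := by positivity
      linarith
    obtain ⟨s₀, hs₀, h1, h2⟩ := hstart hcf hca
    have hnot : w ∉ F1 s₀ (Nat.log 2 (f - c)) := by
      rcases hs₀ with rfl | rfl
      · exact hb.1.1.1
      · exact hb.1.1.2
    have := hF1w _ _ w hnot c f h1 hcf.le h2 h 0 (by simp)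
    simpa using this
  have cross : ∀ k, 1 ≤ k → k ≤ 𝒦 → ∀ c f, c < f → f ≤ n → (c = η k ∨ f = η k) → ∀ h : L2 𝒯,
      (∑ j ∈ Finset.Ioc c f, inner ℝ (sqrtKernelOp ψ θ (X j w)) (h₀ k) *
          inner ℝ (sqrtKernelOp ψ θ (X j w)) h
        - ((f - c : ℕ) : ℝ) * covForm μ (X 1) (sqrtKernelOp ψ θ (h₀ k)) (sqrtKernelOp ψ θ h)) ^ 2
        ≤ K * x * ((f - c : ℕ) : ℝ) ^ q *
          (((f - c : ℕ) : ℝ) * T h + ((f - c : ℕ) : ℝ) ^ q * ‖h‖ ^ 2) := by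
    intro k hk1 hk2 c f hcf hfn hca h
    have hb := hwB k (Finset.mem_Icc.2 ⟨hk1, hk2⟩) _ (hlogJ (f - c) (by omega) (by omega))
    simp only [hB2, Set.mem_union, not_or] at hb
    have hκk := hκ k hk1 hk2
    refine hscale _ _ ((c₆ * √(κ k)) ^ 2) h (by omega) (by positivity)
      (hCa _ (by positivity) ?_) ?_
    · rw [mul_pow, Real.sq_sqrt hκk.1.le]
      have := mul_le_mul_of_nonneg_left (hκle k hk1 hk2) (sq_nonneg c₆)
      have := sq_nonneg aε
      linarith
    obtain ⟨s₀, hs₀, h1, h2⟩ := hstart hcf hca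
    have hnot : w ∉ F2 k s₀ (Nat.log 2 (f - c)) := by
      rcases hs₀ with rfl | rfl
      · exact hb.1
      · exact hb.2
    have := hF2w _ _ _ hk1 hk2 w hnot c f h1 hcf.le h2 h
    simpa only [hcomm] using this
  have lower : ∀ a ∈ A, ∀ c f, c < f → f ≤ n → (c = a ∨ f = a) → M₀ ≤ f - c → ∀ h : L2 𝒯,
      ((f - c : ℕ) : ℝ) * T h ≤ 2 * Cl * (∑ j ∈ Finset.Ioc c f,
        inner ℝ (sqrtKernelOp ψ θ (X j w)) h ^ 2 + ((f - c : ℕ) : ℝ) ^ q * ‖h‖ ^ 2) := by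
    intro a ha c f hcf hfn hca hM h
    have hb := hwA a ha _ (hlogJ (f - c) (by omega) (by omega))
    simp only [hB1, Set.mem_union, not_or] at hb
    obtain ⟨d1, d2, d3, d4, d5, d6⟩ := dyadic_rpow_le hq0 hq1 (show 1 ≤ f - c by omega)
    have hlt : M₀ < 2 ^ (Nat.log 2 (f - c) + 1) :=
      lt_of_le_of_lt hM (Nat.lt_pow_succ_log_self (by norm_num) _)
    simp only [hF3', hlt, if_true] at hb
    obtain ⟨s₀, h1, h2, hnot⟩ : ∃ s₀, c ≤ s₀ ∧ s₀ + 2 ^ Nat.log 2 (f - c) ≤ f ∧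
        w ∉ F3 s₀ (Nat.log 2 (f - c)) := by
      rcases hca with rfl | rfl
      · exact ⟨c, le_rfl, by omega, hb.1.2.1⟩
      · exact ⟨_, by omega, by omega, hb.1.2.2⟩
    have hl := hF3w _ _ w hnot h
    have hsub : ∑ j ∈ Finset.Ioc s₀ (s₀ + 2 ^ Nat.log 2 (f - c)),
        inner ℝ (sqrtKernelOp ψ θ (X j w)) h ^ 2
        ≤ ∑ j ∈ Finset.Ioc c f, inner ℝ (sqrtKernelOp ψ θ (X j w)) h ^ 2 :=
      Finset.sum_le_sum_of_subset_of_nonneg (Finset.Ioc_subset_Ioc h1 h2) fun _ _ _ => sq_nonneg _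
    calc ((f - c : ℕ) : ℝ) * T h ≤ 2 * ((2 ^ Nat.log 2 (f - c) : ℕ) : ℝ) * T h :=
          mul_le_mul_of_nonneg_right d6 (hT0 h)
      _ = 2 * (((2 ^ Nat.log 2 (f - c) : ℕ) : ℝ) * T h) := by ring
      _ ≤ 2 * _ := mul_le_mul_of_nonneg_left hl (by norm_num)
      _ ≤ 2 * (Cl * _) := by
          refine mul_le_mul_of_nonneg_left (mul_le_mul_of_nonneg_left (add_le_add hsub
            (mul_le_mul_of_nonneg_right d5 (sq_nonneg _))) hCl.le) (by norm_num)
      _ = _ := by ring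
  have small : ∀ a ∈ A, ∀ c f, c < f → f ≤ n → (c = a ∨ f = a) → f - c ≤ M₀ →
      ∑ j ∈ Finset.Ioc c f, ε j w ^ 2 ≤ Cn * M₀ := by
    intro a ha c f hcf hfn hca hM
    have hb := hwA a ha _ (hlogJ (f - c) (by omega) (by omega))
    simp only [hB1, Set.mem_union, not_or] at hb
    obtain ⟨s₀, h1, h2, hnot⟩ : ∃ s₀, s₀ ≤ c ∧ f ≤ s₀ + M₀ ∧ w ∉ F4 s₀ := by
      rcases hca with rfl | rfl
      · exact ⟨c, le_rfl, by omega, hb.2.1⟩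
      · exact ⟨_, by omega, by omega, hb.2.2⟩
    exact (Finset.sum_le_sum_of_subset_of_nonneg (Finset.Ioc_subset_Ioc h1 h2)
      fun _ _ _ => sq_nonneg _).trans (hF4w s₀ w hnot)
  refine GoodSample.of_bounds T (fun k h => covForm μ (X 1) (sqrtKernelOp ψ θ (h₀ k))
    (sqrtKernelOp ψ θ h)) (κmax := S * (4 * B)) hK0.le hCl.le hCn.le hx hq0 hη0 hηn hsp hΔ h𝒦
    (fun k hk j h1 h2 => by rw [response, hβG k hk j h1 h2, real_inner_comm, ← hcomm]) hG hω
    (fun k h1 h2 => ⟨(hκ k h1 h2).1, hκle k h1 h2, (hκ k h1 h2).2.symm, (hκ k h1 h2).2.symm,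
      hh₀n k h1 h2⟩) hηA hM₀x
    (fun s e hse => exists_rss_eq hS.theta_nonneg hCθ (by linarith) (by linarith) _ _ hse)
    noise cross lower small ?_
  rw [hC]
  linarith

end Events


/-! ### Change points, the union bound and the choice of the parameters. -/

section Assembly

variable {d : ℕ} {𝒯 : Set (Euc d)}

theorem Localizes.mono {B : Finset ℕ} {𝒦 : ℕ} {η : ℕ → ℕ} {jump : ℕ → ℝ} {v v' : ℝ}
    (h : Localizes B 𝒦 η jump v) (hv : v ≤ v') : Localizes B 𝒦 η jump v' :=
  ⟨h.1, fun k => (h.2 k).trans hv⟩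

namespace IsChangePoints

variable {n : ℕ} {β : ℕ → L2 𝒯} {𝒦 : ℕ} {η : ℕ → ℕ} (h : IsChangePoints n β 𝒦 η)

include h

theorem lt {i j : ℕ} (hij : i < j) (hj : j ≤ 𝒦 + 1) : η i < η j := by
  induction j, hij using Nat.le_induction with
  | base => exact h.lt_succ i (by omega)
  | succ j hij ih => exact (ih (by omega)).trans (h.lt_succ j (by omega))

theorem le {i j : ℕ} (hij : i ≤ j) (hj : j ≤ 𝒦 + 1) : η i ≤ η j := by
  rcases hij.eq_or_lt with rfl | hlt
  · exact le_rfl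
  · exact (h.lt hlt hj).le

theorem le_last {k : ℕ} (hk : k ≤ 𝒦 + 1) : η k ≤ n := h.last ▸ h.le hk le_rfl

theorem eq_of_mem {k : ℕ} (hk : k ≤ 𝒦) {j : ℕ} (h₁ : η k < j) (h₂ : j ≤ η (k + 1)) :
    β j = β (η (k + 1)) := by
  obtain ⟨m, hm⟩ := Nat.exists_eq_add_of_le h₂
  induction m generalizing j with
  | zero => rw [hm, add_zero]
  | succ m ih =>
    rw [← ih (j := j + 1) (by omega) (by omega) (by omega)]
    by_contra hne
    have hn := h.le_last (k := k + 1) (by omega)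
    obtain ⟨k', hk1, hk2, rfl⟩ := (h.change_iff j (by omega) (by omega)).1 hne
    rcases lt_trichotomy k' k with hlt | rfl | hlt
    · have := h.lt hlt (by omega); omega
    · omega
    · have := h.le (show k + 1 ≤ k' by omega) (by omega); omega

theorem spacing {k : ℕ} (hk : k ≤ 𝒦) : η k + minSpacing 𝒦 η ≤ η (k + 1) := by
  have h1 : minSpacing 𝒦 η ≤ η (k + 1) - η k :=
    Nat.sInf_le ⟨k + 1, ⟨by omega, by omega⟩, by simp⟩
  have := h.lt_succ k hk
  omega

theorem mul_minSpacing_le {k : ℕ} (hk : k ≤ 𝒦 + 1) : k * minSpacing 𝒦 η ≤ η k := by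
  induction k with
  | zero => simp
  | succ k ih =>
    have := h.spacing (k := k) (by omega)
    have := ih (by omega)
    rw [add_mul, one_mul]
    omega

end IsChangePoints

/-- The layers double in size, so the last one dominates: the total is at most `2^(m+2)` with `2^m <
2 n/Δ`. This is the source of the factor n/Δ in the threshold and in the rate. -/
theorem card_seededIntervals_le {n Δ : ℕ} (hΔ : 1 ≤ Δ) (hn : Δ ≤ n) :
    ((seededIntervals n Δ).card : ℝ) ≤ 8 * ((n : ℝ) / Δ) := by
  have hΔ0 : (0 : ℝ) < Δ := by exact_mod_cast hΔ
  have hx1 : 1 ≤ (n : ℝ) / Δ := by rw [one_le_div hΔ0]; exact_mod_cast hn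
  set m : ℕ := ⌈Real.logb 2 ((n : ℝ) / Δ)⌉₊ with hm
  have hm2 : (2 : ℝ) ^ m < 2 * ((n : ℝ) / Δ) := by
    have h := Nat.ceil_lt_add_one (Real.logb_nonneg (b := 2) (by norm_num) hx1)
    have h3 : (m : ℝ) - 1 < Real.logb 2 ((n : ℝ) / Δ) := by linarith
    have := (Real.lt_logb_iff_rpow_lt (b := 2) (by norm_num) (by linarith)).1 h3
    rw [Real.rpow_sub (by norm_num), Real.rpow_natCast, Real.rpow_one] at this
    linarith
  have h1 : (seededIntervals n Δ).card ≤ ∑ k ∈ Finset.Icc 1 (m + 1), 2 ^ k := by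
    refine Finset.card_biUnion_le.trans (Finset.sum_le_sum fun k _ => ?_)
    refine Finset.card_image_le.trans ?_
    rw [Nat.card_Icc, Nat.add_sub_cancel]
    exact Nat.sub_le _ _
  have h2 : ∑ k ∈ Finset.Icc 1 (m + 1), 2 ^ k ≤ 2 ^ (m + 2) := by
    have h3 : Finset.Icc 1 (m + 1) ⊆ Finset.range (m + 2) := fun k hk =>
      Finset.mem_range.2 (by have := (Finset.mem_Icc.1 hk).2; omega)
    exact (Finset.sum_le_sum_of_subset h3).trans (Nat.geomSum_lt le_rfl fun k hk =>
      Finset.mem_range.1 hk).le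
  have h3 : ((seededIntervals n Δ).card : ℝ) ≤ 2 ^ (m + 2) := by exact_mod_cast h1.trans h2
  rw [pow_add] at h3
  linarith

variable {Ω : Type*} [mΩ : MeasurableSpace Ω] {μ : Measure Ω}
  {X : ℕ → Ω → L2 𝒯} {ε : ℕ → Ω → ℝ}
  {ψ : HilbertBasis ℕ ℝ (L2 𝒯)} {θ : ℕ → ℝ} {r : ℝ} {φ : ℕ → L2 𝒯} {𝔰 : ℕ → ℝ}

theorem minJumpSq_le {X₁ : Ω → L2 𝒯} {β : ℕ → L2 𝒯} {𝒦 : ℕ} {η : ℕ → ℕ} {k : ℕ} (h1 : 1 ≤ k)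
    (h2 : k ≤ 𝒦) : minJumpSq μ X₁ β 𝒦 η ≤ jumpSq μ X₁ β η k :=
  csInf_le ((Set.finite_Icc 1 𝒦).image _).bddBelow ⟨k, ⟨h1, h2⟩, rfl⟩

theorem covForm_neg_neg (X₁ : Ω → L2 𝒯) (f : L2 𝒯) :
    covForm μ X₁ (-f) (-f) = covForm μ X₁ f f := by
  simp only [covForm, inner_neg_right, neg_mul_neg]

/-- The coefficients of the slope functions in the reproducing kernel Hilbert space. -/
theorem IsChangePoints.exists_coef {n : ℕ} {β : ℕ → L2 𝒯} {𝒦 : ℕ} {η : ℕ → ℕ}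
    (h : IsChangePoints n β 𝒦 η) (hθ : ∀ l, 0 ≤ θ l) {C : ℝ} (hC : ∀ l, θ l ≤ C) {B : ℝ}
    (hβ : ∀ j, 1 ≤ j → j ≤ n → InRKHS ψ θ (β j) ∧ rkhsNormSq ψ θ (β j) ≤ B) :
    ∃ G : ℕ → L2 𝒯, (∀ k ≤ 𝒦, ∀ j, η k < j → j ≤ η (k + 1) → β j = sqrtKernelOp ψ θ (G k)) ∧
      (∀ k ≤ 𝒦, ‖G k‖ ^ 2 ≤ B) ∧ ∀ (X₁ : Ω → L2 𝒯) k, 1 ≤ k → k ≤ 𝒦 → jumpSq μ X₁ β η k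
        = covForm μ X₁ (sqrtKernelOp ψ θ (G k - G (k - 1)))
          (sqrtKernelOp ψ θ (G k - G (k - 1))) := by
  have hex : ∀ k, ∃ g : L2 𝒯, k ≤ 𝒦 → sqrtKernelOp ψ θ g = β (η (k + 1)) ∧ ‖g‖ ^ 2 ≤ B := by
    intro k
    by_cases hk : k ≤ 𝒦
    · have h1 := h.lt_succ k hk
      obtain ⟨hin, hB⟩ := hβ (η (k + 1)) (by omega) (h.le_last (by omega))
      obtain ⟨g, hg, hg'⟩ := hin.exists_lift hθ hC
      exact ⟨g, fun _ => ⟨hg, hg'.trans_le hB⟩⟩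
    · exact ⟨0, fun h => absurd h hk⟩
  choose G hG using hex
  refine ⟨G, fun k hk j h1 h2 => by rw [(hG k hk).1, h.eq_of_mem hk h1 h2],
    fun k hk => (hG k hk).2, fun X₁ k h1 h2 => ?_⟩
  have e1 : k - 1 + 1 = k := by omega
  have g1 := (hG k h2).1
  have g2 := (hG (k - 1) (by omega)).1
  rw [e1] at g2
  rw [jumpSq, sqrtKernelOp_sub hθ hC, g1, g2, ← covForm_neg_neg, neg_sub]

/-- Consistency of the segmentation algorithm outside an event of small probability. -/
theorem exists_event_localizes [IsProbabilityMeasure μ] (hd : DataAssumption μ X ε)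
    (hS : SpectralSystem μ (X 1) ψ θ r φ 𝔰) (B : ℝ) {ω : ℝ} (hω : 1 / 2 ≤ ω) : ∃ C : ℝ, 0 < C ∧
    ∀ (n : ℕ) (β : ℕ → L2 𝒯) (𝒦 : ℕ) (η : ℕ → ℕ), IsChangePoints n β 𝒦 η →
      (∀ j, 1 ≤ j → j ≤ n → InRKHS ψ θ (β j) ∧ rkhsNormSq ψ θ (β j) ≤ B) →
      ∀ (Δ : ℕ) (κsq : ℝ), Δ = minSpacing 𝒦 η → κsq = minJumpSq μ (X 1) β 𝒦 η →
      ∀ (M₀ J : ℕ) (x τ : ℝ), 200 ≤ Δ → 0 < κsq → n < 2 ^ J → 1 ≤ M₀ → 1 ≤ x →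
      (M₀ : ℝ) ≤ x * (Δ : ℝ) ^ (1 / (2 * r + 1)) →
      10 ^ 7 * (C * x * (Δ : ℝ) ^ (1 / (2 * r + 1))) ≤ κsq * Δ →
      300 * (C * x * (n : ℝ) ^ (1 / (2 * r + 1))
        + 1200 * (C * x * (Δ : ℝ) ^ (1 / (2 * r + 1)))) ≤ τ →
      τ ≤ κsq * Δ / 20 →
      ∃ Bd : Set Ω, μ Bd ≤ ENNReal.ofReal (C * (17 * ((n : ℝ) / Δ) * J * (1 / x + 1 / M₀))) ∧
        ∀ w ∉ Bd, ∀ S : Finset ℕ, FRBS (seededIntervals n Δ)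
            (scanStat ψ θ ω r (response β X ε w) (fun j => X j w)) τ 0 n S →
          Localizes S 𝒦 η (jumpSq μ (X 1) β η)
            (1200 * (C * x * (Δ : ℝ) ^ (1 / (2 * r + 1)))) := by
  obtain ⟨C, hC, hgood⟩ := exists_goodSample (B := B) hd hS hω
  obtain ⟨Cθ, hCθ⟩ := hS.theta_le
  refine ⟨C, hC, ?_⟩
  rintro n β 𝒦 η hcp hβ Δ κsq hΔdef hκdef M₀ J x τ hΔ hκ0 hJ hM₀ hx hM₀x hb hτ hτ'
  obtain ⟨G, hG1, hG2, hG3⟩ := hcp.exists_coef (μ := μ) hS.theta_nonneg hCθ hβ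
  have hsp : ∀ k ≤ 𝒦, η k + Δ ≤ η (k + 1) := fun k hk => hΔdef ▸ hcp.spacing hk
  have hκk : ∀ k, 1 ≤ k → k ≤ 𝒦 → κsq ≤ jumpSq μ (X 1) β η k := fun k h1 h2 =>
    hκdef ▸ minJumpSq_le h1 h2
  have hΔ0 : (0 : ℝ) < Δ := by exact_mod_cast (by omega : 0 < Δ)
  have hmul : (𝒦 + 1) * Δ ≤ n := by
    rw [hΔdef, ← hcp.last]; exact hcp.mul_minSpacing_le le_rfl
  have hΔn : Δ ≤ n := by nlinarith
  have h𝒦N : (𝒦 : ℝ) ≤ (n : ℝ) / Δ := by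
    rw [le_div_iff₀ hΔ0]
    exact_mod_cast (Nat.mul_le_mul_right Δ (Nat.le_succ 𝒦)).trans hmul
  set J₀ := seededIntervals n Δ with hJ₀
  -- Every interval to which an error bound is applied ends or starts at a seeded end point or at a
  -- change point. There are at most `(8 + 8 + 1) n/Δ` of these.
  set A : Finset ℕ := J₀.image Prod.fst ∪ J₀.image Prod.snd ∪ (Finset.Icc 1 𝒦).image η with hA
  have hcard : (A.card : ℝ) ≤ 17 * ((n : ℝ) / Δ) := by
    have h1 : A.card ≤ J₀.card + J₀.card + 𝒦 := by
      refine (Finset.card_union_le _ _).trans (add_le_add ((Finset.card_union_le _ _).trans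
        (add_le_add Finset.card_image_le Finset.card_image_le)) (Finset.card_image_le.trans ?_))
      rw [Nat.card_Icc]; omega
    have h2 : (A.card : ℝ) ≤ J₀.card + J₀.card + 𝒦 := by exact_mod_cast h1
    have h3 := card_seededIntervals_le (by omega : 1 ≤ Δ) hΔn
    linarith
  obtain ⟨Bd, hBd, hw⟩ := hgood n Δ 𝒦 M₀ J η β G (jumpSq μ (X 1) β η) A x (17 * ((n : ℝ) / Δ))
    hcp.zero hcp.last hsp (by omega) hcp.one_le hG1 hG2
    (fun k h1 h2 => ⟨hκ0.trans_le (hκk k h1 h2), hG3 (X 1) k h1 h2⟩)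
    (fun k h1 h2 => Finset.mem_union_right _ (Finset.mem_image_of_mem _
      (Finset.mem_Icc.2 ⟨h1, h2⟩))) hcard
    (h𝒦N.trans (by have : 0 ≤ (n : ℝ) / Δ := by positivity
                   linarith)) hJ hM₀ hx hM₀x
  refine ⟨Bd, hBd, fun w hwB S hFS => ?_⟩
  have hgs := hw w hwB
  have := hgs.localizes (τ := τ) (fun I hI => ⟨Finset.mem_union_left _ (Finset.mem_union_left _
      (Finset.mem_image_of_mem _ hI)), Finset.mem_union_left _ (Finset.mem_union_right _
      (Finset.mem_image_of_mem _ hI))⟩) hΔ (fun k h1 h2 => by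
        rw [max_self]
        exact hb.trans (mul_le_mul_of_nonneg_right (hκk k h1 h2) hΔ0.le))
      (by rw [max_self, max_eq_left hΔn]; exact hτ)
      (fun k h1 h2 => hτ'.trans (div_le_div_of_nonneg_right
        (mul_le_mul_of_nonneg_right (hκk k h1 h2) hΔ0.le) (by norm_num))) hFS
  rwa [max_self] at this

end Assembly

end FuncReg

open FuncReg

/-- Only monotonicity and subadditivity of μ are used, so the events `S n` need not be measurable.
-/
theorem FuncReg.tendsto_measure_one_of_compl {Ω : Type*} [MeasurableSpace Ω] {μ : Measure Ω}
    [IsProbabilityMeasure μ] {S : ℕ → Set Ω} {δ : ℕ → ℝ} (hδ : Tendsto δ atTop (𝓝 0))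
    (h : ∀ᶠ n in atTop, ∃ Bd : Set Ω, μ Bd ≤ ENNReal.ofReal (δ n) ∧ ∀ w ∉ Bd, w ∈ S n) :
    Tendsto (fun n => μ (S n)) atTop (𝓝 1) := by
  have h1 : Tendsto (fun n => 1 - ENNReal.ofReal (δ n)) atTop (𝓝 1) := by
    have := ENNReal.Tendsto.sub (tendsto_const_nhds (x := (1 : ENNReal)))
      (ENNReal.tendsto_ofReal hδ) (Or.inl ENNReal.one_ne_top)
    simpa using this
  refine tendsto_of_tendsto_of_tendsto_of_le_of_le' h1 tendsto_const_nhds ?_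
    (Eventually.of_forall fun n => prob_le_one)
  filter_upwards [h] with n ⟨Bd, hBd, hsub⟩
  rw [tsub_le_iff_right]
  calc (1 : ENNReal) = μ Set.univ := measure_univ.symm
    _ ≤ μ (S n ∪ Bd) := measure_mono fun w _ => by
        by_cases hw : w ∈ Bd
        · exact Or.inr hw
        · exact Or.inl (hsub w hw)
    _ ≤ μ (S n) + μ Bd := measure_union_le _ _
    _ ≤ _ := by gcongr

/-- With L = log n, the choices `x = N L^(1+ξ)` and `M₀ = ⌈N L²⌉` make the union bound O(`L^(-ξ) +
L^(-1)`). Since `x L^ξ = N L^(1+2ξ)`, the errors `C x n^q` and `C x Δ^q` lie a factor `L^ξ` below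
the threshold and the rate, so once `L^ξ` is large the constant C is harmless. -/
theorem FuncReg.exists_parameters {n Δ J : ℕ} {q ξ C κ κmax τ c₁ c₂ C₁ L N : ℝ} (hN : N = n / Δ)
    (hq0 : 0 < q) (hξ : 0 < ξ) (hC : 0 < C) (hκmax0 : 0 ≤ κmax) (hc₁ : 32 < c₁)
    (hc₂' : c₂ < 1 / 20) (hC₁ : 2 < C₁) (hΔn' : Δ ≤ n)
    (hsnr : 1 + κmax + 10 ^ 7 * C
      ≤ κ * (Δ : ℝ) ^ 2 / ((n : ℝ) * (n : ℝ) ^ q * L ^ (1 + 2 * ξ)))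
    (hκle : κ ≤ κmax) (hlogq : 2 * L ≤ (n : ℝ) ^ (q / 2)) (hL1 : 1 ≤ L)
    (hLξ : 1 + 10 ^ 6 * C ≤ L ^ ξ) (hn : (40000 : ℝ) ≤ n) (hJL : (J : ℝ) ≤ 3 * L)
    (hτ : c₁ * N * (n : ℝ) ^ q * L ^ (1 + 2 * ξ) < τ ∧ τ < c₂ * κ * Δ) :
    200 ≤ Δ ∧ 0 < κ ∧ ∃ (M₀ : ℕ) (x : ℝ), 1 ≤ M₀ ∧ 1 ≤ x ∧ (M₀ : ℝ) ≤ x * (Δ : ℝ) ^ q ∧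
      10 ^ 7 * (C * x * (Δ : ℝ) ^ q) ≤ κ * Δ ∧
      300 * (C * x * (n : ℝ) ^ q + 1200 * (C * x * (Δ : ℝ) ^ q)) ≤ τ ∧ τ ≤ κ * Δ / 20 ∧
      17 * N * J * (1 / x + 1 / M₀) ≤ 51 * ((L ^ ξ)⁻¹ + L⁻¹) ∧
      1200 * (C * x * (Δ : ℝ) ^ q) ≤ C₁ * N * (Δ : ℝ) ^ q * L ^ (1 + 2 * ξ) := by
  have hn0 : (0 : ℝ) < n := by linarith
  have hL0 : 0 < L := by linarith
  have hΔn : (Δ : ℝ) ≤ n := by exact_mod_cast hΔn'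
  -- the signal-to-noise condition
  have hL12 : L ^ (1 + 2 * ξ) = L * (L ^ ξ * L ^ ξ) := by
    rw [Real.rpow_add hL0, Real.rpow_one, two_mul, Real.rpow_add hL0]
  have hL1ξ : L ^ (1 + ξ) = L * L ^ ξ := by rw [Real.rpow_add hL0, Real.rpow_one]
  have hLξ0 : 0 < L ^ ξ := by positivity
  have hLξ1 : 1 ≤ L ^ ξ := by linarith
  have hnq : 1 ≤ (n : ℝ) ^ q := Real.one_le_rpow (by linarith) hq0.le
  have hsn1 := hsnr
  have hden : 0 < (n : ℝ) * (n : ℝ) ^ q * L ^ (1 + 2 * ξ) := by positivity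
  rw [le_div_iff₀ hden] at hsn1
  have hL12' : 1 ≤ L ^ (1 + 2 * ξ) := Real.one_le_rpow hL1 (by linarith)
  have hpos : 0 < κ * (Δ : ℝ) ^ 2 := by
    refine lt_of_lt_of_le ?_ hsn1
    positivity
  have hΔ2 : 0 < (Δ : ℝ) ^ 2 := by
    refine lt_of_le_of_ne (sq_nonneg _) fun h => ?_
    rw [← h, mul_zero] at hpos
    exact lt_irrefl _ hpos
  have hΔ0 : (0 : ℝ) < Δ := lt_of_le_of_ne (Nat.cast_nonneg _) fun h => by
    rw [← h] at hΔ2; norm_num at hΔ2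
  have hκ0 : 0 < κ := pos_of_mul_pos_left hpos hΔ2.le
  -- The jumps are bounded by `κmax`, so a large signal-to-noise ratio forces Δ to be at least √n.
  -- Hence powers of Δ dominate log n, which is what `M₀ ≤ x Δ^q` needs.
  have hΔsq : (n : ℝ) ≤ (Δ : ℝ) ^ 2 := by
    have h1 : κmax * n ≤ κmax * (Δ : ℝ) ^ 2 := by
      calc κmax * n ≤ (1 + κmax + 10 ^ 7 * C) * n := by gcongr; linarith
        _ ≤ (1 + κmax + 10 ^ 7 * C) * (n * (n : ℝ) ^ q * L ^ (1 + 2 * ξ)) := by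
            gcongr
            rw [mul_assoc]
            exact le_mul_of_one_le_right hn0.le (one_le_mul_of_one_le_of_one_le hnq hL12')
        _ ≤ κ * (Δ : ℝ) ^ 2 := hsn1
        _ ≤ κmax * (Δ : ℝ) ^ 2 := by gcongr
    exact le_of_mul_le_mul_left h1 (hκ0.trans_le hκle)
  have hΔ200 : 200 ≤ Δ := by
    have : (200 : ℝ) ≤ Δ := by
      refine le_of_sq_le_sq ?_ hΔ0.le
      linarith
    exact_mod_cast this
  have hΔq : 2 * L ≤ (Δ : ℝ) ^ q := by
    refine hlogq.trans ?_
    calc (n : ℝ) ^ (q / 2) ≤ ((Δ : ℝ) ^ 2) ^ (q / 2) :=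
          Real.rpow_le_rpow hn0.le hΔsq (by positivity)
      _ = (Δ : ℝ) ^ q := by
          rw [← Real.rpow_natCast, ← Real.rpow_mul hΔ0.le]
          congr 1
          push_cast
          ring
  have hΔqn : (Δ : ℝ) ^ q ≤ (n : ℝ) ^ q := Real.rpow_le_rpow hΔ0.le hΔn hq0.le
  have hΔq0 : 0 < (Δ : ℝ) ^ q := by positivity
  have hN1 : 1 ≤ N := by rw [hN, one_le_div hΔ0]; exact hΔn
  have hN0 : 0 < N := by linarith
  have hκΔ : (1 + κmax + 10 ^ 7 * C) * (N * (n : ℝ) ^ q * L ^ (1 + 2 * ξ)) ≤ κ * Δ := by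
    refine le_of_mul_le_mul_right ?_ hΔ0
    refine le_trans (le_of_eq ?_) (hsn1.trans (le_of_eq ?_))
    · rw [hN]; field_simp
    · ring
  -- the choice of the parameters
  set x : ℝ := N * L ^ (1 + ξ) with hx
  have hx1 : 1 ≤ x := one_le_mul_of_one_le_of_one_le hN1 (Real.one_le_rpow hL1 (by linarith))
  have hxL : x * L ^ ξ = N * L ^ (1 + 2 * ξ) := by rw [hx, hL1ξ, hL12]; ring
  set M₀ : ℕ := ⌈N * L ^ 2⌉₊ with hM₀
  have hNL : 1 ≤ N * L ^ 2 := one_le_mul_of_one_le_of_one_le hN1 (one_le_pow₀ hL1)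
  have hM₀l : N * L ^ 2 ≤ M₀ := Nat.le_ceil _
  have hM₀u : (M₀ : ℝ) ≤ 2 * (N * L ^ 2) := by
    have := Nat.ceil_lt_add_one (show 0 ≤ N * L ^ 2 by linarith)
    linarith
  have hM₀0 : (0 : ℝ) < M₀ := by linarith
  have hM₀x : (M₀ : ℝ) ≤ x * (Δ : ℝ) ^ q := by
    refine hM₀u.trans ?_
    rw [hx, hL1ξ]
    calc 2 * (N * L ^ 2) = N * L * 1 * (2 * L) := by ring
      _ ≤ N * L * L ^ ξ * (Δ : ℝ) ^ q := by gcongr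
      _ = _ := by ring
  have hxq : ∀ y : ℝ, 0 ≤ y → (1 + 10 ^ 6 * C) * (x * y) ≤ N * y * L ^ (1 + 2 * ξ) := by
    intro y hy
    calc (1 + 10 ^ 6 * C) * (x * y) ≤ L ^ ξ * (x * y) := by gcongr
      _ = x * L ^ ξ * y := by ring
      _ = _ := by rw [hxL]; ring
  have hxy0 : ∀ y : ℝ, 0 ≤ y → 0 ≤ x * y := fun y hy => mul_nonneg (by linarith) hy
  have q1 := hxq _ hΔq0.le
  have q2 := hxq ((n : ℝ) ^ q) (by positivity)
  have y1 := hxy0 _ hΔq0.le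
  have y2 : x * (Δ : ℝ) ^ q ≤ x * (n : ℝ) ^ q := mul_le_mul_of_nonneg_left hΔqn (by linarith)
  have hCx : ∀ y : ℝ, C * x * y = C * (x * y) := fun y => mul_assoc _ _ _
  set U : ℝ := N * (n : ℝ) ^ q * L ^ (1 + 2 * ξ) with hU
  have hU0 : 0 ≤ U := by positivity
  have h4 : 0 ≤ C * (x * (n : ℝ) ^ q) := by positivity
  have h5 := mul_le_mul_of_nonneg_left y2 hC.le
  have h6 : 0 ≤ x * (n : ℝ) ^ q := y1.trans y2
  refine ⟨hΔ200, hκ0, M₀, x, by exact_mod_cast hM₀0, hx1, hM₀x, ?_, ?_, ?_, ?_, ?_⟩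
  · refine le_trans ?_ hκΔ
    rw [hCx]
    have h7 : 0 ≤ κmax * U := by positivity
    have h8 : x * (n : ℝ) ^ q ≤ U := by linarith
    have h9 := mul_le_mul_of_nonneg_left h8 hC.le
    linarith
  · refine le_trans ?_ hτ.1.le
    rw [hCx, hCx]
    have h8 := mul_le_mul_of_nonneg_right hc₁.le hU0
    have h9 : c₁ * N * (n : ℝ) ^ q * L ^ (1 + 2 * ξ) = c₁ * U := by rw [hU]; ring
    rw [h9]
    linarith
  · refine hτ.2.le.trans ?_
    have h7 : 0 < κ * Δ := by positivity
    have := mul_le_mul_of_nonneg_right hc₂'.le h7.le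
    linarith
  · calc 17 * N * J * (1 / x + 1 / M₀)
        ≤ 17 * N * (3 * L) * (1 / x + 1 / (N * L ^ 2)) := by gcongr
      _ = 51 * ((L ^ ξ)⁻¹ + L⁻¹) := by
          rw [hx, hL1ξ]; field_simp
          ring
  · rw [hCx]
    have h7 : 0 ≤ N * (Δ : ℝ) ^ q * L ^ (1 + 2 * ξ) := by positivity
    have h8 := mul_le_mul_of_nonneg_right hC₁.le h7
    have h9 : 0 ≤ C * (x * (Δ : ℝ) ^ q) := by positivity
    linarith

theorem theorem1 {d : ℕ} (𝒯 : Set (Euc d)) (h𝒯 : IsCompact 𝒯)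
    -- the kernel and its eigensystem, which defines the RKHS
    (K : Euc d → Euc d → ℝ) (hK : IsKernel 𝒯 K)
    (ψ : HilbertBasis ℕ ℝ (L2 𝒯)) (θ : ℕ → ℝ) (hψ : IsEigensystem 𝒯 K ψ θ)
    -- covariates and noise
    {Ω : Type*} [MeasurableSpace Ω] (μ : Measure Ω) [IsProbabilityMeasure μ]
    (X : ℕ → Ω → L2 𝒯) (ε : ℕ → Ω → ℝ) (hdata : DataAssumption μ X ε)
    (r : ℝ) (hr : 1 < r) (hspec : SpectralDecay μ (X 1) ψ θ r)
    -- for every sample size `n`: slope functions `β n j` and change points `η n k`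
    (β : ℕ → ℕ → L2 𝒯) (𝒦 : ℕ → ℕ) (η : ℕ → ℕ → ℕ)
    (hcp : ∀ᶠ n in atTop, IsChangePoints n (β n) (𝒦 n) (η n))
    (hβ : ∃ B : ℝ, ∀ᶠ n in atTop, ∀ j, 1 ≤ j → j ≤ n →
      InRKHS ψ θ (β n j) ∧ rkhsNormSq ψ θ (β n j) ≤ B)
    -- `κ²` and `Δ`
    (κsq : ℕ → ℝ) (hκ : ∀ n, κsq n = minJumpSq μ (X 1) (β n) (𝒦 n) (η n))
    (Δ : ℕ → ℕ) (hΔ : ∀ n, Δ n = minSpacing (𝒦 n) (η n))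
    -- signal-to-noise condition
    (ξ : ℝ) (hξ : 0 < ξ)
    (hsnr : Tendsto (fun n : ℕ =>
      min (κsq n * (Δ n : ℝ) ^ 2 /
            ((n : ℝ) * (n : ℝ) ^ (1 / (2 * r + 1)) * Real.log n ^ (1 + 2 * ξ)))
          (κsq n * (Δ n : ℝ) ^ (r / (2 * r + 1)) / Real.log (Δ n) ^ (1 + 2 * ξ)))
      atTop atTop)
    -- tuning parameters
    (c₁ c₂ : ℝ) (hc₁ : 32 < c₁) (hc₂ : 0 < c₂) (hc₂' : c₂ < 1 / 20)
    (τ : ℕ → ℝ)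
    (hτ : ∀ᶠ n : ℕ in atTop,
      c₁ * ((n : ℝ) / Δ n) * (n : ℝ) ^ (1 / (2 * r + 1)) * Real.log n ^ (1 + 2 * ξ) < τ n ∧
      τ n < c₂ * κsq n * Δ n)
    (ω : ℝ) (hω : 1 / 2 < ω)
    (C₁ : ℝ) (hC₁ : 2 < C₁) (hC₁' : C₁ < c₁ / 16) :
    Tendsto (fun n : ℕ => μ {w | ∀ B : Finset ℕ,
        FRBS (seededIntervals n (Δ n))
            (scanStat ψ θ ω r (response (β n) X ε w) (fun j => X j w)) (τ n) 0 n B →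
          Localizes B (𝒦 n) (η n) (jumpSq μ (X 1) (β n) (η n))
            (C₁ * ((n : ℝ) / Δ n) * (Δ n : ℝ) ^ (1 / (2 * r + 1)) *
              Real.log n ^ (1 + 2 * ξ))})
      atTop (𝓝 1) := by
  obtain ⟨φ, 𝔰, hφ, hsum, a₀, b₀, ha₀, hdecay⟩ := hspec
  obtain ⟨Cθ, hCθ⟩ := hψ.exists_bound h𝒯 hK
  have hS : SpectralSystem μ (X 1) ψ θ r φ 𝔰 :=
    { theta_nonneg := hψ.nonneg
      theta_le := ⟨Cθ, hCθ⟩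
      one_lt := hr
      orthonormal := hφ
      hasSum := hsum
      pos := fun l => lt_of_lt_of_le (by positivity) (hdecay l).1
      decay := ⟨b₀, fun l => (hdecay l).2⟩ }
  obtain ⟨B, hβ⟩ := hβ
  obtain ⟨C, hC, hmain⟩ := exists_event_localizes hdata hS B hω.le
  obtain ⟨S, hS0, hSle⟩ := hS.exists_covForm_le
  set q : ℝ := 1 / (2 * r + 1) with hq
  have hq0 : 0 < q := by positivity
  set κmax : ℝ := S * (4 * |B|) with hκmax
  have hκmax0 : 0 ≤ κmax := by positivity
  have hcast : Tendsto (fun n : ℕ => (n : ℝ)) atTop atTop := tendsto_natCast_atTop_atTop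
  have hlog : Tendsto (fun n : ℕ => Real.log n) atTop atTop := Real.tendsto_log_atTop.comp hcast
  have hlogξ : Tendsto (fun n : ℕ => Real.log n ^ ξ) atTop atTop :=
    (tendsto_rpow_atTop hξ).comp hlog
  have hlogq : ∀ᶠ n : ℕ in atTop, 2 * Real.log n ≤ (n : ℝ) ^ (q / 2) := by
    have h1 := (isLittleO_log_rpow_atTop (show 0 < q / 2 by positivity)).bound
      (show (0 : ℝ) < 1 / 2 by norm_num)
    filter_upwards [hcast.eventually h1, hcast.eventually_ge_atTop 1] with n hn hn1
    rw [Real.norm_of_nonneg (Real.log_nonneg hn1), Real.norm_of_nonneg (by positivity)] at hn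
    linarith
  refine tendsto_measure_one_of_compl
    (δ := fun n => C * (51 * ((Real.log n ^ ξ)⁻¹ + (Real.log n)⁻¹))) ?_ ?_
  · have := ((tendsto_inv_atTop_zero.comp hlogξ).add (tendsto_inv_atTop_zero.comp hlog)).const_mul 51
      |>.const_mul C
    simpa using this
  filter_upwards [hcp, hβ, hτ, hsnr.eventually_ge_atTop (1 + κmax + 10 ^ 7 * C), hlogq,
    hlog.eventually_ge_atTop 1, hlogξ.eventually_ge_atTop (1 + 10 ^ 6 * C),
    hcast.eventually_ge_atTop 40000] with n hcp hβ hτ hsnr hlogq hL1 hLξ hn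
  have hmul : 1 * Δ n ≤ n := by
    have := hcp.mul_minSpacing_le (k := 𝒦 n + 1) le_rfl
    rw [hcp.last, ← hΔ] at this
    exact (Nat.mul_le_mul_right _ (by omega)).trans this
  rw [one_mul] at hmul
  -- the jumps are bounded
  have hκle : κsq n ≤ κmax := by
    obtain ⟨G, -, hG2, hG3⟩ := hcp.exists_coef (μ := μ) hψ.nonneg hCθ hβ
    have h1 := minJumpSq_le (μ := μ) (X₁ := X 1) (β := β n) (η := η n) le_rfl hcp.one_le
    rw [← hκ, hG3 (X 1) 1 le_rfl hcp.one_le] at h1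
    refine h1.trans ((hSle _).trans (mul_le_mul_of_nonneg_left ?_ hS0.le))
    have g1 := hG2 1 hcp.one_le
    have g0 := hG2 0 (Nat.zero_le _)
    have a3 := pow_le_pow_left₀ (norm_nonneg _) (norm_sub_le (G 1) (G (1 - 1))) 2
    have a4 := le_abs_self B
    simp only [Nat.sub_self] at a3 ⊢
    nlinarith [sq_nonneg (‖G 1‖ - ‖G 0‖)]
  have hJ : n < 2 ^ (Nat.log 2 n + 1) := Nat.lt_pow_succ_log_self (by norm_num) n
  have hJL : ((Nat.log 2 n + 1 : ℕ) : ℝ) ≤ 3 * Real.log n := by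
    have h1 := Real.natLog_le_logb n 2
    have h2 : Real.logb 2 n ≤ 2 * Real.log n := by
      rw [Real.logb, div_le_iff₀ (Real.log_pos (by norm_num))]
      have := Real.log_two_gt_d9
      nlinarith
    push_cast at h1 ⊢
    linarith
  obtain ⟨hΔ200, hκ0, M₀, x, hM₀, hx, hM₀x, b1, b2, b3, b4, b5⟩ := exists_parameters rfl hq0 hξ hC
    hκmax0 hc₁ hc₂' hC₁ hmul (hsnr.trans (min_le_left _ _)) hκle hlogq hL1 hLξ hn hJL hτ
  obtain ⟨Bd, hBd, hgood⟩ := hmain n (β n) (𝒦 n) (η n) hcp hβ (Δ n) (κsq n) (hΔ n) (hκ n) M₀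
    (Nat.log 2 n + 1) x (τ n) hΔ200 hκ0 hJ hM₀ hx hM₀x b1 b2 b3
  exact ⟨Bd, hBd.trans (ENNReal.ofReal_le_ofReal (mul_le_mul_of_nonneg_left b4 hC.le)),
    fun w hw D hD => (hgood w hw D hD).mono b5⟩
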